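/- **Theorem (Quad-mesh metric).** Let $(S,\mathcal Q)$ be a finite oriented quadrilateral mesh: $S$ is a compact oriented surface, possibly with boundary, obtained from finitely many faces, each parametrized by the unit square $[0,1]^2$, by gluing sides in pairs (orientation-compatibly, sides of the same face being allowed); unglued sides are the boundary edges and form $\partial S$. Give every face the metric of a unit Euclidean square, and let $\mathbf g$ be the induced metric on $S$, in which the distance of two points is the infimum of the lengths of broken lines made of straight segments in faces. The valence $\mathrm{Val}(v)$ of a vertex is the number of face corners at $v$; its index is $\mathrm{Ind}(v)=4-\mathrm{Val}(v)$ if $v\notin\partial S$ and $\mathrm{Ind}(v)=2-\mathrm{Val}(v)$ if $v\in\partial S$. Let $\Gamma$ be the set of singularities, i.e. of vertices of nonzero index. The curvature $K(v)$ is $2\pi$ (for $v\in\partial S$: $\pi$) minus the sum of the face angles at $v$. Then: 1. (Gauss–Bonnet condition) Every point of $S\setminus\Gamma$ has a neighbourhood isometric, under $\mathbf g$, to an open subset of the Euclidean plane or, for boundary points, of a closed half-plane, boundary corresponding to boundary. $\Gamma$ is finite, $K(v)=\mathrm{Ind}(v)\,\pi/2$ for every vertex $v$, and $\sum_{v\in\Gamma}K(v)=2\pi\chi(S)$,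 where $\chi(S)=V-E+F$. 2. (Holonomy condition) For every face $\sigma$, the holonomy group based at $\sigma$, consisting of the rotations obtained by parallel transport along closed face paths from $\sigma$ to $\sigma$ (at each step two neighbouring squares are placed in the plane with their common edge and the vector is translated), is contained in $\mathcal R=\{e^{ik\pi/2}\}$. The crosses whose arms are the unit vectors parallel to the edges of the faces form a global smooth cross field: parallel transport along any face path from $\sigma$ to $\tau$ takes the cross of $\sigma$ to the cross of $\tau$, and around every point of $S\setminus\Gamma$ there is a flat chart as in 1 in which the cross field is the constant cross with arms $\pm1,\pm i$. 3. (Boundary alignment condition) Every boundary edge is parallel or orthogonal to each arm of the cross of its face. 4. (Finite geodesic lamination condition) Consider the arc-length parametrized geodesics of $\mathbf g$ that are parallel to the cross field and avoid $\Gamma$ except possibly at their end points. Every segment in a face parallel to an edge is such a geodesic; every such geodesic extends to one that cannot be continued; and each one that cannot be continued either is a closed loop (defined on $\mathbb R$ and periodic) or is defined on a compact interval $[a,b]$ and has both end points in $\partial S\cup\Gamma$. -/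

import Mathlib

open Set Topology
open scoped ENNReal

/-- The closed unit square of the Euclidean plane, the plane being `ℂ` with its usual norm. -/
def unitSquare : Set ℂ := {z | z.re ∈ Icc (0 : ℝ) 1 ∧ z.im ∈ Icc (0 : ℝ) 1}

/-- The corners of the unit square, in counterclockwise order. -/
def corner : Fin 4 → ℂ := ![0, 1, 1 + Complex.I, Complex.I]

/-- The `i`-th side of the unit square, parametrized over `[0, 1]` from `corner i` to
`corner (i + 1)`; indices are taken modulo 4. -/
noncomputable def sidePt (i : Fin 4) (t : ℝ) : ℂ := AffineMap.lineMap (corner i) (corner (i + 1)) t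

/-- The direction vector of the `i`-th side. -/
def sideDir (i : Fin 4) : ℂ := corner (i + 1) - corner i

/-- The elementary identifications made when the sides of a family of squares are glued according
to `mate`: the side `(f, i)` is glued to the side `mate (f, i)` if these are different sides,
with the opposite sense of traversal (so that the counterclockwise orientations of the squares
agree along the common edge). A side that is its own mate is not glued to anything. -/
inductive SideGlue {F : Type*} (mate : F × Fin 4 → F × Fin 4) : F × ℂ → F × ℂ → Prop
  | glue (f : F) (i : Fin 4) (g : F) (j : Fin 4) (t : ℝ) (ht : t ∈ Icc (0 : ℝ) 1)
      (hmate : mate (f, i) = (g, j)) (hne : (f, i) ≠ (g, j)) :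
      SideGlue mate (f, sidePt i t) (g, sidePt j (1 - t))

/-- An (oriented) quadrilateral mesh on the space `S` with set of faces `F`: a cell partition of
`S` into quadrilaterals. Every face `f` is a quadrilateral, parametrized by the unit square
through `param f`; the faces cover `S`, and two points of the squares are the same
point of `S` exactly if they are identified by the gluing of the sides in pairs. A side which is
its own mate is a boundary edge. Different sides of one face may be glued to each other. -/
structure QuadMesh (S F : Type*) [TopologicalSpace S] where
  /-- the side which is glued to a given side; the side itself for a boundary edge -/
  mate : F × Fin 4 → F × Fin 4
  mate_mate : ∀ s, mate (mate s) = s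
  /-- the parametrization of a face by the unit square; its values off the square are irrelevant -/
  param : F → ℂ → S
  continuousOn_param : ∀ f, ContinuousOn (param f) unitSquare
  exists_param : ∀ p, ∃ f, ∃ z ∈ unitSquare, param f z = p
  param_eq_iff : ∀ f g, ∀ z ∈ unitSquare, ∀ w ∈ unitSquare,
    param f z = param g w ↔ Relation.EqvGen (SideGlue mate) (f, z) (g, w)

namespace QuadMesh

variable {S F : Type*} [TopologicalSpace S] (Q : QuadMesh S F)

/-! ### Cells, boundary, Euler characteristic, singularities -/

/-- The vertices of the mesh. -/
def vertices : Set S := range fun s : F × Fin 4 => Q.param s.1 (corner s.2)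

/-- The closed edge of the mesh which is the image of the side `s`. -/
def edge (s : F × Fin 4) : Set S := (fun t => Q.param s.1 (sidePt s.2 t)) '' Icc (0 : ℝ) 1

/-- The boundary of the surface: the union of the boundary edges. -/
def boundary : Set S := {p | ∃ s, Q.mate s = s ∧ p ∈ Q.edge s}

/-- The Euler characteristic `V - E + F` of the surface. -/
noncomputable def eulerChar : ℤ :=
  (Q.vertices.ncard : ℤ) - ((range Q.edge).ncard : ℤ) + (Nat.card F : ℤ)

/-- The corners of faces that lie at a given point. -/
def cornersAt (v : S) : Set (F × Fin 4) := {s | Q.param s.1 (corner s.2) = v}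

/-- The topological valence of a vertex: the number of faces around it (a face is counted once for
each of its corners at the vertex). -/
noncomputable def valence (v : S) : ℕ := (Q.cornersAt v).ncard

open Classical in
/-- The index of a vertex. -/
noncomputable def index (v : S) : ℤ :=
  if v ∈ Q.boundary then 2 - (Q.valence v : ℤ) else 4 - (Q.valence v : ℤ)

/-- The singularities: the interior vertices of valence different from 4 and the boundary vertices
of valence different from 2. -/
def singularSet : Set S :=
  {v | v ∈ Q.vertices ∧
    ((v ∉ Q.boundary ∧ Q.valence v ≠ 4) ∨ (v ∈ Q.boundary ∧ Q.valence v ≠ 2))}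

/-! ### The quad-mesh metric -/

/-- The length of a shortest straight segment between two points inside one of the faces, each face
carrying the metric of the unit square (`∞` if no face contains both points). -/
noncomputable def segmentLength (p q : S) : ℝ≥0∞ :=
  ⨅ (f : F) (z : ℂ) (w : ℂ) (_ : z ∈ unitSquare) (_ : w ∈ unitSquare)
    (_ : Q.param f z = p) (_ : Q.param f w = q), edist z w

/-- The quad-mesh metric: the infimum of the lengths of broken lines from `p` to `q` which consist
of straight segments inside faces (`∞` between different components). -/
noncomputable def meshDist (p q : S) : ℝ≥0∞ :=
  ⨅ (n : ℕ) (c : ℕ → S) (_ : c 0 = p) (_ : c n = q),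
    ∑ k ∈ Finset.range n, Q.segmentLength (c k) (c (k + 1))

open Classical in
/-- The curvature measure at a vertex: `2π` (for boundary vertices `π`) minus the sum of
the angles of the faces at the vertex. -/
noncomputable def curvature (v : S) : ℝ :=
  (if v ∈ Q.boundary then Real.pi else 2 * Real.pi) -
    ∑ᶠ s ∈ Q.cornersAt v,
      EuclideanGeometry.angle (corner (s.2 - 1)) (corner s.2) (corner (s.2 + 1))

/-- `e` is a flat chart of the surface, with values in the region `H` of the Euclidean plane:
`e` is an isometry for the quad-mesh metric and takes boundary points to boundary points. -/
structure IsFlatChart {H : Set ℂ} (e : OpenPartialHomeomorph S H) : Prop where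
  isometry : ∀ p ∈ e.source, ∀ q ∈ e.source, Q.meshDist p q = edist (e p) (e q)
  boundary_iff : ∀ p ∈ e.source, p ∈ Q.boundary ↔ (e p : ℂ) ∈ frontier H

open Classical in
/-- The model of the surface near a point: the plane for interior points, a closed half-plane for
boundary points. -/
noncomputable def localModel (p : S) : Set ℂ :=
  if p ∈ Q.boundary then {z | 0 ≤ z.im} else univ

/-! ### Parallel transport and holonomy -/

/-- The rigid motion `T` places the square of the face beyond the side `s` in the plane in such a
way that it shares exactly the side `s` with the square of the face of `s`. -/
structure IsUnfolding (s : F × Fin 4) (T : ℂ ≃ᵃⁱ[ℝ] ℂ) : Prop where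
  common_edge : ∀ t ∈ Icc (0 : ℝ) 1, T (sidePt (Q.mate s).2 (1 - t)) = sidePt s.2 t
  disjoint : Disjoint (T '' interior unitSquare) (interior unitSquare)

/-- `Q.Transport f g A`: the linear map `A` is the parallel transport, from tangent vectors of the
face `f` to tangent vectors of the face `g`, along some face path from `f` to `g`. In every step
two neighbouring faces are placed in the plane with a common edge, and the vector is
translated from the first to the second. -/
inductive Transport (f : F) : F → (ℂ ≃ₗᵢ[ℝ] ℂ) → Prop
  | nil : Transport f f 1
  | step (g h : F) (i j : Fin 4) (A : ℂ ≃ₗᵢ[ℝ] ℂ) (T : ℂ ≃ᵃⁱ[ℝ] ℂ)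
      (path : Transport f g A) (hmate : Q.mate (g, i) = (h, j)) (hne : (g, i) ≠ (h, j))
      (hT : Q.IsUnfolding (g, i) T) :
      Transport f h (T.linearIsometryEquiv.symm * A)

variable {Q}

theorem Transport.comp {f g h : F} {A B : ℂ ≃ₗᵢ[ℝ] ℂ} (hA : Q.Transport f g A)
    (hB : Q.Transport g h B) : Q.Transport f h (B * A) := by
  induction hB with
  | nil => simpa using hA
  | step k l i j B T _ hmate hne hT ih =>
    rw [mul_assoc]
    exact Transport.step _ _ _ _ _ T ih hmate hne hT

theorem IsUnfolding.inverse {s : F × Fin 4} {T : ℂ ≃ᵃⁱ[ℝ] ℂ} (hT : Q.IsUnfolding s T) :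
    Q.IsUnfolding (Q.mate s) T.symm := by
  refine ⟨fun t ht => ?_, ?_⟩
  · rw [Q.mate_mate, AffineIsometryEquiv.symm_apply_eq]
    have h := hT.common_edge (1 - t) ⟨by linarith [ht.2], by linarith [ht.1]⟩
    simpa using h.symm
  · rw [Set.disjoint_left]
    rintro _ ⟨z, hz, rfl⟩ hw
    exact Set.disjoint_left.1 hT.disjoint ⟨_, hw, T.apply_symm_apply z⟩ hz

theorem Transport.inverse {f g : F} {A : ℂ ≃ₗᵢ[ℝ] ℂ} (hA : Q.Transport f g A) :
    Q.Transport g f A⁻¹ := by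
  induction hA with
  | nil => simpa using Transport.nil
  | step g h i j A T _ hmate hne hT ih =>
    have hinv := hT.inverse
    have hback : Q.mate (h, j) = (g, i) := by rw [← hmate, Q.mate_mate]
    rw [hmate] at hinv
    have hstep := Transport.step h g j i 1 T.symm Transport.nil hback hne.symm hinv
    have := hstep.comp ih
    rw [mul_inv_rev]
    rw [mul_one] at this
    exact this

variable (Q)

/-- The holonomy group based at the face `f`: the rotations that arise from parallel transport
along closed face paths from `f` to `f`. -/
def holonomyGroup (f : F) : Subgroup (ℂ ≃ₗᵢ[ℝ] ℂ) where
  carrier := {A | Q.Transport f f A}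
  one_mem' := Transport.nil
  mul_mem' := fun hA hB => hB.comp hA
  inv_mem' := fun hA => hA.inverse

/-! ### The cross field -/

/-- The cross in the face `f`, given by its arms: the unit vectors parallel to edges of `f`. -/
def crossField (_Q : QuadMesh S F) (_f : F) : Set ℂ :=
  {u | ‖u‖ = 1 ∧ ∃ (i : Fin 4) (r : ℝ), u = r • sideDir i}

/-- In the chart `e` the cross field is the constant standard cross: in
a neighbourhood of each point of a face, `e` is a Euclidean motion on that face, and its linear
part carries the cross of the face to the cross with the arms `±1, ±i`. -/
def CrossFieldConstantIn {H : Set ℂ} (e : OpenPartialHomeomorph S H) : Prop :=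
  ∀ (f : F), ∀ z ∈ unitSquare, Q.param f z ∈ e.source → ∃ A : ℂ ≃ₗᵢ[ℝ] ℂ,
    (∀ᶠ w in 𝓝[unitSquare] z, (e (Q.param f w) : ℂ) = e (Q.param f z) + A (w - z)) ∧
    A '' Q.crossField f = {1, Complex.I, -1, -Complex.I}

/-! ### Geodesics parallel to the edges -/

/-- `γ`, restricted to the interval `I`, is a geodesic of the quad-mesh metric (parametrized by arc
length) which is parallel to the cross field and meets no singularity except possibly at its end
points. -/
structure IsEdgeParallelGeodesic (γ : ℝ → S) (I : Set ℝ) : Prop where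
  ordConnected : I.OrdConnected
  nontrivial : I.Nontrivial
  /-- geodesic: locally the distance along `γ` is the distance in the surface -/
  geodesic : ∀ t ∈ I, ∃ ε > 0, ∀ s ∈ I, ∀ s' ∈ I, |s - t| < ε → |s' - t| < ε →
    Q.meshDist (γ s) (γ s') = ENNReal.ofReal |s - s'|
  /-- a short piece of `γ` that is a straight segment in a face is parallel to the cross there -/
  parallel : ∀ t ∈ I, ∃ ε > 0, ∀ s ∈ I, ∀ s' ∈ I, |s - t| < ε → |s' - t| < ε →
    ∀ (f : F), ∀ z ∈ unitSquare, ∀ w ∈ unitSquare,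
      Q.param f z = γ s → Q.param f w = γ s' → dist z w = |s - s'| →
      ∃ u ∈ Q.crossField f, ∃ r : ℝ, w - z = r • u
  regular : ∀ t ∈ interior I, γ t ∉ Q.singularSet

/-- An edge-parallel geodesic that cannot be continued. -/
structure IsMaximalEdgeParallelGeodesic (γ : ℝ → S) (I : Set ℝ) : Prop
    extends Q.IsEdgeParallelGeodesic γ I where
  maximal : ∀ (γ' : ℝ → S) (I' : Set ℝ), Q.IsEdgeParallelGeodesic γ' I' →
    I ⊆ I' → EqOn γ γ' I → I' = I

end QuadMesh

/-- A cross, given by its four arms: unit vectors at right angles. -/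
def IsCross (C : Set ℂ) : Prop :=
  ∃ u : ℂ, ‖u‖ = 1 ∧ C = {u, Complex.I * u, -u, -(Complex.I * u)}

/-- The group of the rotations of the plane by multiples of `π / 2`. -/
noncomputable def quarterTurns : Subgroup (ℂ ≃ₗᵢ[ℝ] ℂ) :=
  Subgroup.zpowers (rotation (Circle.exp (Real.pi / 2)))

/-!
The surface is the quotient of the disjoint union of the squares by the gluing of the sides. The
only access to this quotient is the principle `QuadMesh.mem_of_param_eq`: a set of points of the
squares that is closed under crossing glued sides is a union of fibres. With it one computes the
fibres, constructs functions on the surface from functions on the squares, and enumerates the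
corners around a vertex, which are permuted by `QuadMesh.nextCorner`.

*Gauss-Bonnet.* All face angles are right angles, hence the curvature is the index times `π / 2`.
Counting the corners and the sides in two ways, and using that the boundary has as many vertices as
edges, one finds that the indices add up to `4 χ`.

*Flat charts and the cross field.* Around a point that is not singular the squares can be laid out
in the plane by translations and quarter turns, so that they tile a disc, or a half-disc for a
boundary point (`QuadMesh.IsLayout`); the point may lie inside a face, on a side or at a vertex
with four, on the boundary two, corners. The layout is an isometry near the point. Distances in the
plane bound the quad-mesh metric from above, because a straight line in the plane can be followed
face by face (`QuadMesh.meshDist_le_of_local`); they bound it from below, because a cut-off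
distance function in the plane lifts to a function on the surface which does not increase lengths
(`QuadMesh.IsSeparating.exists_bump`, `QuadMesh.exists_descent`). As the metric induces the
topology of the surface (`QuadMesh.nhds_hasBasis`), the developing map `QuadMesh.IsDeveloping` is a
flat chart. It turns every face by a multiple of a right angle, and such rotations preserve the
cross with arms `±1`, `±i`, which is the cross of every face. In the same way a rigid motion that
unfolds a neighbouring square is a rotation by a multiple of a right angle, which gives the
statements on parallel transport (`QuadMesh.Transport.exists_rotation`).

*Geodesics.* Under a developing map the edge-parallel geodesics become the axis-parallel straight
lines (`QuadMesh.IsEdgeParallelGeodesic.exists_straight`,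
`QuadMesh.IsDeveloping.geodesic_of_straight`), so that they are determined by any short piece
(`QuadMesh.eqOn_of_eqOn_Ioo`) and can be glued along overlaps. A segment in a face along a side may
end at a singularity, but there it is radial, and distances along it are those in the face. Maximal
continuations exist by Zorn's lemma. A geodesic crosses the squares one after the other on
axis-parallel lines. Gluing takes a coordinate `y` to `y`, `1 - y`, `0` or `1`, so that the
coordinates of the points of passage form a finite set
(`QuadMesh.IsEdgeParallelGeodesic.exists_germTimes`). Consequently the straight pieces have a
minimal length, and there are only finitely many ways to enter a face. If the geodesic can be
followed for ever, it therefore enters some face twice in the same way, and by unique continuation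
it is periodic (`QuadMesh.IsEdgeParallelGeodesic.exists_period`). Otherwise it has a last straight
piece, whose end belongs to a maximal geodesic, and there the geodesic could be continued in a flat
chart unless the end is a singularity or a boundary point
(`QuadMesh.IsMaximalEdgeParallelGeodesic.exists_end`).
-/

/-! ### The unit square and its sides -/

/-- The four unit vectors parallel to the coordinate axes: the arms of the standard cross. -/
def axisUnits : Set ℂ := {1, Complex.I, -1, -Complex.I}

theorem norm_of_mem_axisUnits {u : ℂ} (hu : u ∈ axisUnits) : ‖u‖ = 1 := by
  rcases hu with rfl | rfl | rfl | rfl <;> simp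

theorem ne_zero_of_mem_axisUnits {u : ℂ} (hu : u ∈ axisUnits) : u ≠ 0 := by
  rw [← norm_ne_zero_iff, norm_of_mem_axisUnits hu]; exact one_ne_zero

theorem mul_mem_axisUnits {u v : ℂ} (hu : u ∈ axisUnits) (hv : v ∈ axisUnits) :
    u * v ∈ axisUnits := by
  rcases hu with rfl | rfl | rfl | rfl <;> rcases hv with rfl | rfl | rfl | rfl <;>
    simp [axisUnits]

theorem neg_mem_axisUnits {u : ℂ} (hu : u ∈ axisUnits) : -u ∈ axisUnits := by
  rcases hu with rfl | rfl | rfl | rfl <;> simp [axisUnits]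

theorem inv_mem_axisUnits {u : ℂ} (hu : u ∈ axisUnits) : u⁻¹ ∈ axisUnits := by
  rcases hu with rfl | rfl | rfl | rfl <;> simp [axisUnits]

theorem mul_image_axisUnits {a : ℂ} (ha : a ∈ axisUnits) :
    (fun u => a * u) '' axisUnits = axisUnits := by
  apply Subset.antisymm
  · rintro _ ⟨u, hu, rfl⟩
    exact mul_mem_axisUnits ha hu
  · intro u hu
    exact ⟨a⁻¹ * u, mul_mem_axisUnits (inv_mem_axisUnits ha) hu, by
      simp [mul_inv_cancel_left₀ (ne_zero_of_mem_axisUnits ha)]⟩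

theorem mem_unitSquare {z : ℂ} :
    z ∈ unitSquare ↔ (0 ≤ z.re ∧ z.re ≤ 1) ∧ (0 ≤ z.im ∧ z.im ≤ 1) := Iff.rfl

theorem convex_unitSquare : Convex ℝ unitSquare := by
  have : unitSquare = (Complex.reCLM ⁻¹' Icc 0 1) ∩ (Complex.imCLM ⁻¹' Icc 0 1) := rfl
  rw [this]
  exact ((convex_Icc 0 1).is_linear_preimage Complex.reCLM.isBoundedLinearMap.toIsLinearMap).inter
    ((convex_Icc 0 1).is_linear_preimage Complex.imCLM.isBoundedLinearMap.toIsLinearMap)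

theorem isClosed_unitSquare : IsClosed unitSquare :=
  (isClosed_Icc.preimage Complex.continuous_re).inter (isClosed_Icc.preimage Complex.continuous_im)

theorem isCompact_unitSquare : IsCompact unitSquare := by
  refine Metric.isCompact_of_isClosed_isBounded isClosed_unitSquare ?_
  rw [isBounded_iff_forall_norm_le]
  refine ⟨2, fun z hz => ?_⟩
  obtain ⟨⟨h1, h2⟩, h3, h4⟩ := mem_unitSquare.1 hz
  have := Complex.norm_le_abs_re_add_abs_im z
  rw [abs_of_nonneg h1, abs_of_nonneg h3] at this
  linarith

theorem corner_succ (i : Fin 4) : corner (i + 1) = corner i + sideDir i := by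
  simp [sideDir]

theorem sideDir_mem_axisUnits (i : Fin 4) : sideDir i ∈ axisUnits := by
  fin_cases i <;> simp [sideDir, corner, axisUnits]

theorem sideDir_ne_zero (i : Fin 4) : sideDir i ≠ 0 :=
  ne_zero_of_mem_axisUnits (sideDir_mem_axisUnits i)

theorem norm_sideDir (i : Fin 4) : ‖sideDir i‖ = 1 :=
  norm_of_mem_axisUnits (sideDir_mem_axisUnits i)

theorem sideDir_succ (i : Fin 4) : sideDir (i + 1) = Complex.I * sideDir i := by
  fin_cases i <;> simp [sideDir, corner]

theorem exists_sideDir_eq {u : ℂ} (hu : u ∈ axisUnits) : ∃ i, u = sideDir i := by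
  rcases hu with rfl | rfl | rfl | rfl
  · exact ⟨0, by simp [sideDir, corner]⟩
  · exact ⟨1, by simp [sideDir, corner]⟩
  · exact ⟨2, by simp [sideDir, corner]⟩
  · exact ⟨3, by simp [sideDir, corner]⟩

theorem sidePt_eq (i : Fin 4) (t : ℝ) : sidePt i t = corner i + sideDir i * t := by
  simp [sidePt, AffineMap.lineMap_apply, sideDir, mul_comm, add_comm]

theorem sidePt_zero (i : Fin 4) : sidePt i 0 = corner i := by simp [sidePt_eq]

theorem sidePt_one (i : Fin 4) : sidePt i 1 = corner (i + 1) := by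
  simp [sidePt_eq, corner_succ]

theorem sidePt_sub (i : Fin 4) (t t' : ℝ) :
    sidePt i t - sidePt i t' = sideDir i * ((t - t' : ℝ) : ℂ) := by
  rw [sidePt_eq, sidePt_eq]; push_cast; ring

theorem dist_sidePt (i : Fin 4) (t t' : ℝ) : dist (sidePt i t) (sidePt i t') = |t - t'| := by
  rw [dist_eq_norm, sidePt_sub, norm_mul, norm_sideDir, one_mul, Complex.norm_real,
    Real.norm_eq_abs]

/-- The square looks the same from each of its corners. -/
theorem corner_add_mul_mem (i : Fin 4) (x : ℂ) :
    corner i + sideDir i * x ∈ unitSquare ↔ x ∈ unitSquare := by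
  fin_cases i <;> simp [sideDir, corner, mem_unitSquare] <;> grind

theorem corner_add_mul_sidePt (i k : Fin 4) (t : ℝ) :
    corner i + sideDir i * sidePt k t = sidePt (i + k) t := by
  fin_cases i <;> fin_cases k <;> simp [sidePt_eq, sideDir, corner, Complex.ext_iff]

theorem sidePt_mem_iff (i : Fin 4) (t : ℝ) : sidePt i t ∈ unitSquare ↔ t ∈ Icc (0 : ℝ) 1 := by
  rw [sidePt_eq, corner_add_mul_mem]
  simp [mem_unitSquare]

theorem sidePt_mem (i : Fin 4) {t : ℝ} (ht : t ∈ Icc (0 : ℝ) 1) : sidePt i t ∈ unitSquare :=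
  (sidePt_mem_iff i t).2 ht

theorem corner_mem (i : Fin 4) : corner i ∈ unitSquare := by
  rw [← sidePt_zero]; exact sidePt_mem i (by simp)

theorem sidePt_injective (i : Fin 4) : Function.Injective (sidePt i) := by
  intro t t' h
  have := dist_sidePt i t t'
  rw [h, dist_self] at this
  linarith [abs_eq_zero.1 this.symm]

theorem corner_injective : Function.Injective corner := by
  intro i j
  fin_cases i <;> fin_cases j <;> simp [corner, Complex.ext_iff]

/-- An interior point of a side lies on no other side. -/
theorem sidePt_eq_sidePt {i j : Fin 4} {t t' : ℝ} (ht : t ∈ Ioo (0 : ℝ) 1)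
    (ht' : t' ∈ Icc (0 : ℝ) 1) (h : sidePt i t = sidePt j t') : i = j ∧ t = t' := by
  obtain ⟨h1, h2⟩ := ht
  obtain ⟨h3, h4⟩ := ht'
  have key : i = j := by
    by_contra hij
    revert h hij
    fin_cases i <;> fin_cases j <;>
      simp [sidePt_eq, sideDir, corner, Complex.ext_iff] <;> intros <;> linarith
  subst key
  exact ⟨rfl, sidePt_injective i h⟩

theorem sidePt_eq_corner {i j : Fin 4} {t : ℝ} (ht : t ∈ Icc (0 : ℝ) 1)
    (h : sidePt i t = corner j) : (t = 0 ∧ j = i) ∨ (t = 1 ∧ j = i + 1) := by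
  rcases eq_or_lt_of_le ht.1 with h0 | h0
  · subst h0
    rw [sidePt_zero] at h
    exact Or.inl ⟨rfl, (corner_injective h).symm⟩
  rcases eq_or_lt_of_le ht.2 with h1 | h1
  · subst h1
    rw [sidePt_one] at h
    exact Or.inr ⟨rfl, (corner_injective h).symm⟩
  rw [← sidePt_zero] at h
  have := (sidePt_eq_sidePt ⟨h0, h1⟩ (by simp) h).2
  linarith

/-- The points of the square at which a coordinate is `0` or `1` are the points of the sides. -/
theorem exists_sidePt {z : ℂ} (hz : z ∈ unitSquare)
    (h : z.re = 0 ∨ z.re = 1 ∨ z.im = 0 ∨ z.im = 1) :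
    ∃ i, ∃ t ∈ Icc (0 : ℝ) 1, z = sidePt i t := by
  obtain ⟨⟨h1, h2⟩, h3, h4⟩ := mem_unitSquare.1 hz
  rcases h with h | h | h | h
  · exact ⟨3, 1 - z.im, ⟨by linarith, by linarith⟩, by
      simp [sidePt_eq, sideDir, corner, Complex.ext_iff, h]⟩
  · exact ⟨1, z.im, ⟨by linarith, by linarith⟩, by
      simp [sidePt_eq, sideDir, corner, Complex.ext_iff, h]⟩
  · exact ⟨0, z.re, ⟨by linarith, by linarith⟩, by
      simp [sidePt_eq, sideDir, corner, Complex.ext_iff, h]⟩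
  · exact ⟨2, 1 - z.re, ⟨by linarith, by linarith⟩, by
      simp [sidePt_eq, sideDir, corner, Complex.ext_iff, h]⟩

theorem coord_of_sidePt (i : Fin 4) (t : ℝ) : (sidePt i t).re = 0 ∨ (sidePt i t).re = 1 ∨
    (sidePt i t).im = 0 ∨ (sidePt i t).im = 1 := by
  fin_cases i <;> simp [sidePt_eq, sideDir, corner]

namespace QuadMesh

variable {S F : Type*} [TopologicalSpace S] {Q : QuadMesh S F}

/-! ### The fibres of the quotient map from the squares to the surface -/

theorem glue_symm {a b : F × ℂ} (h : SideGlue Q.mate a b) : SideGlue Q.mate b a := by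
  obtain ⟨f, i, g, j, t, ht, hm, hne⟩ := h
  have := SideGlue.glue (mate := Q.mate) g j f i (1 - t) ⟨by linarith [ht.2], by linarith [ht.1]⟩
    (by rw [← hm, Q.mate_mate]) hne.symm
  simpa using this

theorem param_mate (s : F × Fin 4) (hs : Q.mate s ≠ s) {t : ℝ} (ht : t ∈ Icc (0 : ℝ) 1) :
    Q.param (Q.mate s).1 (sidePt (Q.mate s).2 (1 - t)) = Q.param s.1 (sidePt s.2 t) := by
  symm
  rw [Q.param_eq_iff _ _ _ (sidePt_mem _ ht) _
    (sidePt_mem _ ⟨by linarith [ht.2], by linarith [ht.1]⟩)]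
  exact Relation.EqvGen.rel _ _ (SideGlue.glue _ _ _ _ _ ht rfl hs.symm)

/-- A set of points of the squares that is closed under crossing glued sides contains with a point
all points which represent the same point of the surface. -/
theorem mem_of_param_eq {X : Set (F × ℂ)}
    (hX : ∀ s t, t ∈ Icc (0 : ℝ) 1 → Q.mate s ≠ s → (s.1, sidePt s.2 t) ∈ X →
      ((Q.mate s).1, sidePt (Q.mate s).2 (1 - t)) ∈ X)
    {f g : F} {z w : ℂ} (hz : z ∈ unitSquare) (hw : w ∈ unitSquare)
    (h : Q.param f z = Q.param g w) (hfz : (f, z) ∈ X) : (g, w) ∈ X := by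
  have key : ∀ a b, SideGlue Q.mate a b → a ∈ X → b ∈ X := by
    rintro _ _ ⟨f, i, g, j, t, ht, hm, hne⟩ ha
    have := hX (f, i) t ht (by rw [hm]; exact hne.symm) ha
    rwa [hm] at this
  have : ∀ a b, Relation.EqvGen (SideGlue Q.mate) a b → (a ∈ X ↔ b ∈ X) := by
    intro a b hab
    induction hab with
    | rel a b hab => exact ⟨key a b hab, key b a (glue_symm hab)⟩
    | refl => exact Iff.rfl
    | symm _ _ _ ih => exact ih.symm
    | trans _ _ _ _ _ ih ih' => exact ih.trans ih'
  exact (this _ _ ((Q.param_eq_iff f g z hz w hw).1 h)).1 hfz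

theorem coord_mem_of_param_eq {Y : Set ℝ} (h0 : 0 ∈ Y) (h1 : 1 ∈ Y)
    (hY : ∀ y ∈ Y, 1 - y ∈ Y) {f g : F} {z w : ℂ} (hz : z ∈ unitSquare) (hw : w ∈ unitSquare)
    (h : Q.param f z = Q.param g w) (hz' : z.re ∈ Y ∧ z.im ∈ Y) : w.re ∈ Y ∧ w.im ∈ Y := by
  refine mem_of_param_eq (X := {a | a.2.re ∈ Y ∧ a.2.im ∈ Y}) ?_ hz hw h hz'
  intro s t _ _ hs
  have ht : t ∈ Y := by
    obtain ⟨f, i⟩ := s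
    obtain ⟨h2, h3⟩ := hs
    fin_cases i <;> simp [sidePt_eq, sideDir, corner] at h2 h3
    · exact h2
    · exact h3
    · simpa using hY _ h2
    · simpa using hY _ h3
  have ht' := hY t ht
  generalize Q.mate s = s'
  obtain ⟨g, j⟩ := s'
  fin_cases j <;> simp [sidePt_eq, sideDir, corner, h0, h1, ht, ht']

/-- The coordinates that can occur among the points of the squares over the same point of the
surface as `z`. -/
def coordSet (z : ℂ) : Set ℝ := {0, 1, z.re, 1 - z.re, z.im, 1 - z.im}

theorem coordSet_finite (z : ℂ) : (coordSet z).Finite := by simp [coordSet]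

theorem coordSet_symm {z : ℂ} : ∀ y ∈ coordSet z, 1 - y ∈ coordSet z := by
  rintro y (rfl | rfl | rfl | rfl | rfl | rfl) <;> simp [coordSet]

/-- The points of the squares over the point `p`. -/
def fibre (Q : QuadMesh S F) (p : S) : Set (F × ℂ) := {a | a.2 ∈ unitSquare ∧ Q.param a.1 a.2 = p}

theorem finite_fibre [Finite F] (p : S) : (Q.fibre p).Finite := by
  obtain ⟨f, z, hz, rfl⟩ := Q.exists_param p
  have hfin : ((univ : Set F) ×ˢ (coordSet z ×ℂ coordSet z)).Finite := by
    refine finite_univ.prod ?_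
    have := ((coordSet_finite z).prod (coordSet_finite z)).image
      (fun a : ℝ × ℝ => (⟨a.1, a.2⟩ : ℂ))
    refine this.subset ?_
    rintro w ⟨h1, h2⟩
    exact ⟨(w.re, w.im), ⟨h1, h2⟩, rfl⟩
  refine hfin.subset ?_
  rintro ⟨g, w⟩ ⟨hw, h⟩
  exact ⟨mem_univ _, coord_mem_of_param_eq (by simp [coordSet]) (by simp [coordSet])
    coordSet_symm hz hw h.symm (by simp [coordSet])⟩

theorem exists_sidePt_of_param_eq {f g : F} {z w : ℂ} (hz : z ∈ unitSquare) (hw : w ∈ unitSquare)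
    (h : Q.param f z = Q.param g w) (hz' : ∃ i, ∃ t ∈ Icc (0 : ℝ) 1, z = sidePt i t) :
    ∃ i, ∃ t ∈ Icc (0 : ℝ) 1, w = sidePt i t := by
  refine mem_of_param_eq (X := {a | ∃ i, ∃ t ∈ Icc (0 : ℝ) 1, a.2 = sidePt i t}) ?_ hz hw h hz'
  rintro s t ht _ -
  exact ⟨_, _, ⟨by linarith [ht.2], by linarith [ht.1]⟩, rfl⟩

/-- An interior point of a square is identified with no other point. -/
theorem eq_of_param_eq {f g : F} {z w : ℂ} (hz : z ∈ unitSquare) (hw : w ∈ unitSquare)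
    (h : Q.param f z = Q.param g w) (hz' : ¬ ∃ i, ∃ t ∈ Icc (0 : ℝ) 1, z = sidePt i t) :
    g = f ∧ w = z := by
  have := mem_of_param_eq (Q := Q) (X := {(f, z)}) ?_ hz hw h rfl
  · simpa using this
  · rintro s t ht _ hs
    simp only [mem_singleton_iff, Prod.mk.injEq] at hs
    exact absurd ⟨_, t, ht, hs.2.symm⟩ hz'

/-- An interior point of an edge lies only on the one side or the two sides that form this edge. -/
theorem eq_of_param_sidePt_eq {s : F × Fin 4} {t : ℝ} (ht : t ∈ Ioo (0 : ℝ) 1) {g : F} {w : ℂ}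
    (hw : w ∈ unitSquare) (h : Q.param s.1 (sidePt s.2 t) = Q.param g w) :
    (g, w) = (s.1, sidePt s.2 t) ∨ (g, w) = ((Q.mate s).1, sidePt (Q.mate s).2 (1 - t)) := by
  have ht' : 1 - t ∈ Ioo (0 : ℝ) 1 := ⟨by linarith [ht.2], by linarith [ht.1]⟩
  refine mem_of_param_eq (Q := Q)
    (X := {a | a = (s.1, sidePt s.2 t) ∨ a = ((Q.mate s).1, sidePt (Q.mate s).2 (1 - t))})
    ?_ (sidePt_mem _ (Ioo_subset_Icc_self ht)) hw h (Or.inl rfl)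
  rintro s' t' htt _ (hs | hs)
  · rw [Prod.mk.injEq] at hs
    obtain ⟨h1, h2⟩ := sidePt_eq_sidePt ht htt hs.2.symm
    have : s' = s := Prod.ext hs.1 h1.symm
    subst this; subst h2
    exact Or.inr rfl
  · rw [Prod.mk.injEq] at hs
    obtain ⟨h1, h2⟩ := sidePt_eq_sidePt ht' htt hs.2.symm
    have : s' = Q.mate s := Prod.ext hs.1 h1.symm
    subst this; subst h2
    left
    rw [Q.mate_mate, sub_sub_cancel]

theorem exists_corner_of_param_eq {f g : F} {i : Fin 4} {w : ℂ} (hw : w ∈ unitSquare)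
    (h : Q.param f (corner i) = Q.param g w) : ∃ j, w = corner j := by
  refine mem_of_param_eq (X := {a | ∃ j, a.2 = corner j}) ?_ (corner_mem i) hw h ⟨i, rfl⟩
  rintro s t ht _ ⟨j, hj⟩
  rcases sidePt_eq_corner ht hj with ⟨rfl, -⟩ | ⟨rfl, -⟩
  · exact ⟨(Q.mate s).2 + 1, by simp [sidePt_one]⟩
  · exact ⟨(Q.mate s).2, by simp [sidePt_zero]⟩

theorem mem_vertices_iff {f : F} {z : ℂ} (hz : z ∈ unitSquare) :
    Q.param f z ∈ Q.vertices ↔ ∃ i, z = corner i := by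
  constructor
  · rintro ⟨s, hs⟩
    exact exists_corner_of_param_eq hz hs
  · rintro ⟨i, rfl⟩
    exact ⟨(f, i), rfl⟩

theorem mem_boundary_sidePt_iff {s : F × Fin 4} {t : ℝ} (ht : t ∈ Ioo (0 : ℝ) 1) :
    Q.param s.1 (sidePt s.2 t) ∈ Q.boundary ↔ Q.mate s = s := by
  constructor
  · rintro ⟨s', hs', t', ht', h⟩
    have := eq_of_param_sidePt_eq ht (sidePt_mem s'.2 ht') h.symm
    rcases this with this | this
    · rw [Prod.mk.injEq] at this
      have h1 := sidePt_eq_sidePt ht ht' this.2.symm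
      have : s' = s := Prod.ext this.1 h1.1.symm
      rwa [← this]
    · rw [Prod.mk.injEq] at this
      have h1 := sidePt_eq_sidePt (t := 1 - t) ⟨by linarith [ht.2], by linarith [ht.1]⟩ ht'
        this.2.symm
      have : s' = Q.mate s := Prod.ext this.1 h1.1.symm
      rw [this, Q.mate_mate] at hs'
      exact hs'.symm
  · intro h
    exact ⟨s, h, t, Ioo_subset_Icc_self ht, rfl⟩

theorem not_mem_boundary_of_interior {f : F} {z : ℂ} (hz : z ∈ unitSquare)
    (h : ¬ ∃ i, ∃ t ∈ Icc (0 : ℝ) 1, z = sidePt i t) : Q.param f z ∉ Q.boundary := by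
  rintro ⟨s, -, t, ht, hs⟩
  exact h (exists_sidePt_of_param_eq (sidePt_mem _ ht) hz hs ⟨_, t, ht, rfl⟩)

/-! ### The corners around a vertex -/

/-- The corner that follows a given corner in clockwise order around their common vertex: the
outgoing side of the corner is crossed. For a boundary side, which cannot be crossed, the value is
the next corner of the same face; this makes the map a permutation. -/
def nextCorner (Q : QuadMesh S F) : Equiv.Perm (F × Fin 4) where
  toFun c := ((Q.mate c).1, (Q.mate c).2 + 1)
  invFun c := Q.mate (c.1, c.2 - 1)
  left_inv c := by simp [Q.mate_mate]
  right_inv c := by simp [Q.mate_mate]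

theorem nextCorner_apply (c : F × Fin 4) :
    Q.nextCorner c = ((Q.mate c).1, (Q.mate c).2 + 1) := rfl

theorem nextCorner_mate (c : F × Fin 4) : Q.nextCorner (Q.mate c) = (c.1, c.2 + 1) := by
  rw [nextCorner_apply, Q.mate_mate]

theorem mem_cornersAt {v : S} {c : F × Fin 4} :
    c ∈ Q.cornersAt v ↔ Q.param c.1 (corner c.2) = v := Iff.rfl

theorem nextCorner_mem_iff {v : S} {c : F × Fin 4} (hc : Q.mate c ≠ c) :
    Q.nextCorner c ∈ Q.cornersAt v ↔ c ∈ Q.cornersAt v := by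
  have := Q.param_mate c hc (t := 0) (by simp)
  rw [sub_zero, sidePt_one, sidePt_zero] at this
  rw [mem_cornersAt, mem_cornersAt, nextCorner_apply, this]

/-- The corners at a vertex are all reached from one of them by going around the vertex. -/
theorem cornersAt_subset {v : S} {Z : Set (F × Fin 4)} {c : F × Fin 4} (hc : c ∈ Q.cornersAt v)
    (hcZ : c ∈ Z) (hZ : ∀ a, Q.mate a ≠ a → (a ∈ Z ↔ Q.nextCorner a ∈ Z)) :
    Q.cornersAt v ⊆ Z := by
  intro b hb
  have := mem_of_param_eq (Q := Q) (X := {a | ∃ j, a.2 = corner j ∧ (a.1, j) ∈ Z}) ?_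
    (corner_mem c.2) (corner_mem b.2) (hc.trans hb.symm) ⟨c.2, rfl, hcZ⟩
  · obtain ⟨j, hj, hjZ⟩ := this
    rwa [← corner_injective hj] at hjZ
  · rintro s t ht hs ⟨j, hj, hjZ⟩
    rcases sidePt_eq_corner ht hj with ⟨rfl, rfl⟩ | ⟨rfl, rfl⟩
    · exact ⟨(Q.mate s).2 + 1, by simp [sidePt_one], (hZ s hs).1 hjZ⟩
    · refine ⟨(Q.mate s).2, by simp [sidePt_zero], ?_⟩
      exact (hZ (Q.mate s) (by rw [Q.mate_mate]; exact hs.symm)).2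
        (by rw [nextCorner_mate]; exact hjZ)

/-- At a vertex that has a corner with outgoing boundary side, the corners form a chain which ends
with this corner. -/
theorem reflTransGen_of_mem_cornersAt {v : S} {c : F × Fin 4} (hc : c ∈ Q.cornersAt v)
    (hm : Q.mate c = c) {a : F × Fin 4} (ha : a ∈ Q.cornersAt v) :
    Relation.ReflTransGen (fun a b => Q.mate a ≠ a ∧ Q.nextCorner a = b) a c := by
  refine cornersAt_subset (Z := {a | Relation.ReflTransGen
    (fun a b => Q.mate a ≠ a ∧ Q.nextCorner a = b) a c}) hc Relation.ReflTransGen.refl ?_ ha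
  intro a ha
  constructor
  · intro h
    rcases Relation.ReflTransGen.cases_head h with h | ⟨b, ⟨-, hb⟩, h⟩
    · exact absurd (h ▸ hm) ha
    · change Relation.ReflTransGen _ _ _
      rwa [hb]
  · intro h
    exact Relation.ReflTransGen.head ⟨ha, rfl⟩ h

theorem eq_of_mate_eq {v : S} {c a : F × Fin 4} (hc : c ∈ Q.cornersAt v)
    (hm : Q.mate c = c) (ha : a ∈ Q.cornersAt v) (hma : Q.mate a = a) : a = c := by
  rcases Relation.ReflTransGen.cases_head (reflTransGen_of_mem_cornersAt hc hm ha) with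
    h | ⟨b, ⟨h, -⟩, -⟩
  · exact h
  · exact absurd hma h

/-- If no corner at `v` has an outgoing boundary side, then the corners at `v` are permuted by
`nextCorner`, so that no corner has an incoming boundary side either. -/
theorem mem_cornersAt_of_nextCorner_mem [Finite F] {v : S}
    (hv : ∀ c ∈ Q.cornersAt v, Q.mate c ≠ c) {c : F × Fin 4}
    (hc : Q.nextCorner c ∈ Q.cornersAt v) : c ∈ Q.cornersAt v := by
  have hmaps : MapsTo Q.nextCorner (Q.cornersAt v) (Q.cornersAt v) :=
    fun a ha => (nextCorner_mem_iff (hv a ha)).2 ha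
  have himg : Q.nextCorner '' Q.cornersAt v = Q.cornersAt v :=
    Set.eq_of_subset_of_ncard_le hmaps.image_subset
      (Q.nextCorner.injective.injOn.ncard_image).ge (Set.toFinite _)
  rw [← himg] at hc
  obtain ⟨a, ha, hac⟩ := hc
  rwa [← Q.nextCorner.injective hac]

theorem mem_boundary_vertex_iff [Finite F] {v : S} (hv : v ∈ Q.vertices) :
    v ∈ Q.boundary ↔ ∃ c ∈ Q.cornersAt v, Q.mate c = c := by
  constructor
  · rintro ⟨s, hs, t, ht, h⟩
    by_contra! hcon
    rw [← h] at hv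
    obtain ⟨j, hj⟩ := (mem_vertices_iff (sidePt_mem _ ht)).1 hv
    rcases sidePt_eq_corner ht hj with ⟨rfl, rfl⟩ | ⟨rfl, rfl⟩
    · exact hcon s (by rw [mem_cornersAt, ← h, ← sidePt_zero]) hs
    · refine hcon s (mem_cornersAt_of_nextCorner_mem hcon ?_) hs
      rw [mem_cornersAt, nextCorner_apply, hs, ← h, ← sidePt_one]
  · rintro ⟨c, hc, hm⟩
    exact ⟨c, hm, 0, by simp, by
      beta_reduce; rw [sidePt_zero]; exact hc⟩

/-- Around an interior vertex of valence 4 the corners form a cycle of length 4. -/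
theorem exists_four_corners [Finite F] {v : S} (hv : v ∈ Q.vertices) (hb : v ∉ Q.boundary)
    (h4 : Q.valence v = 4) : ∃ c, Function.minimalPeriod Q.nextCorner c = 4 ∧
      ∀ a, a ∈ Q.cornersAt v ↔ ∃ k < 4, a = Q.nextCorner^[k] c := by
  obtain ⟨c, hc⟩ := hv
  rw [mem_boundary_vertex_iff ⟨c, hc⟩] at hb
  push Not at hb
  replace hc : c ∈ Q.cornersAt v := hc
  have hper : c ∈ Function.periodicPts Q.nextCorner :=
    Function.Injective.mem_periodicPts Q.nextCorner.injective c
  have hpos := Function.minimalPeriod_pos_of_mem_periodicPts hper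
  have hmem : ∀ k, Q.nextCorner^[k] c ∈ Q.cornersAt v := by
    intro k
    induction k with
    | zero => exact hc
    | succ k ih =>
      rw [Function.iterate_succ_apply']
      exact (nextCorner_mem_iff (hb _ ih)).2 ih
  have hsub : Q.cornersAt v ⊆ {a | ∃ k, a = Q.nextCorner^[k] c} := by
    refine cornersAt_subset hc ⟨0, rfl⟩ fun a _ => ⟨?_, ?_⟩
    · rintro ⟨k, rfl⟩
      exact ⟨k + 1, by rw [Function.iterate_succ_apply']⟩
    · rintro ⟨k, hk⟩
      obtain ⟨m, hm⟩ := Nat.exists_eq_succ_of_ne_zero hpos.ne'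
      refine ⟨k + m, Q.nextCorner.injective ?_⟩
      have h2 := Function.iterate_minimalPeriod (f := Q.nextCorner) (x := c)
      rw [hm] at h2
      rw [← Function.iterate_succ_apply' Q.nextCorner, hk, ← Nat.add_succ,
        Function.iterate_add_apply, h2]
  have himg : Q.cornersAt v =
      (fun k => Q.nextCorner^[k] c) '' Iio (Function.minimalPeriod Q.nextCorner c) := by
    apply Subset.antisymm
    · intro a ha
      obtain ⟨k, rfl⟩ := hsub ha
      exact ⟨k % _, Nat.mod_lt _ hpos, Function.iterate_mod_minimalPeriod_eq⟩
    · rintro _ ⟨k, -, rfl⟩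
      exact hmem k
  have hcard : Function.minimalPeriod Q.nextCorner c = 4 := by
    refine Eq.trans ?_ h4
    rw [valence, himg, Function.iterate_injOn_Iio_minimalPeriod.ncard_image]
    simp
  refine ⟨c, hcard, fun a => ?_⟩
  rw [himg]
  simp only [mem_image, mem_Iio, hcard, eq_comm]

/-- At a boundary vertex of valence 2 the two corners form a chain. -/
theorem exists_two_corners [Finite F] {v : S} (hv : v ∈ Q.vertices) (hb : v ∈ Q.boundary)
    (h2 : Q.valence v = 2) : ∃ a c, a ≠ c ∧ Q.cornersAt v = {a, c} ∧ Q.mate c = c ∧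
      Q.mate a ≠ a ∧ Q.nextCorner a = c := by
  obtain ⟨c, hc, hm⟩ := (mem_boundary_vertex_iff hv).1 hb
  have hex : ∃ b ∈ Q.cornersAt v, b ≠ c := by
    apply Set.exists_ne_of_one_lt_ncard
    change 1 < Q.valence v
    omega
  obtain ⟨b, hbv, hbc⟩ := hex
  obtain h | ⟨a, -, hma, hac⟩ :=
    Relation.ReflTransGen.cases_tail (reflTransGen_of_mem_cornersAt hc hm hbv)
  · exact absurd h.symm hbc
  have hav : a ∈ Q.cornersAt v := (nextCorner_mem_iff hma).1 (by rwa [hac])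
  have hne : a ≠ c := by rintro rfl; exact hma hm
  refine ⟨a, c, hne, ?_, hm, hma, hac⟩
  symm
  refine Set.eq_of_subset_of_ncard_le ?_ ?_ (Set.toFinite _)
  · rintro x (rfl | rfl) <;> assumption
  · change Q.valence v ≤ _
    rw [h2, Set.ncard_pair hne]

/-! ### Euler characteristic and curvature -/

theorem angle_corner (i : Fin 4) :
    EuclideanGeometry.angle (corner (i - 1)) (corner i) (corner (i + 1)) = Real.pi / 2 := by
  have h : inner ℝ (corner (i - 1) - corner i) (corner (i + 1) - corner i) = 0 := by
    fin_cases i <;> simp [corner, Complex.inner]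
  exact InnerProductGeometry.inner_eq_zero_iff_angle_eq_pi_div_two _ _ |>.1 h

theorem curvature_eq [Finite F] (v : S) : Q.curvature v = Q.index v * (Real.pi / 2) := by
  have h : ∑ᶠ s ∈ Q.cornersAt v,
      EuclideanGeometry.angle (corner (s.2 - 1)) (corner s.2) (corner (s.2 + 1)) =
      Q.valence v * (Real.pi / 2) := by
    simp_rw [angle_corner]
    rw [finsum_mem_eq_finite_toFinset_sum _ (Set.toFinite _), Finset.sum_const, nsmul_eq_mul,
      valence, Set.ncard_eq_toFinset_card _ (Set.toFinite _)]
  rw [curvature, index, h]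
  split_ifs <;> push_cast <;> ring

theorem finite_vertices [Finite F] : Q.vertices.Finite := Set.finite_range _

theorem singularSet_subset : Q.singularSet ⊆ Q.vertices := fun _ h => h.1

theorem finite_singularSet [Finite F] : Q.singularSet.Finite :=
  finite_vertices.subset singularSet_subset

theorem index_eq_zero {v : S} (hv : v ∈ Q.vertices) (h : v ∉ Q.singularSet) : Q.index v = 0 := by
  rw [singularSet, mem_ofPred_eq, not_and, not_or] at h
  obtain ⟨h1, h2⟩ := h hv
  rw [index]
  split_ifs with hb
  · have : Q.valence v = 2 := by tauto
    rw [this]; norm_num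
  · have : Q.valence v = 4 := by tauto
    rw [this]; norm_num

theorem edge_eq_iff {s s' : F × Fin 4} : Q.edge s' = Q.edge s ↔ s' = s ∨ s' = Q.mate s := by
  rw [eq_comm]
  constructor
  · intro h
    have hmem : Q.param s.1 (sidePt s.2 (1 / 2)) ∈ Q.edge s' := by
      rw [← h]; exact ⟨1 / 2, by norm_num, rfl⟩
    obtain ⟨t, ht, hst⟩ := hmem
    rcases eq_of_param_sidePt_eq (by norm_num) (sidePt_mem _ ht) hst.symm with h | h
    · rw [Prod.mk.injEq] at h
      exact Or.inl (Prod.ext h.1 (sidePt_eq_sidePt (by norm_num) ht h.2.symm).1.symm)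
    · rw [Prod.mk.injEq] at h
      exact Or.inr (Prod.ext h.1 (sidePt_eq_sidePt (by norm_num) ht h.2.symm).1.symm)
  · rintro (rfl | rfl)
    · rfl
    · have key : ∀ s, Q.mate s ≠ s → Q.edge s ⊆ Q.edge (Q.mate s) := by
        rintro s hs _ ⟨t, ht, rfl⟩
        exact ⟨1 - t, ⟨by linarith [ht.2], by linarith [ht.1]⟩, param_mate s hs ht⟩
      by_cases hs : Q.mate s = s
      · rw [hs]
      · refine Subset.antisymm (key s hs) ?_
        have := key (Q.mate s) (by rw [Q.mate_mate]; exact Ne.symm hs)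
        rwa [Q.mate_mate] at this

theorem sum_valence [Finite F] :
    ∑ v ∈ (Q.finite_vertices).toFinset, Q.valence v = 4 * Nat.card F := by
  classical
  have := Fintype.ofFinite F
  have h := Finset.card_eq_sum_card_fiberwise (s := (Finset.univ : Finset (F × Fin 4)))
    (f := fun s => Q.param s.1 (corner s.2)) (t := (Q.finite_vertices).toFinset)
    (fun s _ => by simp [vertices])
  rw [Finset.card_univ, Fintype.card_prod, Fintype.card_fin] at h
  rw [Nat.card_eq_fintype_card, mul_comm, h]
  refine Finset.sum_congr rfl fun v _ => ?_
  rw [valence, Set.ncard_eq_toFinset_card']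
  congr 1
  ext s
  simp [mem_cornersAt]

theorem two_mul_ncard_edges [Finite F] :
    2 * (range Q.edge).ncard = 4 * Nat.card F + {s | Q.mate s = s}.ncard := by
  classical
  have := Fintype.ofFinite F
  have hfin : (range Q.edge).Finite := Set.finite_range _
  have h1 := Finset.card_eq_sum_card_fiberwise (s := (Finset.univ : Finset (F × Fin 4)))
    (f := Q.edge) (t := hfin.toFinset) (fun s _ => by simp)
  have h2 := Finset.card_eq_sum_card_fiberwise (s := {s : F × Fin 4 | Q.mate s = s}.toFinset)
    (f := Q.edge) (t := hfin.toFinset) (fun s _ => by simp)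
  rw [Finset.card_univ, Fintype.card_prod, Fintype.card_fin] at h1
  rw [Nat.card_eq_fintype_card, mul_comm 4, h1, Set.ncard_eq_toFinset_card _ hfin,
    Set.ncard_eq_toFinset_card' {s | Q.mate s = s}, h2, ← Finset.sum_add_distrib, mul_comm,
    ← smul_eq_mul, ← Finset.sum_const]
  refine Finset.sum_congr rfl fun e he => ?_
  rw [Set.Finite.mem_toFinset] at he
  obtain ⟨s, rfl⟩ := he
  by_cases hs : Q.mate s = s
  · have e1 : Finset.univ.filter (fun s' => Q.edge s' = Q.edge s) = {s} := by
      ext s'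
      simp [edge_eq_iff, hs]
    have e2 : {s : F × Fin 4 | Q.mate s = s}.toFinset.filter (fun s' => Q.edge s' = Q.edge s)
        = {s} := by
      ext s'
      simp only [Finset.mem_filter, mem_toFinset, mem_ofPred_eq, edge_eq_iff,
        hs, or_self, Finset.mem_singleton, and_iff_right_iff_imp]
      rintro rfl
      exact hs
    rw [e1, e2]; rfl
  · have e1 : Finset.univ.filter (fun s' => Q.edge s' = Q.edge s) = {s, Q.mate s} := by
      ext s'
      simp [edge_eq_iff]
    have e2 : {s : F × Fin 4 | Q.mate s = s}.toFinset.filter (fun s' => Q.edge s' = Q.edge s)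
        = ∅ := by
      ext s'
      simp only [Finset.mem_filter, mem_toFinset, mem_ofPred_eq, edge_eq_iff,
        Finset.notMem_empty, iff_false, not_and, not_or]
      intro h
      refine ⟨?_, ?_⟩
      · rintro rfl; exact hs h
      · rintro rfl
        rw [Q.mate_mate] at h
        exact hs h.symm
    rw [e1, e2, Finset.card_pair (Ne.symm hs)]; rfl

/-- The boundary has as many vertices as edges: every boundary vertex is the starting point of
exactly one boundary side. -/
theorem ncard_boundary_vertices [Finite F] :
    (Q.vertices ∩ Q.boundary).ncard = {s | Q.mate s = s}.ncard := by
  have h : Q.vertices ∩ Q.boundary =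
      (fun s : F × Fin 4 => Q.param s.1 (corner s.2)) '' {s | Q.mate s = s} := by
    ext v
    constructor
    · rintro ⟨hv, hb⟩
      obtain ⟨c, hc, hm⟩ := (mem_boundary_vertex_iff hv).1 hb
      exact ⟨c, hm, hc⟩
    · rintro ⟨c, hm, rfl⟩
      exact ⟨⟨c, rfl⟩, (mem_boundary_vertex_iff ⟨c, rfl⟩).2 ⟨c, rfl, hm⟩⟩
  rw [h]
  refine Set.InjOn.ncard_image fun a ha b hb hab => ?_
  exact eq_of_mate_eq (v := Q.param b.1 (corner b.2)) rfl hb hab ha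

theorem sum_index [Finite F] :
    ∑ v ∈ (Q.finite_vertices).toFinset, Q.index v = 4 * Q.eulerChar := by
  classical
  have h1 : ∀ v, Q.index v = 4 - Q.valence v - 2 * (if v ∈ Q.boundary then (1 : ℤ) else 0) := by
    intro v
    rw [index]
    split_ifs <;> ring
  have h2 : (∑ v ∈ (Q.finite_vertices).toFinset, if v ∈ Q.boundary then (1 : ℤ) else 0) =
      {s | Q.mate s = s}.ncard := by
    rw [← ncard_boundary_vertices, ← Finset.sum_filter, Finset.sum_const, nsmul_eq_mul, mul_one,
      Set.ncard_eq_toFinset_card _ ((Q.finite_vertices).inter_of_left _)]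
    congr 2
    ext v
    simp
  have h3 := Q.sum_valence
  have h4 := Q.two_mul_ncard_edges
  have h5 : Q.vertices.ncard = (Q.finite_vertices).toFinset.card :=
    Set.ncard_eq_toFinset_card _ _
  simp_rw [h1]
  rw [Finset.sum_sub_distrib, Finset.sum_sub_distrib, ← Finset.mul_sum, h2, ← Nat.cast_sum, h3,
    Finset.sum_const, nsmul_eq_mul, ← h5, eulerChar]
  push_cast
  have h4' : 2 * ((range Q.edge).ncard : ℤ) = 4 * Nat.card F + {s | Q.mate s = s}.ncard := by
    exact_mod_cast h4
  linarith

theorem gauss_bonnet [Finite F] :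
    ∑ᶠ v ∈ Q.singularSet, Q.curvature v = 2 * Real.pi * Q.eulerChar := by
  rw [finsum_mem_eq_finite_toFinset_sum _ Q.finite_singularSet]
  have hsub : Q.finite_singularSet.toFinset ⊆ (Q.finite_vertices).toFinset := by
    simpa using singularSet_subset
  rw [Finset.sum_subset hsub]
  · simp_rw [curvature_eq]
    rw [← Finset.sum_mul, ← Int.cast_sum, sum_index]
    push_cast
    ring
  · intro v hv hv'
    rw [curvature_eq, index_eq_zero (by simpa using hv) (by simpa using hv')]
    simp

/-! ### The quad-mesh metric: first estimates -/

theorem segmentLength_le {f : F} {z w : ℂ} (hz : z ∈ unitSquare) (hw : w ∈ unitSquare) :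
    Q.segmentLength (Q.param f z) (Q.param f w) ≤ edist z w :=
  iInf_le_of_le f <| iInf_le_of_le z <| iInf_le_of_le w <| iInf_le_of_le hz <|
    iInf_le_of_le hw <| iInf_le_of_le rfl <| iInf_le_of_le rfl le_rfl

theorem le_segmentLength {p q : S} {x : ℝ≥0∞} (h : ∀ f, ∀ z ∈ unitSquare, ∀ w ∈ unitSquare,
    Q.param f z = p → Q.param f w = q → x ≤ edist z w) : x ≤ Q.segmentLength p q :=
  le_iInf fun f => le_iInf fun z => le_iInf fun w => le_iInf fun hz => le_iInf fun hw =>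
    le_iInf fun hp => le_iInf fun hq => h f z hz w hw hp hq

theorem segmentLength_comm (p q : S) : Q.segmentLength p q = Q.segmentLength q p := by
  have : ∀ p q, Q.segmentLength p q ≤ Q.segmentLength q p := by
    intro p q
    refine le_segmentLength ?_
    rintro f z hz w hw rfl rfl
    rw [edist_comm]
    exact segmentLength_le hw hz
  exact le_antisymm (this _ _) (this _ _)

theorem meshDist_le_sum (c : ℕ → S) (n : ℕ) :
    Q.meshDist (c 0) (c n) ≤ ∑ k ∈ Finset.range n, Q.segmentLength (c k) (c (k + 1)) :=
  iInf_le_of_le n <| iInf_le_of_le c <| iInf_le_of_le rfl <| iInf_le_of_le rfl le_rfl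

theorem le_meshDist {p q : S} {x : ℝ≥0∞} (h : ∀ (c : ℕ → S) (n : ℕ), c 0 = p → c n = q →
    x ≤ ∑ k ∈ Finset.range n, Q.segmentLength (c k) (c (k + 1))) : x ≤ Q.meshDist p q :=
  le_iInf fun n => le_iInf fun c => le_iInf fun h0 => le_iInf fun hn => h c n h0 hn

theorem meshDist_self (p : S) : Q.meshDist p p = 0 :=
  le_antisymm (by simpa using Q.meshDist_le_sum (fun _ => p) 0) (zero_le)

theorem meshDist_comm (p q : S) : Q.meshDist p q = Q.meshDist q p := by
  have : ∀ p q, Q.meshDist p q ≤ Q.meshDist q p := by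
    intro p q
    refine le_meshDist ?_
    rintro c n rfl rfl
    have h := Q.meshDist_le_sum (fun k => c (n - k)) n
    simp only [tsub_zero, tsub_self] at h
    refine h.trans (le_of_eq ?_)
    rw [← Finset.sum_range_reflect]
    refine Finset.sum_congr rfl fun k hk => ?_
    have hk' := Finset.mem_range.1 hk
    rw [segmentLength_comm]
    congr 2 <;> omega
  exact le_antisymm (this _ _) (this _ _)

theorem meshDist_le_segmentLength_add (p q r : S) :
    Q.meshDist p r ≤ Q.segmentLength p q + Q.meshDist q r := by
  rw [← tsub_le_iff_left]
  refine le_meshDist ?_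
  rintro c n rfl rfl
  rw [tsub_le_iff_left]
  have h := Q.meshDist_le_sum (fun k => Nat.casesOn k p c) (n + 1)
  rw [Finset.sum_range_succ'] at h
  rw [add_comm]
  exact h

theorem meshDist_triangle (p q r : S) :
    Q.meshDist p r ≤ Q.meshDist p q + Q.meshDist q r := by
  rw [← tsub_le_iff_right]
  refine le_meshDist ?_
  rintro c n rfl rfl
  rw [tsub_le_iff_right]
  induction n with
  | zero => simp
  | succ n ih =>
    refine ih.trans ?_
    rw [Finset.sum_range_succ, add_assoc]
    gcongr
    exact meshDist_le_segmentLength_add _ _ _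

theorem meshDist_le_edist {f : F} {z w : ℂ} (hz : z ∈ unitSquare) (hw : w ∈ unitSquare) :
    Q.meshDist (Q.param f z) (Q.param f w) ≤ edist z w := by
  have := Q.meshDist_le_segmentLength_add (Q.param f z) (Q.param f w) (Q.param f w)
  rw [meshDist_self, add_zero] at this
  exact this.trans (segmentLength_le hz hw)

/-- A function on the squares that is compatible with the gluing and does not increase distances in
any square bounds the quad-mesh metric from below. -/
theorem exists_descent {η : F → ℂ → ℝ}
    (hglue : ∀ s t, t ∈ Icc (0 : ℝ) 1 → Q.mate s ≠ s →
      η (Q.mate s).1 (sidePt (Q.mate s).2 (1 - t)) = η s.1 (sidePt s.2 t))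
    (hlip : ∀ f w w', η f w - η f w' ≤ dist w w') :
    ∃ φ : S → ℝ, (∀ q q', ENNReal.ofReal (φ q - φ q') ≤ Q.meshDist q q') ∧
      ∀ f, ∀ w ∈ unitSquare, φ (Q.param f w) = η f w := by
  choose f z hz hfz using Q.exists_param
  have hφ : ∀ g, ∀ w ∈ unitSquare, η (f (Q.param g w)) (z (Q.param g w)) = η g w := by
    intro g w hw
    refine mem_of_param_eq (Q := Q) (X := {a | η a.1 a.2 = η g w}) ?_ hw (hz _)
      (hfz _).symm rfl
    intro s t ht hs h
    exact (hglue s t ht hs).trans h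
  refine ⟨fun q => η (f q) (z q), fun q q' => le_meshDist ?_, hφ⟩
  rintro c n rfl rfl
  induction n with
  | zero => simp
  | succ n ih =>
    rw [Finset.sum_range_succ]
    refine le_trans ?_ (add_le_add ih (le_segmentLength (x := ENNReal.ofReal
      (η (f (c n)) (z (c n)) - η (f (c (n + 1))) (z (c (n + 1))))) ?_))
    · refine le_trans (ENNReal.ofReal_le_ofReal (le_of_eq ?_)) ENNReal.ofReal_add_le
      ring
    · intro g w hw w' hw' h h'
      rw [← h, ← h', hφ g w hw, hφ g w' hw', edist_dist]
      exact ENNReal.ofReal_le_ofReal (hlip g w w')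

/-! ### The metric near a point -/

theorem mem_fibre {p : S} {f : F} {z : ℂ} :
    (f, z) ∈ Q.fibre p ↔ z ∈ unitSquare ∧ Q.param f z = p := Iff.rfl

theorem fibre_mate {p : S} {s : F × Fin 4} {t : ℝ} (ht : t ∈ Icc (0 : ℝ) 1) (hs : Q.mate s ≠ s)
    (h : (s.1, sidePt s.2 t) ∈ Q.fibre p) :
    ((Q.mate s).1, sidePt (Q.mate s).2 (1 - t)) ∈ Q.fibre p :=
  ⟨sidePt_mem _ ⟨by linarith [ht.2], by linarith [ht.1]⟩, (param_mate s hs ht).trans h.2⟩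

/-- The radius `r` is small compared with the distances between the points over `p` in the same
square, and with their distances from the sides that do not contain them. -/
structure IsSeparating (Q : QuadMesh S F) (p : S) (r : ℝ) : Prop where
  pos : 0 < r
  fibre : ∀ f z z', (f, z) ∈ Q.fibre p → (f, z') ∈ Q.fibre p → z ≠ z' → 4 * r ≤ dist z z'
  side : ∀ f z i, (f, z) ∈ Q.fibre p → (∃ t ∈ Icc (0 : ℝ) 1, z = sidePt i t) ∨
    ∀ t ∈ Icc (0 : ℝ) 1, 4 * r ≤ dist z (sidePt i t)

theorem IsSeparating.mono {p : S} {r r' : ℝ} (h : Q.IsSeparating p r) (h0 : 0 < r') (hr : r' ≤ r) :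
    Q.IsSeparating p r' where
  pos := h0
  fibre f z z' hz hz' hne := by linarith [h.fibre f z z' hz hz' hne]
  side f z i hz := (h.side f z i hz).imp_right fun h t ht => by linarith [h t ht]

theorem exists_isSeparating [Finite F] (p : S) : ∃ r, Q.IsSeparating p r := by
  have hev : ∀ D > 0, ∀ᶠ r in 𝓝[>] (0 : ℝ), 4 * r ≤ D := by
    intro D hD
    filter_upwards [Ioo_mem_nhdsGT (show (0 : ℝ) < D / 4 by positivity)] with r hr
    linarith [hr.2]
  have h1 : ∀ᶠ r in 𝓝[>] (0 : ℝ), ∀ a ∈ Q.fibre p, ∀ b ∈ Q.fibre p, a.2 ≠ b.2 →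
      4 * r ≤ dist a.2 b.2 := by
    rw [Filter.eventually_all_finite (finite_fibre p)]
    intro a _
    rw [Filter.eventually_all_finite (finite_fibre p)]
    intro b _
    by_cases h : a.2 = b.2
    · simp [h]
    · filter_upwards [hev _ (dist_pos.2 h)] with r hr _ using hr
  have h2 : ∀ᶠ r in 𝓝[>] (0 : ℝ), ∀ a ∈ Q.fibre p, ∀ i : Fin 4,
      (∃ t ∈ Icc (0 : ℝ) 1, a.2 = sidePt i t) ∨
      ∀ t ∈ Icc (0 : ℝ) 1, 4 * r ≤ dist a.2 (sidePt i t) := by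
    rw [Filter.eventually_all_finite (finite_fibre p)]
    intro a _
    rw [Filter.eventually_all]
    intro i
    by_cases h : ∃ t ∈ Icc (0 : ℝ) 1, a.2 = sidePt i t
    · exact Filter.Eventually.of_forall fun _ => Or.inl h
    · have hcomp : IsCompact (sidePt i '' Icc 0 1) := by
        refine isCompact_Icc.image ?_
        have : sidePt i = fun t : ℝ => corner i + sideDir i * t := funext (sidePt_eq i)
        rw [this]
        fun_prop
      have hmem : a.2 ∉ sidePt i '' Icc 0 1 := fun ⟨t, ht, h'⟩ => h ⟨t, ht, h'.symm⟩
      have hpos := (hcomp.isClosed.notMem_iff_infDist_pos ⟨_, 0, by simp, rfl⟩).1 hmem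
      filter_upwards [hev _ hpos] with r hr
      right
      intro t ht
      exact hr.trans (Metric.infDist_le_dist_of_mem ⟨t, ht, rfl⟩)
  obtain ⟨r, ⟨h1, h2⟩, h0⟩ := ((h1.and h2).and self_mem_nhdsWithin).exists
  exact ⟨r, h0, fun f z z' hz hz' hne => h1 _ hz _ hz' hne, fun f z i hz => h2 _ hz i⟩

/-- A function on the surface which is supported near `p`, prescribed in terms of the functions
`ψ f z` of the displacement from the points `z` over `p`, and which does not increase the quad-mesh
distance. -/
theorem IsSeparating.exists_bump {p : S} {r : ℝ} (hr : Q.IsSeparating p r) {ψ : F → ℂ → ℂ → ℝ}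
    (hlip : ∀ f z, (f, z) ∈ Q.fibre p → ∀ v v', ψ f z v - ψ f z v' ≤ dist v v')
    (hbig : ∀ f z, (f, z) ∈ Q.fibre p → ∀ v, ‖v‖ - r ≤ ψ f z v)
    (hglue : ∀ s t, t ∈ Icc (0 : ℝ) 1 → Q.mate s ≠ s → (s.1, sidePt s.2 t) ∈ Q.fibre p → ∀ τ : ℝ,
      ψ (Q.mate s).1 (sidePt (Q.mate s).2 (1 - t)) (sideDir (Q.mate s).2 * (-τ : ℝ)) =
        ψ s.1 (sidePt s.2 t) (sideDir s.2 * τ)) :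
    ∃ φ : S → ℝ, (∀ q q', ENNReal.ofReal (φ q - φ q') ≤ Q.meshDist q q') ∧
      (∀ f z w, (f, z) ∈ Q.fibre p → w ∈ unitSquare → dist w z < 2 * r →
        φ (Q.param f w) = max 0 (r - ψ f z (w - z))) ∧
      (∀ f w, w ∈ unitSquare → (∀ z, (f, z) ∈ Q.fibre p → 2 * r ≤ dist w z) →
        φ (Q.param f w) = 0) := by
  classical
  let η : F → ℂ → ℝ := fun f w =>
    if h : ∃ z, (f, z) ∈ Q.fibre p ∧ dist w z < 2 * r then
      max 0 (r - ψ f h.choose (w - h.choose)) else 0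
  have hη1 : ∀ f z w, (f, z) ∈ Q.fibre p → dist w z < 2 * r →
      η f w = max 0 (r - ψ f z (w - z)) := by
    intro f z w hz hw
    have h : ∃ z, (f, z) ∈ Q.fibre p ∧ dist w z < 2 * r := ⟨z, hz, hw⟩
    have heq : h.choose = z := by
      by_contra hne
      have h1 := hr.fibre f _ z h.choose_spec.1 hz hne
      have h2 := dist_triangle_left h.choose z w
      linarith [h.choose_spec.2]
    simp only [η]
    rw [dif_pos h, heq]
  have hη0 : ∀ f w, (∀ z, (f, z) ∈ Q.fibre p → 2 * r ≤ dist w z) → η f w = 0 := by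
    intro f w h
    simp only [η]
    rw [dif_neg]
    push Not
    exact h
  have hηle : ∀ f z w, (f, z) ∈ Q.fibre p → max 0 (r - ψ f z (w - z)) ≤ η f w := by
    intro f z w hz
    by_cases hw : dist w z < 2 * r
    · exact (hη1 f z w hz hw).ge
    · have h1 := hbig f z hz (w - z)
      rw [← dist_eq_norm] at h1
      rw [max_eq_left (by linarith)]
      simp only [η]
      split_ifs
      · exact le_max_left _ _
      · exact le_rfl
  have hη_glue : ∀ s t, t ∈ Icc (0 : ℝ) 1 → Q.mate s ≠ s →
      (∃ z, (s.1, z) ∈ Q.fibre p ∧ dist (sidePt s.2 t) z < 2 * r) →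
      η (Q.mate s).1 (sidePt (Q.mate s).2 (1 - t)) = η s.1 (sidePt s.2 t) := by
    rintro s t ht hs ⟨z, hz, hzt⟩
    rcases hr.side s.1 z s.2 hz with ⟨t₀, ht₀, rfl⟩ | h
    · rw [hη1 _ _ _ hz hzt, hη1 _ _ _ (fibre_mate ht₀ hs hz), sidePt_sub, sidePt_sub,
        ← hglue s t₀ ht₀ hs hz]
      · congr 4
        ring_nf
      · rw [dist_sidePt] at hzt ⊢
        rw [abs_sub_comm] at hzt
        rwa [show 1 - t - (1 - t₀) = t₀ - t by ring]
    · have := h t ht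
      rw [dist_comm] at this
      linarith [hr.pos]
  have hη_glue' : ∀ s t, t ∈ Icc (0 : ℝ) 1 → Q.mate s ≠ s →
      η (Q.mate s).1 (sidePt (Q.mate s).2 (1 - t)) = η s.1 (sidePt s.2 t) := by
    intro s t ht hs
    by_cases h1 : ∃ z, (s.1, z) ∈ Q.fibre p ∧ dist (sidePt s.2 t) z < 2 * r
    · exact hη_glue s t ht hs h1
    by_cases h2 : ∃ z, ((Q.mate s).1, z) ∈ Q.fibre p ∧
        dist (sidePt (Q.mate s).2 (1 - t)) z < 2 * r
    · have := hη_glue (Q.mate s) (1 - t) ⟨by linarith [ht.2], by linarith [ht.1]⟩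
        (by rw [Q.mate_mate]; exact hs.symm) h2
      rw [Q.mate_mate, sub_sub_cancel] at this
      exact this.symm
    · push Not at h1 h2
      rw [hη0 _ _ h1, hη0 _ _ h2]
  have hη_lip : ∀ f w w', η f w - η f w' ≤ dist w w' := by
    intro f w w'
    by_cases h : ∃ z, (f, z) ∈ Q.fibre p ∧ dist w z < 2 * r
    · obtain ⟨z, hz, hwz⟩ := h
      rw [hη1 f z w hz hwz]
      have h1 := hηle f z w' hz
      have h2 := hlip f z hz (w' - z) (w - z)
      rw [dist_sub_right, dist_comm] at h2
      have h3 : max 0 (r - ψ f z (w - z)) ≤ max 0 (r - ψ f z (w' - z)) + dist w w' := by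
        refine max_le (add_nonneg (le_max_left _ _) dist_nonneg) ?_
        linarith [le_max_right 0 (r - ψ f z (w' - z))]
      linarith
    · push Not at h
      rw [hη0 f w h]
      have : 0 ≤ η f w' := by
        simp only [η]
        split_ifs
        · exact le_max_left _ _
        · exact le_rfl
      linarith [dist_nonneg (x := w) (y := w')]
  obtain ⟨φ, hφ, hφη⟩ := Q.exists_descent hη_glue' hη_lip
  refine ⟨φ, hφ, fun f z w hz hw hwz => ?_, fun f w hw h => ?_⟩
  · rw [hφη f w hw, hη1 f z w hz hwz]
  · rw [hφη f w hw, hη0 f w h]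

theorem IsSeparating.exists_bump_norm {p : S} {r : ℝ} (hr : Q.IsSeparating p r) :
    ∃ φ : S → ℝ, (∀ q q', ENNReal.ofReal (φ q - φ q') ≤ Q.meshDist q q') ∧
      (∀ f z w, (f, z) ∈ Q.fibre p → w ∈ unitSquare → dist w z < 2 * r →
        φ (Q.param f w) = max 0 (r - ‖w - z‖)) ∧
      (∀ f w, w ∈ unitSquare → (∀ z, (f, z) ∈ Q.fibre p → 2 * r ≤ dist w z) →
        φ (Q.param f w) = 0) := by
  refine hr.exists_bump (ψ := fun _ _ v => ‖v‖) ?_ ?_ ?_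
  · intro f z _ v v'
    rw [dist_eq_norm]
    exact norm_sub_norm_le v v'
  · intro f z _ v
    linarith [hr.pos]
  · intro s t _ _ _ τ
    simp [norm_sideDir]

/-- Near a point, the distance from this point is the distance measured in a face. -/
theorem IsSeparating.meshDist_eq {p : S} {r : ℝ} (hr : Q.IsSeparating p r) {f : F} {z w : ℂ}
    (hz : (f, z) ∈ Q.fibre p) (hw : w ∈ unitSquare) (hwz : dist w z < r) :
    Q.meshDist p (Q.param f w) = edist w z := by
  obtain ⟨hz1, rfl⟩ := mem_fibre.1 hz
  refine le_antisymm ?_ ?_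
  · rw [edist_comm]
    exact meshDist_le_edist hz1 hw
  · obtain ⟨φ, h1, h2, -⟩ := hr.exists_bump_norm
    refine le_trans ?_ (h1 _ _)
    rw [h2 f z w hz hw (by linarith [hr.pos]), h2 f z z hz hz1 (by simpa using hr.pos), edist_dist]
    refine ENNReal.ofReal_le_ofReal ?_
    rw [sub_self, norm_zero, sub_zero, max_eq_right hr.pos.le, ← dist_eq_norm,
      max_eq_right (by linarith)]
    linarith

theorem IsSeparating.exists_near {p : S} {r : ℝ} (hr : Q.IsSeparating p r) {f : F} {w : ℂ}
    (hw : w ∈ unitSquare) (h : Q.meshDist p (Q.param f w) < ENNReal.ofReal r) :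
    ∃ z, (f, z) ∈ Q.fibre p ∧ dist w z < r ∧ Q.meshDist p (Q.param f w) = edist w z := by
  suffices ∃ z, (f, z) ∈ Q.fibre p ∧ dist w z < r by
    obtain ⟨z, hz, hwz⟩ := this
    exact ⟨z, hz, hwz, hr.meshDist_eq hz hw hwz⟩
  by_contra! hcon
  obtain ⟨g, z₀, hz₀, hp⟩ := Q.exists_param p
  obtain ⟨φ, h1, h2, h3⟩ := hr.exists_bump_norm
  have hp' : φ p = r := by
    rw [← hp, h2 g z₀ z₀ ⟨hz₀, hp⟩ hz₀ (by simpa using hr.pos)]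
    simpa using hr.pos.le
  have hq : φ (Q.param f w) = 0 := by
    by_cases hex : ∃ z, (f, z) ∈ Q.fibre p ∧ dist w z < 2 * r
    · obtain ⟨z, hz, hwz⟩ := hex
      rw [h2 f z w hz hw hwz, ← dist_eq_norm, max_eq_left]
      linarith [hcon z hz]
    · push Not at hex
      exact h3 f w hw hex
  have := h1 p (Q.param f w)
  rw [hp', hq, sub_zero] at this
  exact absurd h (not_lt.2 this)

theorem eq_of_meshDist_eq_zero [Finite F] {p q : S} (h : Q.meshDist p q = 0) : p = q := by
  obtain ⟨r, hr⟩ := Q.exists_isSeparating p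
  obtain ⟨f, w, hw, rfl⟩ := Q.exists_param q
  obtain ⟨z, hz, -, h'⟩ := hr.exists_near hw (by rw [h]; simpa using hr.pos)
  rw [h, eq_comm, edist_eq_zero] at h'
  rw [h']
  exact hz.2.symm

/-- The quad-mesh metric induces the topology of the surface. -/
theorem nhds_hasBasis [Finite F] [T2Space S] (p : S) : (𝓝 p).HasBasis (fun ε : ℝ => 0 < ε)
    (fun ε => {q | Q.meshDist p q < ENNReal.ofReal ε}) := by
  obtain ⟨r, hr⟩ := Q.exists_isSeparating p
  refine ⟨fun U => ⟨fun hU => ?_, ?_⟩⟩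
  · have hev : ∀ᶠ ε in 𝓝[>] (0 : ℝ), ∀ a ∈ Q.fibre p, ∀ w ∈ unitSquare, dist w a.2 < ε →
        Q.param a.1 w ∈ U := by
      rw [Filter.eventually_all_finite (finite_fibre p)]
      rintro ⟨f, z⟩ ⟨hz, rfl⟩
      have := Q.continuousOn_param f z hz hU
      rw [Filter.mem_map, Metric.mem_nhdsWithin_iff] at this
      obtain ⟨ε, hε, h⟩ := this
      filter_upwards [Ioo_mem_nhdsGT hε] with ε' hε' w hw hwz
      exact h ⟨hwz.trans hε'.2, hw⟩
    obtain ⟨ε, ⟨h1, h2⟩⟩ := (hev.and (Ioo_mem_nhdsGT hr.pos)).exists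
    refine ⟨ε, h2.1, fun q hq => ?_⟩
    obtain ⟨f, w, hw, rfl⟩ := Q.exists_param q
    obtain ⟨z, hz, hwz, -⟩ := (hr.mono h2.1 h2.2.le).exists_near hw hq
    exact h1 _ hz w hw hwz
  · rintro ⟨ε, hε, hU⟩
    have hr' := hr.mono (lt_min hr.pos hε) (min_le_left _ _)
    refine Filter.mem_of_superset ?_ hU
    have hclosed : IsClosed (⋃ f : F, Q.param f ''
        (unitSquare ∩ {w | ∀ z, (f, z) ∈ Q.fibre p → min r ε ≤ dist w z})) := by
      refine isClosed_iUnion_of_finite fun f => IsCompact.isClosed ?_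
      refine IsCompact.image_of_continuousOn ?_ ((Q.continuousOn_param f).mono inter_subset_left)
      refine isCompact_unitSquare.inter_right ?_
      simp only [ofPred_forall]
      refine isClosed_iInter fun z => isClosed_iInter fun _ => ?_
      exact isClosed_le continuous_const (by fun_prop)
    have hp : p ∈ (⋃ f : F, Q.param f ''
        (unitSquare ∩ {w | ∀ z, (f, z) ∈ Q.fibre p → min r ε ≤ dist w z}))ᶜ := by
      simp only [mem_compl_iff, mem_iUnion, not_exists]
      rintro f ⟨w, ⟨hw, h⟩, hp⟩
      have := h w ⟨hw, hp⟩
      rw [dist_self] at this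
      exact absurd this (not_le.2 hr'.pos)
    refine Filter.mem_of_superset (hclosed.isOpen_compl.mem_nhds hp) fun q hq => ?_
    obtain ⟨f, w, hw, rfl⟩ := Q.exists_param q
    simp only [mem_compl_iff, mem_iUnion, not_exists] at hq
    have : ∃ z, (f, z) ∈ Q.fibre p ∧ dist w z < min r ε := by
      by_contra! hcon
      exact hq f ⟨w, ⟨hw, hcon⟩, rfl⟩
    obtain ⟨z, hz, hwz⟩ := this
    change Q.meshDist p _ < _
    rw [hr'.meshDist_eq hz hw hwz, edist_dist]
    exact (ENNReal.ofReal_lt_ofReal_iff hε).2 (hwz.trans_le (min_le_right _ _))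

/-! ### Developing a neighbourhood of a point into the plane -/

/-- Combinatorial data that lay out the faces around the point `p` in the plane: the part near `z`
of the square of the face `f`, for `(f, z)` over `p`, is translated so that `z` becomes the origin
and turned by the unit `a f z`. The pieces match along the glued sides and tile the region `H` near
the origin, boundary points being placed on the frontier of `H`. -/
structure IsLayout (Q : QuadMesh S F) (p : S) (H : Set ℂ) (a : F → ℂ → ℂ) (r : ℝ) : Prop where
  convex : Convex ℝ H
  pos : 0 < r
  unit : ∀ f z, (f, z) ∈ Q.fibre p → a f z ∈ axisUnits
  glue : ∀ s t, t ∈ Icc (0 : ℝ) 1 → Q.mate s ≠ s → (s.1, sidePt s.2 t) ∈ Q.fibre p →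
    a (Q.mate s).1 (sidePt (Q.mate s).2 (1 - t)) * sideDir (Q.mate s).2 =
      -(a s.1 (sidePt s.2 t) * sideDir s.2)
  mem : ∀ f z w, (f, z) ∈ Q.fibre p → w ∈ unitSquare → dist w z < r → a f z * (w - z) ∈ H
  cover : ∀ y ∈ H, ‖y‖ < r →
    ∃ f z w, (f, z) ∈ Q.fibre p ∧ w ∈ unitSquare ∧ a f z * (w - z) = y
  single : ∀ f z w f' z' w', (f, z) ∈ Q.fibre p → (f', z') ∈ Q.fibre p → w ∈ unitSquare →
    w' ∈ unitSquare → dist w z < r → dist w' z' < r → a f z * (w - z) = a f' z' * (w' - z') →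
    Q.param f w = Q.param f' w'
  boundary : ∀ f z w, (f, z) ∈ Q.fibre p → w ∈ unitSquare → dist w z < r →
    (Q.param f w ∈ Q.boundary ↔ a f z * (w - z) ∈ frontier H)

/-- The map `E` develops the ball of radius `δ` around `p` in the quad-mesh metric isometrically
onto the ball of radius `δ` around the origin of the region `H`; on the pieces of
faces around the points `(f, z)` over `p` it is the rotation by the unit `a f z`. -/
structure IsDeveloping (Q : QuadMesh S F) (p : S) (H : Set ℂ) (E : S → ℂ) (a : F → ℂ → ℂ)
    (δ : ℝ) : Prop where
  pos : 0 < δ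
  unit : ∀ f z, (f, z) ∈ Q.fibre p → a f z ∈ axisUnits
  apply_param : ∀ f z w, (f, z) ∈ Q.fibre p → w ∈ unitSquare → dist w z < δ →
    E (Q.param f w) = a f z * (w - z)
  meshDist_eq : ∀ f z w, (f, z) ∈ Q.fibre p → w ∈ unitSquare → dist w z < δ →
    Q.meshDist p (Q.param f w) = edist w z
  near : ∀ f w, w ∈ unitSquare → Q.meshDist p (Q.param f w) < ENNReal.ofReal δ →
    ∃ z, (f, z) ∈ Q.fibre p ∧ dist w z < δ
  isometry : ∀ q q', Q.meshDist p q < ENNReal.ofReal δ → Q.meshDist p q' < ENNReal.ofReal δ →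
    Q.meshDist q q' = edist (E q) (E q')
  mem : ∀ q, Q.meshDist p q < ENNReal.ofReal δ → E q ∈ H
  cover : ∀ y ∈ H, ‖y‖ < δ → ∃ q, Q.meshDist p q < ENNReal.ofReal δ ∧ E q = y
  boundary : ∀ q, Q.meshDist p q < ENNReal.ofReal δ → (q ∈ Q.boundary ↔ E q ∈ frontier H)

theorem exists_mem_fibre (p : S) : ∃ f z, (f, z) ∈ Q.fibre p := by
  obtain ⟨f, z, hz, hp⟩ := Q.exists_param p
  exact ⟨f, z, hz, hp⟩

theorem norm_unit_mul_sub {a z w : ℂ} (ha : a ∈ axisUnits) : ‖a * (w - z)‖ = dist w z := by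
  rw [norm_mul, norm_of_mem_axisUnits ha, one_mul, dist_eq_norm]

/-- A curve that increases distances locally by at most the factor `L` does so globally. -/
theorem meshDist_le_of_local {g : ℝ → S} {L : ℝ} (hL : 0 ≤ L)
    (h : ∀ t ∈ Icc (0 : ℝ) 1, ∃ ε > 0, ∀ s ∈ Icc (0 : ℝ) 1, |s - t| < ε →
      Q.meshDist (g t) (g s) ≤ ENNReal.ofReal (L * |s - t|)) :
    Q.meshDist (g 0) (g 1) ≤ ENNReal.ofReal L := by
  set A : Set ℝ := {t | t ∈ Icc (0 : ℝ) 1 ∧ Q.meshDist (g 0) (g t) ≤ ENNReal.ofReal (L * t)}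
  have h0 : (0 : ℝ) ∈ A := ⟨by simp, by simp [meshDist_self]⟩
  have hbdd : BddAbove A := ⟨1, fun t ht => ht.1.2⟩
  set T := sSup A
  have hT : T ∈ Icc (0 : ℝ) 1 := ⟨le_csSup hbdd h0, csSup_le ⟨_, h0⟩ fun t ht => ht.1.2⟩
  obtain ⟨ε, hε, hloc⟩ := h T hT
  have hTA : T ∈ A := by
    obtain ⟨t, ht, htT⟩ := exists_lt_of_lt_csSup ⟨_, h0⟩ (show T - ε < T by linarith)
    have htT' : t ≤ T := le_csSup hbdd ht
    refine ⟨hT, (meshDist_triangle _ (g t) _).trans ?_⟩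
    have h1 := hloc t ht.1 (by rw [abs_sub_lt_iff]; constructor <;> linarith)
    rw [meshDist_comm] at h1
    refine (add_le_add ht.2 h1).trans ?_
    rw [← ENNReal.ofReal_add (mul_nonneg hL ht.1.1) (by positivity), abs_sub_comm,
      abs_of_nonneg (by linarith : 0 ≤ T - t)]
    exact ENNReal.ofReal_le_ofReal (by linarith)
  rcases eq_or_lt_of_le hT.2 with h1 | h1
  · have := hTA.2
    rwa [h1, mul_one] at this
  · exfalso
    have hpos : 0 < min (ε / 2) (1 - T) := lt_min (by positivity) (by linarith)
    set s := T + min (ε / 2) (1 - T) with hs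
    have hsI : s ∈ Icc (0 : ℝ) 1 :=
      ⟨by linarith [hT.1], by linarith [min_le_right (ε / 2) (1 - T)]⟩
    have habs : |s - T| = s - T := abs_of_nonneg (by linarith)
    have h2 := hloc s hsI (by rw [habs]; linarith [min_le_left (ε / 2) (1 - T)])
    have : s ∈ A := by
      refine ⟨hsI, (meshDist_triangle _ (g T) _).trans ((add_le_add hTA.2 h2).trans ?_)⟩
      rw [habs, ← ENNReal.ofReal_add (mul_nonneg hL hT.1) (mul_nonneg hL (by linarith))]
      exact ENNReal.ofReal_le_ofReal (by linarith)
    linarith [le_csSup hbdd this]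

namespace IsLayout

variable {p : S} {H : Set ℂ} {a : F → ℂ → ℂ} {r : ℝ}

theorem mono (h : Q.IsLayout p H a r) {r' : ℝ} (h0 : 0 < r') (hr : r' ≤ r) :
    Q.IsLayout p H a r' where
  convex := h.convex
  pos := h0
  unit := h.unit
  glue := h.glue
  mem f z w hz hw hd := h.mem f z w hz hw (hd.trans_le hr)
  cover y hy hn := h.cover y hy (hn.trans_le hr)
  single f z w f' z' w' hz hz' hw hw' hd hd' :=
    h.single f z w f' z' w' hz hz' hw hw' (hd.trans_le hr) (hd'.trans_le hr)
  boundary f z w hz hw hd := h.boundary f z w hz hw (hd.trans_le hr)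

/-- The layout does not increase distances: the distance from a point of the layout is a bump
function on the surface. -/
theorem edist_le (h : Q.IsLayout p H a r) (hr : Q.IsSeparating p r) {f f' : F} {z z' w w' : ℂ}
    (hz : (f, z) ∈ Q.fibre p) (hz' : (f', z') ∈ Q.fibre p) (hw : w ∈ unitSquare)
    (hw' : w' ∈ unitSquare) (hd : dist w z < r / 2) (hd' : dist w' z' < r / 2) :
    edist (a f z * (w - z)) (a f' z' * (w' - z')) ≤
      Q.meshDist (Q.param f w) (Q.param f' w') := by
  have hpos := hr.pos
  set y := a f z * (w - z) with hy
  have hyn : ‖y‖ < r / 2 := by rw [hy, norm_unit_mul_sub (h.unit f z hz)]; exact hd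
  obtain ⟨φ, h1, h2, -⟩ := hr.exists_bump (ψ := fun g x v => ‖a g x * v - y‖) (by
      intro g x hx v v'
      refine (norm_sub_norm_le _ _).trans (le_of_eq ?_)
      rw [sub_sub_sub_cancel_right, ← mul_sub, norm_unit_mul_sub (h.unit g x hx)]) (by
      intro g x hx v
      have h3 := norm_sub_norm_le (a g x * v) y
      rw [norm_mul, norm_of_mem_axisUnits (h.unit g x hx), one_mul] at h3
      linarith) (by
      intro s t ht hs hst τ
      have h3 := h.glue s t ht hs hst
      congr 2
      push_cast
      linear_combination (-(τ : ℂ)) * h3)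
  refine le_trans ?_ (h1 _ _)
  have hyn' : ‖a f' z' * (w' - z')‖ < r / 2 := by
    rw [norm_unit_mul_sub (h.unit f' z' hz')]; exact hd'
  have h4 := norm_sub_le (a f' z' * (w' - z')) y
  rw [h2 f z w hz hw (by linarith), h2 f' z' w' hz' hw' (by linarith), ← hy, sub_self, norm_zero,
    sub_zero, max_eq_right hpos.le, max_eq_right (by linarith), sub_sub_cancel, ← dist_eq_norm,
    edist_comm, edist_dist]

/-- The layout does not decrease distances: a segment in the layout runs through finitely many
faces. -/
theorem le_edist [Finite F] (h : Q.IsLayout p H a r) {f f' : F} {z z' w w' : ℂ}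
    (hz : (f, z) ∈ Q.fibre p) (hz' : (f', z') ∈ Q.fibre p) (hw : w ∈ unitSquare)
    (hw' : w' ∈ unitSquare) (hd : dist w z < r) (hd' : dist w' z' < r) :
    Q.meshDist (Q.param f w) (Q.param f' w') ≤
      edist (a f z * (w - z)) (a f' z' * (w' - z')) := by
  set y := a f z * (w - z) with hy
  set y' := a f' z' * (w' - z') with hy'
  have hdist : ∀ g x v, (g, x) ∈ Q.fibre p → dist v x = ‖a g x * (v - x)‖ :=
    fun g x v hx => (norm_unit_mul_sub (h.unit g x hx)).symm
  have hyH : y ∈ H ∩ Metric.ball 0 r :=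
    ⟨h.mem f z w hz hw hd, by rw [mem_ball_zero_iff, hy, ← hdist f z w hz]; exact hd⟩
  have hyH' : y' ∈ H ∩ Metric.ball 0 r :=
    ⟨h.mem f' z' w' hz' hw' hd', by rw [mem_ball_zero_iff, hy', ← hdist f' z' w' hz']; exact hd'⟩
  have hG : ∀ y, ∃ q, y ∈ H ∩ Metric.ball 0 r → ∀ g x v, (g, x) ∈ Q.fibre p → v ∈ unitSquare →
      a g x * (v - x) = y → Q.param g v = q := by
    intro y
    by_cases hy : y ∈ H ∩ Metric.ball 0 r
    · obtain ⟨g, x, v, hx, hv, hxv⟩ := h.cover y hy.1 (mem_ball_zero_iff.1 hy.2)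
      have hn := mem_ball_zero_iff.1 hy.2
      refine ⟨Q.param g v, fun _ g' x' v' hx' hv' hxv' => ?_⟩
      exact h.single _ _ _ _ _ _ hx' hx hv' hv (by rw [hdist g' x' v' hx', hxv']; exact hn)
        (by rw [hdist g x v hx, hxv]; exact hn) (hxv'.trans hxv.symm)
    · exact ⟨p, fun h => absurd h hy⟩
  choose G hG using hG
  set Y : ℝ → ℂ := fun t => AffineMap.lineMap y y' t with hY
  have hYmem : ∀ t ∈ Icc (0 : ℝ) 1, Y t ∈ H ∩ Metric.ball 0 r := fun t ht =>
    (h.convex.inter (convex_ball 0 r)).lineMap_mem hyH hyH' ht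
  have key := Q.meshDist_le_of_local (g := G ∘ Y) (L := dist y y') dist_nonneg ?_
  · have e0 : Y 0 = y := by simp [hY]
    have e1 : Y 1 = y' := by simp [hY]
    rw [Function.comp_apply, Function.comp_apply, e0, e1, ← hG y hyH f z w hz hw rfl,
      ← hG y' hyH' f' z' w' hz' hw' rfl, ← edist_dist] at key
    exact key
  · intro t ht
    have hev : ∀ᶠ s in 𝓝 t, ∀ b ∈ Q.fibre p,
        b.2 + (a b.1 b.2)⁻¹ * Y s ∈ unitSquare → b.2 + (a b.1 b.2)⁻¹ * Y t ∈ unitSquare := by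
      rw [Filter.eventually_all_finite (finite_fibre p)]
      intro b _
      by_cases hb : b.2 + (a b.1 b.2)⁻¹ * Y t ∈ unitSquare
      · exact Filter.Eventually.of_forall fun _ _ => hb
      · have hcont : Continuous fun s : ℝ => b.2 + (a b.1 b.2)⁻¹ * Y s := by
          have : Continuous Y := AffineMap.lineMap_continuous
          fun_prop
        filter_upwards [(isClosed_unitSquare.isOpen_compl.preimage hcont).mem_nhds hb]
          with s hs hs'
        exact absurd hs' hs
    obtain ⟨ε, hε, hev⟩ := Metric.eventually_nhds_iff.1 hev
    refine ⟨ε, hε, fun s hs hst => ?_⟩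
    have hst' := hev (y := s) (by rwa [Real.dist_eq])
    obtain ⟨g, x, v, hx, hv, hxv⟩ := h.cover (Y s) (hYmem s hs).1
      (mem_ball_zero_iff.1 (hYmem s hs).2)
    have ha := ne_zero_of_mem_axisUnits (h.unit g x hx)
    have hv' : x + (a g x)⁻¹ * Y s = v := by
      rw [← hxv, inv_mul_cancel_left₀ ha, add_sub_cancel]
    have ht' := hst' (g, x) hx (by rw [hv']; exact hv)
    rw [Function.comp_apply, Function.comp_apply, ← hG (Y s) (hYmem s hs) g x v hx hv hxv,
      ← hG (Y t) (hYmem t ht) g x _ hx ht' (by rw [add_sub_cancel_left, mul_inv_cancel_left₀ ha])]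
    refine (meshDist_le_edist ht' hv).trans (le_of_eq ?_)
    rw [edist_dist, ← hv', dist_add_left, dist_eq_norm, ← mul_sub, norm_mul, norm_inv,
      norm_of_mem_axisUnits (h.unit g x hx), inv_one, one_mul, ← dist_eq_norm,
      dist_lineMap_lineMap, Real.dist_eq, abs_sub_comm, mul_comm]

/-- A layout of the faces around a point yields a developing map. -/
theorem exists_isDeveloping [Finite F] (h : Q.IsLayout p H a r) :
    ∃ E δ, Q.IsDeveloping p H E a δ := by
  classical
  obtain ⟨r₁, hr₁⟩ := Q.exists_isSeparating p
  have hpos : 0 < min r r₁ := lt_min h.pos hr₁.pos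
  replace h := h.mono hpos (min_le_left _ _)
  have hr := hr₁.mono hpos (min_le_right _ _)
  generalize min r r₁ = r at h hr hpos
  have hle : r / 2 ≤ r := by linarith
  let E : S → ℂ := fun q =>
    if hq : ∃ b : F × ℂ × ℂ, (b.1, b.2.1) ∈ Q.fibre p ∧ b.2.2 ∈ unitSquare ∧
      dist b.2.2 b.2.1 < r / 2 ∧ Q.param b.1 b.2.2 = q then
      a hq.choose.1 hq.choose.2.1 * (hq.choose.2.2 - hq.choose.2.1) else 0
  have hE : ∀ f z w, (f, z) ∈ Q.fibre p → w ∈ unitSquare → dist w z < r / 2 →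
      E (Q.param f w) = a f z * (w - z) := by
    intro f z w hz hw hd
    have hq : ∃ b : F × ℂ × ℂ, (b.1, b.2.1) ∈ Q.fibre p ∧ b.2.2 ∈ unitSquare ∧
      dist b.2.2 b.2.1 < r / 2 ∧ Q.param b.1 b.2.2 = Q.param f w := ⟨(f, z, w), hz, hw, hd, rfl⟩
    obtain ⟨h1, h2, h3, h4⟩ := hq.choose_spec
    have h5 := h.edist_le hr h1 hz h2 hw h3 hd
    rw [h4, meshDist_self] at h5
    simp only [E]
    rw [dif_pos hq]
    exact edist_eq_zero.1 (le_antisymm h5 (zero_le))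
  have hnear : ∀ q, Q.meshDist p q < ENNReal.ofReal (r / 2) → ∃ f z w, (f, z) ∈ Q.fibre p ∧
      w ∈ unitSquare ∧ dist w z < r / 2 ∧ Q.param f w = q := by
    intro q hq
    obtain ⟨f, w, hw, rfl⟩ := Q.exists_param q
    obtain ⟨z, hz, hd, -⟩ := (hr.mono (by linarith) hle).exists_near hw hq
    exact ⟨f, z, w, hz, hw, hd, rfl⟩
  refine ⟨E, r / 2, by linarith, h.unit, hE, fun f z w hz hw hd => ?_, fun f w hw hd => ?_,
    fun q q' hq hq' => ?_, fun q hq => ?_, fun y hy hn => ?_, fun q hq => ?_⟩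
  · exact hr.meshDist_eq hz hw (by linarith)
  · obtain ⟨z, hz, hd, -⟩ := (hr.mono (by linarith) hle).exists_near hw hd
    exact ⟨z, hz, hd⟩
  · obtain ⟨f, z, w, hz, hw, hd, rfl⟩ := hnear q hq
    obtain ⟨f', z', w', hz', hw', hd', rfl⟩ := hnear q' hq'
    rw [hE f z w hz hw hd, hE f' z' w' hz' hw' hd']
    exact le_antisymm (h.le_edist hz hz' hw hw' (by linarith) (by linarith))
      (h.edist_le hr hz hz' hw hw' hd hd')
  · obtain ⟨f, z, w, hz, hw, hd, rfl⟩ := hnear q hq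
    rw [hE f z w hz hw hd]
    exact h.mem f z w hz hw (by linarith)
  · obtain ⟨f, z, w, hz, hw, rfl⟩ := h.cover y hy (by linarith)
    rw [norm_unit_mul_sub (h.unit f z hz)] at hn
    refine ⟨Q.param f w, ?_, hE f z w hz hw hn⟩
    rw [hr.meshDist_eq hz hw (by linarith), edist_dist]
    exact (ENNReal.ofReal_lt_ofReal_iff (by linarith)).2 hn
  · obtain ⟨f, z, w, hz, hw, hd, rfl⟩ := hnear q hq
    rw [hE f z w hz hw hd]
    exact h.boundary f z w hz hw (by linarith)

end IsLayout

namespace IsDeveloping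

variable {p : S} {H : Set ℂ} {E : S → ℂ} {a : F → ℂ → ℂ} {δ : ℝ}

theorem meshDist_self_lt (h : Q.IsDeveloping p H E a δ) :
    Q.meshDist p p < ENNReal.ofReal δ := by
  rw [meshDist_self]
  exact ENNReal.ofReal_pos.2 h.pos

theorem apply_self (h : Q.IsDeveloping p H E a δ) : E p = 0 := by
  obtain ⟨f, z, hz⟩ := Q.exists_mem_fibre p
  have := h.apply_param f z z hz hz.1 (by simpa using h.pos)
  rwa [hz.2, sub_self, mul_zero] at this

theorem meshDist_eq_norm (h : Q.IsDeveloping p H E a δ) {q : S}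
    (hq : Q.meshDist p q < ENNReal.ofReal δ) : Q.meshDist p q = ENNReal.ofReal ‖E q‖ := by
  rw [h.isometry p q h.meshDist_self_lt hq, h.apply_self, edist_dist, dist_zero_left]

theorem norm_lt (h : Q.IsDeveloping p H E a δ) {q : S}
    (hq : Q.meshDist p q < ENNReal.ofReal δ) : ‖E q‖ < δ := by
  have := hq
  rwa [h.meshDist_eq_norm hq, ENNReal.ofReal_lt_ofReal_iff h.pos] at this

theorem injective [Finite F] (h : Q.IsDeveloping p H E a δ) {q q' : S}
    (hq : Q.meshDist p q < ENNReal.ofReal δ) (hq' : Q.meshDist p q' < ENNReal.ofReal δ)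
    (he : E q = E q') : q = q' := by
  refine eq_of_meshDist_eq_zero (Q := Q) ?_
  rw [h.isometry q q' hq hq', he, edist_self]

/-- The developing map is a flat chart in which the cross field is constant. -/
theorem exists_chart [Finite F] [T2Space S] (h : Q.IsDeveloping p H E a δ) :
    ∃ e : OpenPartialHomeomorph S H, p ∈ e.source ∧ Q.IsFlatChart e ∧
      ∀ f, ∀ w ∈ unitSquare, Q.param f w ∈ e.source → ∃ u ∈ axisUnits,
        ∀ᶠ w' in 𝓝[unitSquare] w, (e (Q.param f w') : ℂ) = e (Q.param f w) + u * (w' - w) := by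
  classical
  have h0 : (0 : ℂ) ∈ H := by
    rw [← h.apply_self]
    exact h.mem p h.meshDist_self_lt
  set B : Set S := {q | Q.meshDist p q < ENNReal.ofReal δ} with hB
  have hBnhds : ∀ q ∈ B, ∃ ε > 0, ∀ q', Q.meshDist q q' < ENNReal.ofReal ε → q' ∈ B := by
    intro q hq
    have h1 := h.norm_lt hq
    refine ⟨δ - ‖E q‖, by linarith, fun q' hq' => ?_⟩
    refine (meshDist_triangle p q q').trans_lt ?_
    rw [h.meshDist_eq_norm hq]
    refine (ENNReal.add_lt_add_left ENNReal.ofReal_ne_top hq').trans_le (le_of_eq ?_)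
    rw [← ENNReal.ofReal_add (norm_nonneg _) (by linarith), add_sub_cancel]
  have hBopen : IsOpen B := by
    rw [isOpen_iff_mem_nhds]
    intro q hq
    obtain ⟨ε, hε, hsub⟩ := hBnhds q hq
    exact (Q.nhds_hasBasis q).mem_iff.2 ⟨ε, hε, hsub⟩
  have hG : ∀ y, ∃ q, y ∈ H → ‖y‖ < δ → q ∈ B ∧ E q = y := by
    intro y
    by_cases hy : y ∈ H ∧ ‖y‖ < δ
    · obtain ⟨q, hq⟩ := h.cover y hy.1 hy.2
      exact ⟨q, fun _ _ => hq⟩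
    · exact ⟨p, fun h1 h2 => absurd ⟨h1, h2⟩ hy⟩
  choose G hG using hG
  let toH : S → H := fun q => if hq : E q ∈ H then ⟨E q, hq⟩ else ⟨0, h0⟩
  have htoH : ∀ q ∈ B, (toH q : ℂ) = E q := by
    intro q hq
    simp only [toH]
    rw [dif_pos (h.mem q hq)]
  let e : OpenPartialHomeomorph S H :=
    { toFun := toH
      invFun := fun y => G y
      source := B
      target := {y | ‖(y : ℂ)‖ < δ}
      map_source' := fun q hq => by
        change ‖(toH q : ℂ)‖ < δ
        rw [htoH q hq]
        exact h.norm_lt hq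
      map_target' := fun y hy => (hG y y.2 hy).1
      left_inv' := fun q hq => by
        have h1 := hG (toH q) (toH q).2 (by rw [htoH q hq]; exact h.norm_lt hq)
        exact h.injective h1.1 hq (h1.2.trans (htoH q hq))
      right_inv' := fun y hy => by
        have h1 := hG y y.2 hy
        exact Subtype.ext ((htoH _ h1.1).trans h1.2)
      open_source := hBopen
      open_target := isOpen_lt (by fun_prop) continuous_const
      continuousOn_toFun := by
        intro q hq
        apply ContinuousAt.continuousWithinAt
        rw [ContinuousAt, (Q.nhds_hasBasis q).tendsto_iff Metric.nhds_basis_ball]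
        intro ε hε
        obtain ⟨ε', hε', hsub⟩ := hBnhds q hq
        refine ⟨min ε ε', lt_min hε hε', fun q' hq' => ?_⟩
        have hq'B : q' ∈ B := hsub q'
          (hq'.trans_le (ENNReal.ofReal_le_ofReal (min_le_right _ _)))
        have h1 := hq'.trans_le (ENNReal.ofReal_le_ofReal (min_le_left _ _))
        rw [h.isometry q q' hq hq'B, edist_dist, ENNReal.ofReal_lt_ofReal_iff hε] at h1
        rw [Metric.mem_ball, dist_comm, Subtype.dist_eq, htoH q hq, htoH q' hq'B]
        exact h1
      continuousOn_invFun := by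
        intro y hy
        rw [ContinuousWithinAt, (nhdsWithin_hasBasis Metric.nhds_basis_ball _).tendsto_iff
          (Q.nhds_hasBasis _)]
        intro ε hε
        refine ⟨ε, hε, fun y' hy' => ?_⟩
        have h1 := hG y y.2 hy
        have h2 := hG y' y'.2 hy'.2
        change Q.meshDist (G y) (G y') < _
        rw [h.isometry _ _ h1.1 h2.1, h1.2, h2.2, edist_dist, ENNReal.ofReal_lt_ofReal_iff hε,
          dist_comm]
        exact hy'.1 }
  refine ⟨e, h.meshDist_self_lt, ⟨fun q hq q' hq' => ?_, fun q hq => ?_⟩, fun f w hw hq => ?_⟩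
  · rw [h.isometry q q' hq hq', ← htoH q hq, ← htoH q' hq']
    rfl
  · rw [h.boundary q hq, ← htoH q hq]
    rfl
  · obtain ⟨z, hz, hd⟩ := h.near f w hw hq
    refine ⟨a f z, h.unit f z hz, ?_⟩
    have hval : ∀ w' ∈ unitSquare, dist w' z < δ →
        (e (Q.param f w') : ℂ) = a f z * (w' - z) := by
      intro w' hw' hd'
      rw [← h.apply_param f z w' hz hw' hd']
      refine htoH _ ?_
      change Q.meshDist _ _ < _
      rw [h.meshDist_eq f z w' hz hw' hd', edist_dist]
      exact (ENNReal.ofReal_lt_ofReal_iff h.pos).2 hd'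
    have hnhds : ∀ᶠ w' in 𝓝[unitSquare] w, w' ∈ Metric.ball z δ :=
      nhdsWithin_le_nhds (Metric.isOpen_ball.mem_nhds hd)
    filter_upwards [hnhds, self_mem_nhdsWithin] with w' hw' hw'sq
    rw [hval w' hw'sq hw', hval w hw hd]
    ring

end IsDeveloping

/-! ### Layouts around the regular points -/

theorem not_exists_sidePt_of_mem_Ioo {i : Fin 4} {x : ℂ} (h1 : x.re ∈ Ioo (0 : ℝ) 1)
    (h2 : x.im ∈ Ioo (0 : ℝ) 1) :
    ¬ ∃ j, ∃ t ∈ Icc (0 : ℝ) 1, corner i + sideDir i * x = sidePt j t := by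
  rintro ⟨j, t, -, h⟩
  have h3 := corner_add_mul_sidePt i (j - i) t
  rw [add_sub_cancel, ← h, add_right_inj] at h3
  have h4 := mul_left_cancel₀ (sideDir_ne_zero i) h3
  have h5 := coord_of_sidePt (j - i) t
  rw [h4] at h5
  rcases h5 with h5 | h5 | h5 | h5 <;> [have := h1.1; have := h1.2; have := h2.1; have := h2.2] <;>
    linarith

/-- A point on a boundary side, other than an end point, is identified with no other point. -/
theorem eq_of_param_boundary_sidePt_eq {s : F × Fin 4} (hs : Q.mate s = s) {t : ℝ}
    (ht : t ∈ Ioo (0 : ℝ) 1) {g : F} {w : ℂ} (hw : w ∈ unitSquare)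
    (h : Q.param s.1 (sidePt s.2 t) = Q.param g w) : (g, w) = (s.1, sidePt s.2 t) := by
  refine mem_of_param_eq (Q := Q) (X := {(s.1, sidePt s.2 t)})
    ?_ (sidePt_mem _ (Ioo_subset_Icc_self ht)) hw h rfl
  intro s' t' htt hs' hmem
  rw [mem_singleton_iff, Prod.mk.injEq] at hmem
  obtain ⟨h1, -⟩ := sidePt_eq_sidePt ht htt hmem.2.symm
  have : s' = s := Prod.ext hmem.1 h1.symm
  exact absurd (this ▸ hs) hs'

theorem exists_isLayout_of_interior {f : F} {z : ℂ} (hz : z ∈ unitSquare)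
    (h : ¬ ∃ i, ∃ t ∈ Icc (0 : ℝ) 1, z = sidePt i t) :
    ∃ a r, Q.IsLayout (Q.param f z) univ a r := by
  have hcoord : z.re ∈ Ioo (0 : ℝ) 1 ∧ z.im ∈ Ioo (0 : ℝ) 1 := by
    obtain ⟨⟨h1, h2⟩, h3, h4⟩ := mem_unitSquare.1 hz
    have h5 : ¬ (z.re = 0 ∨ z.re = 1 ∨ z.im = 0 ∨ z.im = 1) := fun h' => h (exists_sidePt hz h')
    push Not at h5
    exact ⟨⟨lt_of_le_of_ne h1 h5.1.symm, lt_of_le_of_ne h2 h5.2.1⟩,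
      ⟨lt_of_le_of_ne h3 h5.2.2.1.symm, lt_of_le_of_ne h4 h5.2.2.2⟩⟩
  obtain ⟨⟨h1, h2⟩, h3, h4⟩ := hcoord
  obtain ⟨r, hr⟩ : ∃ r, r = min (min z.re (1 - z.re)) (min z.im (1 - z.im)) := ⟨_, rfl⟩
  have hr0 : 0 < r := by rw [hr]; simp [h1, h2, h3, h4]
  have hr1 : r ≤ z.re := hr ▸ (min_le_left _ _).trans (min_le_left _ _)
  have hr2 : r ≤ 1 - z.re := hr ▸ (min_le_left _ _).trans (min_le_right _ _)
  have hr3 : r ≤ z.im := hr ▸ (min_le_right _ _).trans (min_le_left _ _)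
  have hr4 : r ≤ 1 - z.im := hr ▸ (min_le_right _ _).trans (min_le_right _ _)
  have hball : ∀ y : ℂ, ‖y‖ < r → (z + y).re ∈ Ioo (0 : ℝ) 1 ∧ (z + y).im ∈ Ioo (0 : ℝ) 1 := by
    intro y hy
    obtain ⟨h5, h6⟩ := abs_lt.1 ((Complex.abs_re_le_norm y).trans_lt hy)
    obtain ⟨h7, h8⟩ := abs_lt.1 ((Complex.abs_im_le_norm y).trans_lt hy)
    simp only [Complex.add_re, Complex.add_im, mem_Ioo]
    refine ⟨⟨?_, ?_⟩, ?_, ?_⟩ <;> linarith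
  have hfib : ∀ g x, (g, x) ∈ Q.fibre (Q.param f z) → g = f ∧ x = z := fun g x hx =>
    eq_of_param_eq hz hx.1 hx.2.symm h
  refine ⟨fun _ _ => 1, r, convex_univ, hr0, fun _ _ _ => by simp [axisUnits], ?_,
    fun _ _ _ _ _ _ => mem_univ _, ?_, ?_, ?_⟩
  · intro s t ht _ hs
    exact absurd ⟨_, t, ht, (hfib _ _ hs).2.symm⟩ h
  · intro y _ hy
    obtain ⟨h5, h6⟩ := hball y hy
    exact ⟨f, z, z + y, ⟨hz, rfl⟩, ⟨Ioo_subset_Icc_self h5, Ioo_subset_Icc_self h6⟩, by simp⟩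
  · intro g x w g' x' w' hx hx' _ _ _ _ hww
    obtain ⟨rfl, rfl⟩ := hfib g x hx
    obtain ⟨rfl, rfl⟩ := hfib g' x' hx'
    rw [one_mul, one_mul, sub_left_inj] at hww
    rw [hww]
  · intro g x w hx hw hd
    obtain ⟨rfl, rfl⟩ := hfib g x hx
    rw [frontier_univ]
    refine iff_of_false (not_mem_boundary_of_interior hw ?_) (notMem_empty _)
    rw [dist_eq_norm] at hd
    obtain ⟨h5, h6⟩ := hball _ hd
    rw [add_sub_cancel] at h5 h6
    rintro ⟨j, t, -, rfl⟩
    rcases coord_of_sidePt j t with h7 | h7 | h7 | h7 <;>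
      [have := h5.1; have := h5.2; have := h6.1; have := h6.2] <;> linarith

/-- Near an interior point of a side the square is a half-disc. -/
theorem exists_eq_sidePt_add {i : Fin 4} {t : ℝ} {w : ℂ} (hw : w ∈ unitSquare)
    (hd : dist w (sidePt i t) < min t (1 - t)) :
    ∃ x : ℂ, w = sidePt i t + sideDir i * x ∧ ‖x‖ < min t (1 - t) ∧ 0 ≤ x.im ∧
      (x.im = 0 → w = sidePt i (t + x.re) ∧ t + x.re ∈ Ioo (0 : ℝ) 1) ∧
      (0 < x.im → ¬ ∃ j, ∃ t ∈ Icc (0 : ℝ) 1, w = sidePt j t) := by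
  obtain ⟨x, rfl⟩ : ∃ x, w = sidePt i t + sideDir i * x :=
    ⟨(sideDir i)⁻¹ * (w - sidePt i t), by rw [mul_inv_cancel_left₀ (sideDir_ne_zero i)]; ring⟩
  rw [dist_self_add_left, norm_mul, norm_sideDir, one_mul] at hd
  obtain ⟨hd1, hd2⟩ := lt_min_iff.1 hd
  obtain ⟨h5, h6⟩ := abs_le.1 (Complex.abs_re_le_norm x)
  obtain ⟨h7, h8⟩ := abs_le.1 (Complex.abs_im_le_norm x)
  have heq : sidePt i t + sideDir i * x = corner i + sideDir i * (t + x) := by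
    rw [sidePt_eq]; ring
  rw [heq, corner_add_mul_mem] at hw
  have him : 0 ≤ x.im := by simpa using hw.2.1
  have hIoo : t + x.re ∈ Ioo (0 : ℝ) 1 := ⟨by linarith, by linarith⟩
  refine ⟨x, rfl, hd, him, fun h => ⟨?_, hIoo⟩, fun h => ?_⟩
  · rw [heq, sidePt_eq]
    congr 2
    apply Complex.ext <;> simp [h]
  · rw [heq]
    refine not_exists_sidePt_of_mem_Ioo ?_ ?_
    · simpa using hIoo
    · have : t ≤ 1 := by
        by_contra hlt
        linarith [norm_nonneg x]
      simpa using ⟨h, by linarith⟩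

theorem sidePt_add_mem {i : Fin 4} {t : ℝ} {x : ℂ} (hx : ‖x‖ < min t (1 - t)) (h0 : 0 ≤ x.im) :
    sidePt i t + sideDir i * x ∈ unitSquare := by
  obtain ⟨hd1, hd2⟩ := lt_min_iff.1 hx
  obtain ⟨h5, h6⟩ := abs_le.1 (Complex.abs_re_le_norm x)
  obtain ⟨h7, h8⟩ := abs_le.1 (Complex.abs_im_le_norm x)
  rw [sidePt_eq, add_assoc, ← mul_add, corner_add_mul_mem, mem_unitSquare]
  simp only [Complex.add_re, Complex.ofReal_re, Complex.add_im, Complex.ofReal_im, zero_add]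
  refine ⟨⟨?_, ?_⟩, ?_, ?_⟩ <;> linarith [norm_nonneg x]

theorem exists_isLayout_of_boundary_side {s : F × Fin 4} (hs : Q.mate s = s) {t : ℝ}
    (ht : t ∈ Ioo (0 : ℝ) 1) :
    ∃ a r, Q.IsLayout (Q.param s.1 (sidePt s.2 t)) {z | 0 ≤ z.im} a r := by
  have hfib : ∀ g x, (g, x) ∈ Q.fibre (Q.param s.1 (sidePt s.2 t)) →
      g = s.1 ∧ x = sidePt s.2 t := fun g x hx => by
    simpa using eq_of_param_boundary_sidePt_eq hs ht hx.1 hx.2.symm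
  have hne := sideDir_ne_zero s.2
  refine ⟨fun _ _ => (sideDir s.2)⁻¹, min t (1 - t), convex_halfSpace_im_ge 0,
    lt_min ht.1 (by linarith [ht.2]), fun _ _ _ => inv_mem_axisUnits (sideDir_mem_axisUnits _),
    ?_, ?_, ?_, ?_, ?_⟩
  · intro s' t' ht' hs' hmem
    obtain ⟨h1, h2⟩ := hfib _ _ hmem
    have : s' = s := Prod.ext h1 (sidePt_eq_sidePt ht ht' h2.symm).1.symm
    exact absurd (this ▸ hs) hs'
  · intro f z w hz hw hd
    obtain ⟨rfl, rfl⟩ := hfib f z hz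
    obtain ⟨x, rfl, -, hx, -⟩ := exists_eq_sidePt_add hw hd
    rw [add_sub_cancel_left, inv_mul_cancel_left₀ hne]
    exact hx
  · intro y hy hn
    exact ⟨s.1, sidePt s.2 t, sidePt s.2 t + sideDir s.2 * y,
      ⟨sidePt_mem _ (Ioo_subset_Icc_self ht), rfl⟩, sidePt_add_mem hn hy,
      by rw [add_sub_cancel_left, inv_mul_cancel_left₀ hne]⟩
  · intro f z w f' z' w' hz hz' _ _ _ _ hww
    obtain ⟨rfl, rfl⟩ := hfib f z hz
    obtain ⟨rfl, rfl⟩ := hfib f' z' hz'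
    rw [sub_left_inj.1 (mul_left_cancel₀ (inv_ne_zero hne) hww)]
  · intro f z w hz hw hd
    obtain ⟨rfl, rfl⟩ := hfib f z hz
    obtain ⟨x, hwx, -, hx, h1, h2⟩ := exists_eq_sidePt_add hw hd
    rw [Complex.frontier_setOfPred_le_im, hwx, add_sub_cancel_left, inv_mul_cancel_left₀ hne, ← hwx]
    change _ ↔ x.im = 0
    rcases eq_or_lt_of_le hx with h0 | h0
    · obtain ⟨h3, h4⟩ := h1 h0.symm
      rw [h3, mem_boundary_sidePt_iff h4]
      exact iff_of_true hs h0.symm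
    · exact iff_of_false (not_mem_boundary_of_interior hw (h2 h0)) h0.ne'

theorem exists_isLayout_of_glued_side {s : F × Fin 4} (hs : Q.mate s ≠ s) {t : ℝ}
    (ht : t ∈ Ioo (0 : ℝ) 1) :
    ∃ a r, Q.IsLayout (Q.param s.1 (sidePt s.2 t)) univ a r := by
  classical
  have ht' : 1 - t ∈ Ioo (0 : ℝ) 1 := ⟨by linarith [ht.2], by linarith [ht.1]⟩
  have hmin : min (1 - t) (1 - (1 - t)) = min t (1 - t) := by rw [sub_sub_cancel, min_comm]
  have hfib : ∀ g x, (g, x) ∈ Q.fibre (Q.param s.1 (sidePt s.2 t)) →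
      (g = s.1 ∧ x = sidePt s.2 t) ∨
      (g = (Q.mate s).1 ∧ x = sidePt (Q.mate s).2 (1 - t)) := fun g x hx => by
    simpa using eq_of_param_sidePt_eq ht hx.1 hx.2.symm
  have hne := sideDir_ne_zero s.2
  have hne' := sideDir_ne_zero (Q.mate s).2
  have hdiff : ((Q.mate s).1, sidePt (Q.mate s).2 (1 - t)) ≠ (s.1, sidePt s.2 t) := by
    intro h
    rw [Prod.mk.injEq] at h
    exact hs (Prod.ext h.1 (sidePt_eq_sidePt ht' (Ioo_subset_Icc_self ht) h.2).1)
  set a : F → ℂ → ℂ := fun g x =>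
    if (g, x) = (s.1, sidePt s.2 t) then (sideDir s.2)⁻¹ else -(sideDir (Q.mate s).2)⁻¹ with ha
  have ha1 : a s.1 (sidePt s.2 t) = (sideDir s.2)⁻¹ := if_pos rfl
  have ha2 : a (Q.mate s).1 (sidePt (Q.mate s).2 (1 - t)) = -(sideDir (Q.mate s).2)⁻¹ :=
    if_neg hdiff
  -- the two half-discs meet along the edge only
  have hmeet : ∀ w w', w ∈ unitSquare → w' ∈ unitSquare → dist w (sidePt s.2 t) < min t (1 - t) →
      dist w' (sidePt (Q.mate s).2 (1 - t)) < min t (1 - t) →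
      (sideDir s.2)⁻¹ * (w - sidePt s.2 t) =
        -(sideDir (Q.mate s).2)⁻¹ * (w' - sidePt (Q.mate s).2 (1 - t)) →
      Q.param s.1 w = Q.param (Q.mate s).1 w' := by
    intro w w' hw hw' hd hd' h
    rw [← hmin] at hd'
    obtain ⟨x, hwx, -, hx, h1, -⟩ := exists_eq_sidePt_add hw hd
    obtain ⟨x', hwx', -, hx', h1', -⟩ := exists_eq_sidePt_add hw' hd'
    rw [hwx, hwx', add_sub_cancel_left, inv_mul_cancel_left₀ hne, add_sub_cancel_left, neg_mul,
      inv_mul_cancel_left₀ hne'] at h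
    have him : x.im = -x'.im := by rw [h, Complex.neg_im]
    have hre : x'.re = -x.re := by rw [h, Complex.neg_re, neg_neg]
    obtain ⟨h2, h3⟩ := h1 (by linarith)
    obtain ⟨h2', -⟩ := h1' (by linarith)
    rw [h2, h2', hre, show 1 - t + -x.re = 1 - (t + x.re) by ring,
      param_mate s hs (Ioo_subset_Icc_self h3)]
  have hmem1 : (s.1, sidePt s.2 t) ∈ Q.fibre (Q.param s.1 (sidePt s.2 t)) :=
    ⟨sidePt_mem _ (Ioo_subset_Icc_self ht), rfl⟩
  have hmem2 := fibre_mate (Ioo_subset_Icc_self ht) hs hmem1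
  refine ⟨a, min t (1 - t), convex_univ, lt_min ht.1 ht'.1, ?_, ?_, fun _ _ _ _ _ _ => mem_univ _,
    ?_, ?_, ?_⟩
  · intro f z _
    rw [ha]
    dsimp only
    split_ifs
    · exact inv_mem_axisUnits (sideDir_mem_axisUnits _)
    · exact neg_mem_axisUnits (inv_mem_axisUnits (sideDir_mem_axisUnits _))
  · intro s' t' htt hs' hmem
    rcases hfib _ _ hmem with ⟨h1, h2⟩ | ⟨h1, h2⟩
    · obtain ⟨h3, rfl⟩ := sidePt_eq_sidePt ht htt h2.symm
      obtain rfl : s' = s := Prod.ext h1 h3.symm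
      rw [ha1, ha2, neg_mul, inv_mul_cancel₀ hne, inv_mul_cancel₀ hne']
    · obtain ⟨h3, rfl⟩ := sidePt_eq_sidePt ht' htt h2.symm
      obtain rfl : s' = Q.mate s := Prod.ext h1 h3.symm
      rw [Q.mate_mate, sub_sub_cancel, ha1, ha2, neg_mul, inv_mul_cancel₀ hne,
        inv_mul_cancel₀ hne', neg_neg]
  · intro y _ hn
    rcases le_total 0 y.im with h0 | h0
    · refine ⟨s.1, sidePt s.2 t, sidePt s.2 t + sideDir s.2 * y, hmem1, sidePt_add_mem hn h0, ?_⟩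
      rw [ha1, add_sub_cancel_left, inv_mul_cancel_left₀ hne]
    · refine ⟨(Q.mate s).1, sidePt (Q.mate s).2 (1 - t),
        sidePt (Q.mate s).2 (1 - t) + sideDir (Q.mate s).2 * (-y), hmem2,
        sidePt_add_mem (by rw [hmin, norm_neg]; exact hn) (by simpa using h0), ?_⟩
      rw [ha2, add_sub_cancel_left, neg_mul, inv_mul_cancel_left₀ hne', neg_neg]
  · intro f z w f' z' w' hz hz' hw hw' hd hd' hww
    rcases hfib f z hz with ⟨rfl, rfl⟩ | ⟨rfl, rfl⟩ <;>
      rcases hfib f' z' hz' with ⟨rfl, rfl⟩ | ⟨rfl, rfl⟩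
    · rw [ha1] at hww
      rw [sub_left_inj.1 (mul_left_cancel₀ (inv_ne_zero hne) hww)]
    · rw [ha1, ha2] at hww
      exact hmeet w w' hw hw' hd hd' hww
    · rw [ha1, ha2] at hww
      exact (hmeet w' w hw' hw hd' hd hww.symm).symm
    · rw [ha2] at hww
      rw [sub_left_inj.1 (mul_left_cancel₀ (neg_ne_zero.2 (inv_ne_zero hne')) hww)]
  · intro f z w hz hw hd
    rw [frontier_univ]
    refine iff_of_false ?_ (notMem_empty _)
    rcases hfib f z hz with ⟨rfl, rfl⟩ | ⟨rfl, rfl⟩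
    · obtain ⟨x, -, -, hx, h1, h2⟩ := exists_eq_sidePt_add hw hd
      rcases eq_or_lt_of_le hx with h0 | h0
      · obtain ⟨rfl, h4⟩ := h1 h0.symm
        rwa [mem_boundary_sidePt_iff h4]
      · exact not_mem_boundary_of_interior hw (h2 h0)
    · rw [← hmin] at hd
      obtain ⟨x, -, -, hx, h1, h2⟩ := exists_eq_sidePt_add hw hd
      rcases eq_or_lt_of_le hx with h0 | h0
      · obtain ⟨rfl, h4⟩ := h1 h0.symm
        rw [mem_boundary_sidePt_iff h4, Q.mate_mate]
        exact hs.symm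
      · exact not_mem_boundary_of_interior hw (h2 h0)

theorem corner_add_mul_I (i : Fin 4) (τ : ℝ) :
    corner i + sideDir i * (Complex.I * τ) = sidePt (i - 1) (1 - τ) := by
  have h := corner_add_mul_sidePt i 3 (1 - τ)
  have h3 : sidePt 3 (1 - τ) = Complex.I * τ := by
    simp [sidePt_eq, sideDir, corner]
    ring
  rw [h3] at h
  rw [h]
  congr 1
  rw [sub_eq_add_neg]
  rfl

/-- A layout around a vertex, from a labelling of the corners at this vertex by the quadrants
`u c · {re ≥ 0, im ≥ 0}` in which neighbouring corners are labelled by neighbouring quadrants. -/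
theorem exists_isLayout_of_corners {v : S} {H : Set ℂ} {u : F × Fin 4 → ℂ} (hv : v ∈ Q.vertices)
    (hH : Convex ℝ H) (hu : ∀ c ∈ Q.cornersAt v, u c ∈ axisUnits)
    (hinj : InjOn u (Q.cornersAt v))
    (hnext : ∀ c ∈ Q.cornersAt v, Q.mate c ≠ c → u c = Complex.I * u (Q.nextCorner c))
    (hend : ∀ c ∈ Q.cornersAt v, ∀ c' ∈ Q.cornersAt v, Q.mate c = c → u c ≠ Complex.I * u c')
    (hmem : ∀ c ∈ Q.cornersAt v, ∀ x : ℂ, 0 ≤ x.re → 0 ≤ x.im → u c * x ∈ H)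
    (hcover : ∀ y ∈ H, ∃ c ∈ Q.cornersAt v, ∃ x : ℂ, 0 ≤ x.re ∧ 0 ≤ x.im ∧ u c * x = y)
    (hbdry : ∀ c ∈ Q.cornersAt v, ∀ x : ℂ, 0 ≤ x.re → 0 ≤ x.im →
      ((Q.mate c = c ∧ x.im = 0) ∨ (Q.mate (c.1, c.2 - 1) = (c.1, c.2 - 1) ∧ x.re = 0) ∨
        (v ∈ Q.boundary ∧ x = 0) ↔ u c * x ∈ frontier H)) :
    ∃ a r, Q.IsLayout v H a r := by
  classical
  set a : F → ℂ → ℂ := fun f z =>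
    if h : ∃ i, z = corner i then u (f, h.choose) * (sideDir h.choose)⁻¹ else 0
  have ha : ∀ f i, a f (corner i) = u (f, i) * (sideDir i)⁻¹ := by
    intro f i
    have h : ∃ j, corner i = corner j := ⟨i, rfl⟩
    have h' : h.choose = i := (corner_injective h.choose_spec).symm
    simp only [a]
    rw [dif_pos h, h']
  have hne := sideDir_ne_zero
  have hamul : ∀ f i x, a f (corner i) * (corner i + sideDir i * x - corner i) = u (f, i) * x := by
    intro f i x
    rw [ha, add_sub_cancel_left, mul_assoc, inv_mul_cancel_left₀ (hne i)]
  have hfib : ∀ f z, (f, z) ∈ Q.fibre v → ∃ i, z = corner i ∧ (f, i) ∈ Q.cornersAt v := by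
    rintro f z ⟨hz, h⟩
    obtain ⟨s, hs⟩ := hv
    obtain ⟨i, rfl⟩ := exists_corner_of_param_eq hz (hs.trans h.symm)
    exact ⟨i, rfl, h⟩
  have hpt : ∀ (i : Fin 4) (w : ℂ), w ∈ unitSquare → dist w (corner i) < 1 →
      ∃ x : ℂ, w = corner i + sideDir i * x ∧ x ∈ unitSquare ∧ x.re < 1 ∧ x.im < 1 := by
    intro i w hw hd
    obtain ⟨x, rfl⟩ : ∃ x, w = corner i + sideDir i * x :=
      ⟨(sideDir i)⁻¹ * (w - corner i), by rw [mul_inv_cancel_left₀ (hne i)]; ring⟩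
    rw [dist_self_add_left, norm_mul, norm_sideDir, one_mul] at hd
    exact ⟨x, rfl, (corner_add_mul_mem i x).1 hw, (Complex.re_le_norm x).trans_lt hd,
      (Complex.im_le_norm x).trans_lt hd⟩
  -- two neighbouring quadrants meet along their common edge only
  have hmeet : ∀ c ∈ Q.cornersAt v, ∀ c' ∈ Q.cornersAt v, ∀ x ∈ unitSquare, ∀ x' ∈ unitSquare,
      u c = Complex.I * u c' → Complex.I * x = x' →
      Q.param c.1 (corner c.2 + sideDir c.2 * x) =
        Q.param c'.1 (corner c'.2 + sideDir c'.2 * x') := by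
    intro c hc c' hc' x hx x' hx' huc hxx
    have hm : Q.mate c ≠ c := fun hm => hend c hc c' hc' hm huc
    have hn : Q.nextCorner c = c' := by
      refine hinj ((nextCorner_mem_iff hm).2 hc) hc' ?_
      have := hnext c hc hm
      rw [huc] at this
      exact (mul_left_cancel₀ Complex.I_ne_zero this).symm
    have him : x.im = 0 := by
      have h1 := hx.2.1
      have h2 := hx'.1.1
      rw [← hxx, Complex.mul_re, Complex.I_re, Complex.I_im] at h2
      linarith
    have hxr : x = (x.re : ℂ) := Complex.ext rfl (by simp [him])
    rw [← hxx, hxr, corner_add_mul_I, ← sidePt_eq, ← hn, nextCorner_apply, add_sub_cancel_right,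
      param_mate c hm hx.1]
  refine ⟨a, 1, hH, one_pos, ?_, ?_, ?_, ?_, ?_, ?_⟩
  · intro f z hz
    obtain ⟨i, rfl, hi⟩ := hfib f z hz
    rw [ha]
    exact mul_mem_axisUnits (hu _ hi) (inv_mem_axisUnits (sideDir_mem_axisUnits i))
  · intro s t ht hs hst
    obtain ⟨j, hj, hjv⟩ := hfib _ _ hst
    rcases sidePt_eq_corner ht hj with ⟨rfl, rfl⟩ | ⟨rfl, rfl⟩
    · have h1 := hnext s hjv hs
      rw [nextCorner_apply] at h1
      rw [sub_zero, sidePt_one, sidePt_zero, ha, ha, sideDir_succ, mul_inv, Complex.inv_I,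
        mul_assoc, mul_assoc, mul_assoc, inv_mul_cancel₀ (hne _), inv_mul_cancel₀ (hne _), mul_one,
        mul_one, h1]
      ring
    · have h0 : Q.mate (Q.mate s) ≠ Q.mate s := by rw [Q.mate_mate]; exact hs.symm
      have h1 := hnext (Q.mate s) ((nextCorner_mem_iff h0).1 (by rwa [nextCorner_mate])) h0
      rw [nextCorner_mate] at h1
      rw [sub_self, sidePt_one, sidePt_zero, ha, ha, sideDir_succ, mul_inv, Complex.inv_I,
        mul_assoc, mul_assoc, mul_assoc, inv_mul_cancel₀ (hne _), inv_mul_cancel₀ (hne _), mul_one,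
        mul_one, h1]
      ring
  · intro f z w hz hw hd
    obtain ⟨i, rfl, hi⟩ := hfib f z hz
    obtain ⟨x, rfl, hx, -⟩ := hpt i w hw hd
    rw [hamul]
    exact hmem _ hi x hx.1.1 hx.2.1
  · intro y hy hn
    obtain ⟨c, hc, x, h1, h2, rfl⟩ := hcover y hy
    rw [norm_mul, norm_of_mem_axisUnits (hu c hc), one_mul] at hn
    refine ⟨c.1, corner c.2, corner c.2 + sideDir c.2 * x, ⟨corner_mem _, hc⟩, ?_, hamul _ _ _⟩
    rw [corner_add_mul_mem]
    exact ⟨⟨h1, (Complex.re_le_norm x).trans hn.le⟩, h2, (Complex.im_le_norm x).trans hn.le⟩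
  · intro f z w f' z' w' hz hz' hw hw' hd hd' hww
    obtain ⟨i, rfl, hi⟩ := hfib f z hz
    obtain ⟨i', rfl, hi'⟩ := hfib f' z' hz'
    obtain ⟨x, rfl, hx, -⟩ := hpt i w hw hd
    obtain ⟨x', rfl, hx', -⟩ := hpt i' w' hw' hd'
    rw [hamul, hamul] at hww
    have hne' := ne_zero_of_mem_axisUnits (hu _ hi')
    obtain ⟨ζ, hζ, hζu⟩ : ∃ ζ ∈ axisUnits, u (f, i) = ζ * u (f', i') :=
      ⟨u (f, i) * (u (f', i'))⁻¹, mul_mem_axisUnits (hu _ hi) (inv_mem_axisUnits (hu _ hi')), by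
        rw [inv_mul_cancel_right₀ hne']⟩
    have hxx : ζ * x = x' := by
      rw [hζu] at hww
      refine mul_left_cancel₀ hne' ?_
      rw [← hww]
      ring
    rcases hζ with rfl | rfl | rfl | rfl
    · rw [one_mul] at hζu hxx
      have := hinj hi hi' hζu
      rw [Prod.mk.injEq] at this
      rw [hxx, this.1, this.2]
    · exact hmeet _ hi _ hi' x hx x' hx' hζu hxx
    · have h0 : x = 0 := by
        have h1 := hx.1.1
        have h2 := hx.2.1
        have h3 := hx'.1.1
        have h4 := hx'.2.1
        rw [← hxx, neg_one_mul, Complex.neg_re] at h3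
        rw [← hxx, neg_one_mul, Complex.neg_im] at h4
        exact Complex.ext (by simp; linarith) (by simp; linarith)
      rw [← hxx, h0, mul_zero, mul_zero, mul_zero, add_zero, add_zero]
      exact Eq.trans hi hi'.symm
    · refine (hmeet _ hi' _ hi x' hx' x hx ?_ ?_).symm
      · rw [hζu, neg_mul, mul_neg, ← mul_assoc, Complex.I_mul_I, neg_one_mul, neg_neg]
      · rw [← hxx, neg_mul, mul_neg, ← mul_assoc, Complex.I_mul_I, neg_one_mul, neg_neg]
  · intro f z w hz hw hd
    obtain ⟨i, rfl, hi⟩ := hfib f z hz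
    obtain ⟨x, rfl, hx, hx1, hx2⟩ := hpt i w hw hd
    rw [hamul, ← hbdry _ hi x hx.1.1 hx.2.1]
    rcases eq_or_lt_of_le hx.1.1 with hre | hre <;> rcases eq_or_lt_of_le hx.2.1 with him | him
    · obtain rfl : x = 0 := Complex.ext hre.symm him.symm
      rw [mul_zero, add_zero]
      have hparam : Q.param f (corner i) = v := hi
      rw [hparam]
      refine ⟨fun h => Or.inr (Or.inr ⟨h, rfl⟩), ?_⟩
      rintro (⟨h, -⟩ | ⟨h, -⟩ | ⟨h, -⟩)
      · exact ⟨(f, i), h, 0, by simp, by beta_reduce; rw [sidePt_zero]; exact hi⟩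
      · refine ⟨(f, i - 1), h, 1, by simp, ?_⟩
        beta_reduce
        rw [sidePt_one, sub_add_cancel]
        exact hi
      · exact h
    · have hxI : x = Complex.I * (x.im : ℂ) := Complex.ext (by simp [← hre]) (by simp)
      have hx0 : x ≠ 0 := by rintro rfl; simp at him
      rw [hxI, corner_add_mul_I,
        mem_boundary_sidePt_iff (s := (f, i - 1)) ⟨by linarith, by linarith⟩, ← hxI]
      simp [him.ne', hx0, hre.symm]
    · have hxr : x = (x.re : ℂ) := Complex.ext rfl (by simp [him.symm])
      have hx0 : x ≠ 0 := by rintro rfl; simp at hre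
      rw [hxr, ← sidePt_eq, mem_boundary_sidePt_iff (s := (f, i)) ⟨hre, hx1⟩, ← hxr]
      simp [hre.ne', hx0, him.symm]
    · have hx0 : x ≠ 0 := by rintro rfl; simp at him
      refine iff_of_false (not_mem_boundary_of_interior hw
        (not_exists_sidePt_of_mem_Ioo ⟨hre, hx1⟩ ⟨him, hx2⟩)) ?_
      simp [hre.ne', him.ne', hx0]

theorem exists_isLayout_of_interior_vertex [Finite F] {v : S} (hv : v ∈ Q.vertices)
    (hb : v ∉ Q.boundary) (h4 : Q.valence v = 4) : ∃ a r, Q.IsLayout v univ a r := by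
  classical
  obtain ⟨c, hper, hc⟩ := exists_four_corners hv hb h4
  have hinj := Function.iterate_injOn_Iio_minimalPeriod (f := Q.nextCorner) (x := c)
  have hcyc := Function.iterate_minimalPeriod (f := Q.nextCorner) (x := c)
  have hne : ∀ k l, k < 4 → l < 4 → k ≠ l → Q.nextCorner^[k] c ≠ Q.nextCorner^[l] c := by
    intro k l hk hl hkl h
    exact hkl (hinj (by rw [mem_Iio, hper]; exact hk) (by rw [mem_Iio, hper]; exact hl) h)
  obtain ⟨c₀, hc₀⟩ : ∃ c₀, c₀ = c := ⟨_, rfl⟩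
  obtain ⟨c₁, hc₁⟩ : ∃ c₁, c₁ = Q.nextCorner c := ⟨_, rfl⟩
  obtain ⟨c₂, hc₂⟩ : ∃ c₂, c₂ = Q.nextCorner c₁ := ⟨_, rfl⟩
  obtain ⟨c₃, hc₃⟩ : ∃ c₃, c₃ = Q.nextCorner c₂ := ⟨_, rfl⟩
  have hc₄ : Q.nextCorner c₃ = c₀ := by
    rw [hc₃, hc₂, hc₁, hc₀]
    have h5 : Q.nextCorner^[Function.minimalPeriod Q.nextCorner c] c = Q.nextCorner^[4] c := by
      congr 1
    exact h5.symm.trans hcyc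
  have h01 : c₁ ≠ c₀ := by rw [hc₁, hc₀]; exact hne 1 0 (by simp) (by simp) (by simp)
  have h02 : c₂ ≠ c₀ := by rw [hc₂, hc₁, hc₀]; exact hne 2 0 (by simp) (by simp) (by simp)
  have h03 : c₃ ≠ c₀ := by rw [hc₃, hc₂, hc₁, hc₀]; exact hne 3 0 (by simp) (by simp) (by simp)
  have h12 : c₂ ≠ c₁ := by rw [hc₂, hc₁]; exact hne 2 1 (by simp) (by simp) (by simp)
  have h13 : c₃ ≠ c₁ := by rw [hc₃, hc₂, hc₁]; exact hne 3 1 (by simp) (by simp) (by simp)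
  have h23 : c₃ ≠ c₂ := by rw [hc₃, hc₂, hc₁]; exact hne 3 2 (by simp) (by simp) (by simp)
  have hmem : ∀ b, b ∈ Q.cornersAt v ↔ b = c₀ ∨ b = c₁ ∨ b = c₂ ∨ b = c₃ := by
    intro b
    rw [hc]
    constructor
    · rintro ⟨k, hk, rfl⟩
      interval_cases k
      · exact Or.inl hc₀.symm
      · exact Or.inr (Or.inl hc₁.symm)
      · exact Or.inr (Or.inr (Or.inl (by rw [hc₂, hc₁]; rfl)))
      · exact Or.inr (Or.inr (Or.inr (by rw [hc₃, hc₂, hc₁]; rfl)))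
    · rintro (rfl | rfl | rfl | rfl)
      · exact ⟨0, by simp, hc₀⟩
      · exact ⟨1, by simp, hc₁⟩
      · exact ⟨2, by simp, by rw [hc₂, hc₁]; rfl⟩
      · exact ⟨3, by simp, by rw [hc₃, hc₂, hc₁]; rfl⟩
  set u : F × Fin 4 → ℂ := fun b =>
    if b = c₀ then 1 else if b = c₁ then -Complex.I else if b = c₂ then -1 else Complex.I with hu
  have hu₀ : u c₀ = 1 := if_pos rfl
  have hu₁ : u c₁ = -Complex.I := by simp [hu, h01]
  have hu₂ : u c₂ = -1 := by simp [hu, h02, h12]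
  have hu₃ : u c₃ = Complex.I := by simp [hu, h03, h13, h23]
  have hbd : ∀ b ∈ Q.cornersAt v, Q.mate b ≠ b := fun b hb' h =>
    hb ((mem_boundary_vertex_iff hv).2 ⟨b, hb', h⟩)
  refine exists_isLayout_of_corners (u := u) hv convex_univ ?_ ?_ ?_ ?_
    (fun _ _ _ _ _ => mem_univ _) ?_ ?_
  · intro b hb
    rcases (hmem b).1 hb with rfl | rfl | rfl | rfl
    · rw [hu₀]; simp [axisUnits]
    · rw [hu₁]; simp [axisUnits]
    · rw [hu₂]; simp [axisUnits]
    · rw [hu₃]; simp [axisUnits]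
  · intro b hb b' hb' h
    rcases (hmem b).1 hb with rfl | rfl | rfl | rfl <;>
      rcases (hmem b').1 hb' with rfl | rfl | rfl | rfl <;>
      simp [hu₀, hu₁, hu₂, hu₃, Complex.ext_iff] at h ⊢ <;> norm_num at h
  · intro b hb _
    rcases (hmem b).1 hb with rfl | rfl | rfl | rfl
    · rw [hc₀, ← hc₁, ← hc₀, hu₀, hu₁]; simp
    · rw [← hc₂, hu₁, hu₂]; simp
    · rw [← hc₃, hu₂, hu₃]; simp
    · rw [hc₄, hu₀, hu₃]; simp
  · intro b hb _ _ h
    exact absurd h (hbd b hb)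
  · intro y _
    rcases le_total 0 y.re with h1 | h1 <;> rcases le_total 0 y.im with h2 | h2
    · exact ⟨c₀, (hmem _).2 (by simp), y, h1, h2, by rw [hu₀, one_mul]⟩
    · refine ⟨c₁, (hmem _).2 (by simp), Complex.I * y, by simpa using h2, by simpa using h1, ?_⟩
      rw [hu₁, neg_mul, ← mul_assoc, Complex.I_mul_I, neg_one_mul, neg_neg]
    · refine ⟨c₃, (hmem _).2 (by simp), -(Complex.I * y), by simpa using h2, by simpa using h1, ?_⟩
      rw [hu₃, mul_neg, ← mul_assoc, Complex.I_mul_I, neg_one_mul, neg_neg]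
    · exact ⟨c₂, (hmem _).2 (by simp), -y, by simpa using h1, by simpa using h2, by
        rw [hu₂, neg_one_mul, neg_neg]⟩
  · intro b hb' x _ _
    rw [frontier_univ]
    refine iff_of_false ?_ (notMem_empty _)
    rintro (⟨h, -⟩ | ⟨h, -⟩ | ⟨h, -⟩)
    · exact hbd b hb' h
    · refine hbd (b.1, b.2 - 1) (mem_cornersAt_of_nextCorner_mem hbd ?_) h
      rw [nextCorner_apply, h]
      simpa using hb'
    · exact hb h

theorem exists_isLayout_of_boundary_vertex [Finite F] {v : S} (hv : v ∈ Q.vertices)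
    (hb : v ∈ Q.boundary) (h2 : Q.valence v = 2) : ∃ a r, Q.IsLayout v {z | 0 ≤ z.im} a r := by
  classical
  obtain ⟨b, c, hbc, hV, hmc, hmb, hn⟩ := exists_two_corners hv hb h2
  have hmem : ∀ x, x ∈ Q.cornersAt v ↔ x = b ∨ x = c := by
    intro x
    rw [hV]
    simp
  set u : F × Fin 4 → ℂ := fun x => if x = c then 1 else Complex.I with hu
  have huc : u c = 1 := if_pos rfl
  have hub : u b = Complex.I := if_neg hbc
  refine exists_isLayout_of_corners (u := u) hv (convex_halfSpace_im_ge 0) ?_ ?_ ?_ ?_ ?_ ?_ ?_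
  · intro x hx
    rcases (hmem x).1 hx with rfl | rfl
    · rw [hub]; simp [axisUnits]
    · rw [huc]; simp [axisUnits]
  · intro x hx x' hx' h
    rcases (hmem x).1 hx with rfl | rfl <;> rcases (hmem x').1 hx' with rfl | rfl <;>
      simp [huc, hub, Complex.ext_iff] at h ⊢
  · intro x hx hm
    rcases (hmem x).1 hx with rfl | rfl
    · rw [hn, huc, hub, mul_one]
    · exact absurd hmc hm
  · intro x hx x' hx' hm
    rcases (hmem x).1 hx with rfl | rfl
    · exact absurd hm hmb
    · rcases (hmem x').1 hx' with rfl | rfl <;> simp [huc, hub, Complex.ext_iff]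
      norm_num
  · intro x hx y h3 h4
    rcases (hmem x).1 hx with rfl | rfl
    · simpa [hub] using h3
    · simpa [huc] using h4
  · intro y hy
    rcases le_total 0 y.re with h1 | h1
    · exact ⟨c, (hmem _).2 (by simp), y, h1, hy, by rw [huc, one_mul]⟩
    · refine ⟨b, (hmem _).2 (by simp), -(Complex.I * y), by simpa using hy, by simpa using h1, ?_⟩
      rw [hub, mul_neg, ← mul_assoc, Complex.I_mul_I, neg_one_mul, neg_neg]
  · intro x hx y _ _
    rw [Complex.frontier_setOfPred_le_im]
    rcases (hmem x).1 hx with rfl | rfl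
    · have hin : Q.mate (x.1, x.2 - 1) = (x.1, x.2 - 1) := by
        by_contra hin
        have h0 : Q.mate (Q.mate (x.1, x.2 - 1)) ≠ Q.mate (x.1, x.2 - 1) := by
          rw [Q.mate_mate]; exact fun h => hin h.symm
        have h3 : Q.nextCorner (Q.mate (x.1, x.2 - 1)) = x := by
          rw [nextCorner_mate, sub_add_cancel]
        have h4 := (hmem _).1 ((nextCorner_mem_iff h0).1 (by rw [h3]; exact hx))
        rcases h4 with h4 | h4
        · rw [h4, hn] at h3
          exact hbc h3.symm
        · rw [h4] at h0
          exact h0 hmc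
      rw [hub]
      simp only [hmb, hin, hb, false_and, true_and, false_or]
      change _ ↔ (Complex.I * y).im = 0
      rw [Complex.I_mul_im]
      exact ⟨fun h => h.elim id fun h => by simp [h], Or.inl⟩
    · have hin : Q.mate (x.1, x.2 - 1) ≠ (x.1, x.2 - 1) := by
        intro hin
        have h3 : Q.nextCorner (x.1, x.2 - 1) = x := by
          rw [nextCorner_apply, hin]
          simp
        have h4 := Q.nextCorner.injective (h3.trans hn.symm)
        rw [h4] at hin
        exact hmb hin
      rw [huc]
      simp only [hmc, hin, hb, false_and, true_and, false_or]
      change _ ↔ (1 * y).im = 0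
      rw [one_mul]
      exact ⟨fun h => h.elim id fun h => by simp [h], Or.inl⟩

theorem localModel_of_mem {p : S} (h : p ∈ Q.boundary) : Q.localModel p = {z | 0 ≤ z.im} :=
  if_pos h

theorem localModel_of_notMem {p : S} (h : p ∉ Q.boundary) : Q.localModel p = univ :=
  if_neg h

/-- Around a point that is not a singularity, the faces tile a disc or a half-disc. -/
theorem exists_isLayout [Finite F] {p : S} (hp : p ∉ Q.singularSet) :
    ∃ a r, Q.IsLayout p (Q.localModel p) a r := by
  obtain ⟨f, z, hz, rfl⟩ := Q.exists_param p
  by_cases hside : ∃ i, ∃ t ∈ Icc (0 : ℝ) 1, z = sidePt i t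
  swap
  · rw [localModel_of_notMem (not_mem_boundary_of_interior hz hside)]
    exact exists_isLayout_of_interior hz hside
  by_cases hv : Q.param f z ∈ Q.vertices
  · by_cases hb : Q.param f z ∈ Q.boundary
    · rw [localModel_of_mem hb]
      refine exists_isLayout_of_boundary_vertex hv hb ?_
      by_contra h
      exact hp ⟨hv, Or.inr ⟨hb, h⟩⟩
    · rw [localModel_of_notMem hb]
      refine exists_isLayout_of_interior_vertex hv hb ?_
      by_contra h
      exact hp ⟨hv, Or.inl ⟨hb, h⟩⟩
  · obtain ⟨i, t, ht, rfl⟩ := hside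
    have ht' : t ∈ Ioo (0 : ℝ) 1 := by
      rw [mem_vertices_iff hz] at hv
      push Not at hv
      refine ⟨lt_of_le_of_ne ht.1 ?_, lt_of_le_of_ne ht.2 ?_⟩
      · rintro rfl
        exact hv i (sidePt_zero i)
      · rintro rfl
        exact hv (i + 1) (sidePt_one i)
    by_cases hm : Q.mate (f, i) = (f, i)
    · rw [localModel_of_mem ((mem_boundary_sidePt_iff (s := (f, i)) ht').2 hm)]
      exact exists_isLayout_of_boundary_side (s := (f, i)) hm ht'
    · rw [localModel_of_notMem fun h => hm ((mem_boundary_sidePt_iff (s := (f, i)) ht').1 h)]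
      exact exists_isLayout_of_glued_side (s := (f, i)) hm ht'

theorem exists_isDeveloping [Finite F] {p : S} (hp : p ∉ Q.singularSet) :
    ∃ E a δ, Q.IsDeveloping p (Q.localModel p) E a δ := by
  obtain ⟨a, r, h⟩ := exists_isLayout hp
  obtain ⟨E, δ, h⟩ := h.exists_isDeveloping
  exact ⟨E, a, δ, h⟩

/-! ### The cross field and parallel transport -/

theorem crossField_eq (f : F) : Q.crossField f = axisUnits := by
  ext u
  constructor
  · rintro ⟨hu, i, r, rfl⟩
    rw [norm_smul, norm_sideDir, mul_one, Real.norm_eq_abs] at hu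
    have h := sideDir_mem_axisUnits i
    rcases eq_or_eq_neg_of_abs_eq hu with rfl | rfl
    · rwa [one_smul]
    · rw [neg_one_smul]
      exact neg_mem_axisUnits h
  · intro hu
    obtain ⟨i, rfl⟩ := exists_sideDir_eq hu
    exact ⟨norm_sideDir i, i, 1, (one_smul _ _).symm⟩

theorem isCross_crossField (f : F) : IsCross (Q.crossField f) :=
  ⟨1, by simp, by rw [crossField_eq]; simp [axisUnits]⟩

theorem exists_circle_eq {u : ℂ} (hu : u ∈ axisUnits) : ∃ c : Circle, (c : ℂ) = u :=
  ⟨⟨u, mem_sphere_zero_iff_norm.2 (norm_of_mem_axisUnits hu)⟩, rfl⟩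

theorem exists_chart_crossFieldConstant [Finite F] [T2Space S] {p : S} (hp : p ∉ Q.singularSet) :
    ∃ e : OpenPartialHomeomorph S (Q.localModel p),
      p ∈ e.source ∧ Q.IsFlatChart e ∧ Q.CrossFieldConstantIn e := by
  obtain ⟨E, a, δ, h⟩ := exists_isDeveloping hp
  obtain ⟨e, hpe, hflat, he⟩ := h.exists_chart
  refine ⟨e, hpe, hflat, fun f z hz hfz => ?_⟩
  obtain ⟨u, hu, hev⟩ := he f z hz hfz
  obtain ⟨c, rfl⟩ := exists_circle_eq hu
  refine ⟨rotation c, ?_, ?_⟩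
  · filter_upwards [hev] with w hw
    rw [rotation_apply, hw]
  · rw [crossField_eq]
    have : ⇑(rotation c) = fun u => (c : ℂ) * u := funext (rotation_apply c)
    rw [this]
    exact mul_image_axisUnits hu

theorem half_mem_interior_unitSquare : (⟨1 / 2, 1 / 2⟩ : ℂ) ∈ interior unitSquare := by
  have h : unitSquare = Icc (0 : ℝ) 1 ×ℂ Icc (0 : ℝ) 1 := rfl
  rw [h, Complex.interior_reProdIm, interior_Icc, Complex.mem_reProdIm]
  norm_num

theorem corner_add_mul_half (i : Fin 4) :
    corner i + sideDir i * ⟨1 / 2, 1 / 2⟩ = ⟨1 / 2, 1 / 2⟩ := by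
  fin_cases i <;> simp [corner, sideDir, Complex.ext_iff] <;> norm_num

/-- Placing two neighbouring squares side by side turns the second one by a multiple of a right
angle; a reflection would place both squares on the same side of the common edge. -/
theorem IsUnfolding.exists_rotation {s : F × Fin 4} {T : ℂ ≃ᵃⁱ[ℝ] ℂ} (hT : Q.IsUnfolding s T) :
    ∃ u ∈ axisUnits, ∀ x, T.linearIsometryEquiv x = u * x := by
  have hlin : ∀ z x, T (z + x) = T z + T.linearIsometryEquiv x := by
    intro z x
    have := T.map_vadd z x
    rw [vadd_eq_add, vadd_eq_add, add_comm, add_comm _ (T z)] at this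
    exact this
  have h0 := hT.common_edge 0 (by simp)
  have h1 := hT.common_edge 1 (by simp)
  rw [sub_zero, sidePt_one, sidePt_zero, corner_succ, hlin] at h0
  rw [sub_self, sidePt_zero, sidePt_one, corner_succ] at h1
  have hdir : T.linearIsometryEquiv (sideDir (Q.mate s).2) = -sideDir s.2 := by
    rw [h1] at h0
    linear_combination h0
  obtain ⟨c, hc | hc⟩ := linear_isometry_complex T.linearIsometryEquiv
  · refine ⟨c, ?_, fun x => by rw [hc, rotation_apply]⟩
    rw [hc, rotation_apply] at hdir
    have : (c : ℂ) = -sideDir s.2 * (sideDir (Q.mate s).2)⁻¹ := by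
      rw [← hdir, mul_inv_cancel_right₀ (sideDir_ne_zero _)]
    rw [this]
    exact mul_mem_axisUnits (neg_mem_axisUnits (sideDir_mem_axisUnits _))
      (inv_mem_axisUnits (sideDir_mem_axisUnits _))
  · exfalso
    have happ : ∀ x, T.linearIsometryEquiv x = c * (starRingEnd ℂ) x := by
      intro x
      rw [hc]
      simp
    rw [happ] at hdir
    have hconj : (starRingEnd ℂ) (⟨1 / 2, 1 / 2⟩ : ℂ) = 1 - ⟨1 / 2, 1 / 2⟩ := by
      apply Complex.ext <;> simp
      norm_num
    have hmid : T ⟨1 / 2, 1 / 2⟩ = ⟨1 / 2, 1 / 2⟩ := calc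
      T ⟨1 / 2, 1 / 2⟩ = T (corner (Q.mate s).2 + sideDir (Q.mate s).2 * ⟨1 / 2, 1 / 2⟩) := by
        rw [corner_add_mul_half]
      _ = corner s.2 + sideDir s.2 * ⟨1 / 2, 1 / 2⟩ := by
        rw [hlin, happ, h1, map_mul, ← mul_assoc, hdir, hconj]
        ring
      _ = ⟨1 / 2, 1 / 2⟩ := corner_add_mul_half _
    exact Set.disjoint_left.1 hT.disjoint ⟨_, half_mem_interior_unitSquare, hmid⟩
      half_mem_interior_unitSquare

theorem Transport.exists_rotation {f g : F} {A : ℂ ≃ₗᵢ[ℝ] ℂ} (h : Q.Transport f g A) :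
    ∃ u ∈ axisUnits, ∀ x, A x = u * x := by
  induction h with
  | nil => exact ⟨1, by simp [axisUnits], fun x => by simp⟩
  | step g h i j A T _ _ _ hT ih =>
    obtain ⟨u, hu, hA⟩ := ih
    obtain ⟨v, hv, hT⟩ := hT.exists_rotation
    refine ⟨v⁻¹ * u, mul_mem_axisUnits (inv_mem_axisUnits hv) hu, fun x => ?_⟩
    rw [LinearIsometryEquiv.mul_def, LinearIsometryEquiv.trans_apply,
      LinearIsometryEquiv.symm_apply_eq, hT, hA, mul_assoc,
      mul_inv_cancel_left₀ (ne_zero_of_mem_axisUnits hv)]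

theorem mem_quarterTurns {A : ℂ ≃ₗᵢ[ℝ] ℂ} {u : ℂ} (hu : u ∈ axisUnits) (hA : ∀ x, A x = u * x) :
    A ∈ quarterTurns := by
  have hI : ((Circle.exp (Real.pi / 2) : Circle) : ℂ) = Complex.I := by
    rw [Circle.coe_exp]
    push_cast
    exact Complex.exp_pi_div_two_mul_I
  have hpow : ∃ k : ℕ, u = Complex.I ^ k := by
    rcases hu with rfl | rfl | rfl | rfl
    · exact ⟨0, by simp⟩
    · exact ⟨1, by simp⟩
    · exact ⟨2, by simp⟩
    · exact ⟨3, by simp⟩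
  obtain ⟨k, rfl⟩ := hpow
  refine Subgroup.mem_zpowers_iff.2 ⟨k, ?_⟩
  rw [zpow_natCast, ← map_pow]
  ext x
  rw [rotation_apply, hA, Circle.coe_pow, hI]

theorem parallel_or_orthogonal {u v : ℂ} (hu : u ∈ axisUnits) (hv : v ∈ axisUnits) :
    (∃ r : ℝ, u = r • v) ∨ inner ℝ u v = 0 := by
  rcases hu with rfl | rfl | rfl | rfl <;> rcases hv with rfl | rfl | rfl | rfl <;>
    first
    | (right; simp [Complex.inner]; done)
    | (left; refine ⟨1, ?_⟩; simp; done)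
    | (left; refine ⟨-1, ?_⟩; simp)

/-! ### Edge-parallel geodesics: local structure -/

/-- In the plane, a point is determined by its distances from two points of a line if these are
the distances of a point of the same line. -/
theorem mul_eq_mul_of_norm_eq {x y : ℂ} {τ c : ℝ} (hx : ‖x‖ = |τ|) (hy : ‖y‖ = |c|)
    (hxy : ‖x - y‖ = |τ - c|) : (c : ℂ) * x = τ * y := by
  have sq : ∀ z : ℂ, ∀ r : ℝ, ‖z‖ = |r| → z.re * z.re + z.im * z.im = r ^ 2 := by
    intro z r h
    rw [← Complex.normSq_apply, Complex.normSq_eq_norm_sq, h, sq_abs]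
  have h1 := sq x τ hx
  have h2 := sq y c hy
  have h3 := sq _ _ hxy
  rw [Complex.sub_re, Complex.sub_im] at h3
  have h4 : (c * x.re - τ * y.re) ^ 2 + (c * x.im - τ * y.im) ^ 2 = 0 := by
    linear_combination c ^ 2 * h1 + τ ^ 2 * h2 - c * τ * (h1 + h2 - h3)
  have h5 : c * x.re - τ * y.re = 0 := by nlinarith [sq_nonneg (c * x.im - τ * y.im)]
  have h6 : c * x.im - τ * y.im = 0 := by nlinarith [sq_nonneg (c * x.re - τ * y.re)]
  apply Complex.ext
  · simpa using sub_eq_zero.1 h5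
  · simpa using sub_eq_zero.1 h6

theorem abs_sub_lt_of_lt {a b t r : ℝ} (ha : |a - t| < r) (hb : |b - t| < r) :
    |a - b| < 2 * r := by
  rw [abs_lt] at ha hb ⊢
  constructor <;> linarith [ha.1, ha.2, hb.1, hb.2]

/-- Being an edge-parallel geodesic is a local property. -/
theorem IsEdgeParallelGeodesic.of_local {γ : ℝ → S} {J : Set ℝ} (hJ : J.OrdConnected)
    (hJ' : J.Nontrivial) (h : ∀ t ∈ J, ∃ ε > 0, ∃ (γ' : ℝ → S) (I : Set ℝ),
      Q.IsEdgeParallelGeodesic γ' I ∧ ∀ x ∈ J, |x - t| < ε → x ∈ I ∧ γ x = γ' x) :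
    Q.IsEdgeParallelGeodesic γ J where
  ordConnected := hJ
  nontrivial := hJ'
  geodesic t ht := by
    obtain ⟨ε, hε, γ', I, hγ', hI⟩ := h t ht
    obtain ⟨ε', hε', h'⟩ := hγ'.geodesic t (hI t ht (by simpa using hε)).1
    refine ⟨min ε ε', lt_min hε hε', fun s hs s' hs' hst hst' => ?_⟩
    obtain ⟨h1, h2⟩ := hI s hs (hst.trans_le (min_le_left _ _))
    obtain ⟨h3, h4⟩ := hI s' hs' (hst'.trans_le (min_le_left _ _))
    rw [h2, h4]
    exact h' s h1 s' h3 (hst.trans_le (min_le_right _ _)) (hst'.trans_le (min_le_right _ _))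
  parallel t ht := by
    obtain ⟨ε, hε, γ', I, hγ', hI⟩ := h t ht
    obtain ⟨ε', hε', h'⟩ := hγ'.parallel t (hI t ht (by simpa using hε)).1
    refine ⟨min ε ε', lt_min hε hε', fun s hs s' hs' hst hst' => ?_⟩
    obtain ⟨h1, h2⟩ := hI s hs (hst.trans_le (min_le_left _ _))
    obtain ⟨h3, h4⟩ := hI s' hs' (hst'.trans_le (min_le_left _ _))
    rw [h2, h4]
    exact h' s h1 s' h3 (hst.trans_le (min_le_right _ _)) (hst'.trans_le (min_le_right _ _))
  regular t ht := by
    have htJ := interior_subset ht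
    obtain ⟨ε, hε, γ', I, hγ', hI⟩ := h t htJ
    rw [(hI t htJ (by simpa using hε)).2]
    refine hγ'.regular t (mem_interior_iff_mem_nhds.2 ?_)
    filter_upwards [mem_interior_iff_mem_nhds.1 ht, Metric.ball_mem_nhds t hε] with x hx hxt
    exact (hI x hx (by rwa [Metric.mem_ball, Real.dist_eq] at hxt)).1

theorem IsEdgeParallelGeodesic.comp {γ : ℝ → S} {I : Set ℝ} (h : Q.IsEdgeParallelGeodesic γ I)
    (φ : ℝ ≃ᵢ ℝ) : Q.IsEdgeParallelGeodesic (γ ∘ φ) (φ ⁻¹' I) := by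
  have hφ : ∀ s t, |φ s - φ t| = |s - t| := fun s t => by
    rw [← Real.dist_eq, φ.dist_eq, Real.dist_eq]
  refine ⟨?_, ?_, fun t ht => ?_, fun t ht => ?_, fun t ht => ?_⟩
  · exact (φ.toHomeomorph.isPreconnected_preimage.2 h.ordConnected.isPreconnected).ordConnected
  · exact h.nontrivial.preimage φ.surjective
  · obtain ⟨ε, hε, h'⟩ := h.geodesic (φ t) ht
    refine ⟨ε, hε, fun s hs s' hs' hst hst' => ?_⟩
    rw [← hφ s s']
    exact h' _ hs _ hs' (by rwa [hφ]) (by rwa [hφ])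
  · obtain ⟨ε, hε, h'⟩ := h.parallel (φ t) ht
    refine ⟨ε, hε, fun s hs s' hs' hst hst' => ?_⟩
    rw [← hφ s s']
    exact h' _ hs _ hs' (by rwa [hφ]) (by rwa [hφ])
  · refine h.regular (φ t) ?_
    have h1 : φ ⁻¹' interior I = interior (φ ⁻¹' I) := φ.toHomeomorph.preimage_interior I
    rw [← h1] at ht
    exact ht

/-- A curve that develops to an axis-parallel straight line is an edge-parallel geodesic near the
centre of the developing map. -/
theorem IsDeveloping.geodesic_of_straight {p : S} {H : Set ℂ} {E : S → ℂ} {a : F → ℂ → ℂ}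
    {δ : ℝ} (h : Q.IsDeveloping p H E a δ) {γ : ℝ → S} {I : Set ℝ} {t ε : ℝ} {d : ℂ}
    (hd : d ∈ axisUnits) (hε : 0 < ε)
    (hs : ∀ s ∈ I, |s - t| < ε → Q.meshDist p (γ s) < ENNReal.ofReal δ ∧
      E (γ s) = d * ((s - t : ℝ) : ℂ)) :
    ∃ ε' > 0, ∀ s ∈ I, ∀ s' ∈ I, |s - t| < ε' → |s' - t| < ε' →
      Q.meshDist (γ s) (γ s') = ENNReal.ofReal |s - s'| ∧
      ∀ (f : F), ∀ z ∈ unitSquare, ∀ w ∈ unitSquare,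
        Q.param f z = γ s → Q.param f w = γ s' → dist z w = |s - s'| →
        ∃ u ∈ Q.crossField f, ∃ r : ℝ, w - z = r • u := by
  have hδ := h.pos
  refine ⟨min ε (δ / 3), lt_min hε (by linarith), fun s hsI s' hsI' hst hst' => ?_⟩
  obtain ⟨h1, h2⟩ := hs s hsI (hst.trans_le (min_le_left _ _))
  obtain ⟨h3, h4⟩ := hs s' hsI' (hst'.trans_le (min_le_left _ _))
  replace hst := hst.trans_le (min_le_right _ _)
  replace hst' := hst'.trans_le (min_le_right _ _)
  refine ⟨?_, fun f z hz w hw hzs hws hzw => ?_⟩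
  · rw [h.isometry _ _ h1 h3, h2, h4, edist_dist, dist_eq_norm, ← mul_sub, ← Complex.ofReal_sub,
      norm_mul, norm_of_mem_axisUnits hd, one_mul, Complex.norm_real, Real.norm_eq_abs]
    congr 2
    ring
  · rw [crossField_eq]
    rw [← hzs] at h1 h2
    rw [← hws] at h4
    obtain ⟨x, hx, hxz⟩ := h.near f z hz h1
    have ha := h.unit f x hx
    rw [h.apply_param f x z hx hz hxz] at h2
    have hzx : dist z x = |s - t| := by
      rw [← norm_unit_mul_sub ha, h2, norm_mul, norm_of_mem_axisUnits hd, one_mul,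
        Complex.norm_real, Real.norm_eq_abs]
    have hwx : dist w x < δ := by
      have := dist_triangle_left w x z
      have := abs_sub_lt_of_lt hst hst'
      linarith
    rw [h.apply_param f x w hx hw hwx] at h4
    refine ⟨(a f x)⁻¹ * d, mul_mem_axisUnits (inv_mem_axisUnits ha) hd, s' - s, ?_⟩
    have ha0 := ne_zero_of_mem_axisUnits ha
    refine mul_left_cancel₀ ha0 ?_
    rw [Complex.real_smul, mul_left_comm, mul_inv_cancel_left₀ ha0]
    push_cast at h2 h4 ⊢
    linear_combination h4 - h2

/-- Conversely, an edge-parallel geodesic develops to an axis-parallel straight line. -/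
theorem IsEdgeParallelGeodesic.exists_straight {γ : ℝ → S} {I : Set ℝ}
    (hγ : Q.IsEdgeParallelGeodesic γ I) {t : ℝ} (ht : t ∈ interior I) {H : Set ℂ} {E : S → ℂ}
    {a : F → ℂ → ℂ} {δ : ℝ} (h : Q.IsDeveloping (γ t) H E a δ) :
    ∃ ε > 0, ∃ d ∈ axisUnits, ∀ s, |s - t| < ε → s ∈ I ∧
      Q.meshDist (γ t) (γ s) < ENNReal.ofReal δ ∧ E (γ s) = d * ((s - t : ℝ) : ℂ) := by
  have htI := interior_subset ht
  obtain ⟨ε₁, hε₁, h₁⟩ := hγ.geodesic t htI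
  obtain ⟨ε₂, hε₂, h₂⟩ := hγ.parallel t htI
  obtain ⟨ε₃, hε₃, h₃⟩ := Metric.mem_nhds_iff.1 (mem_interior_iff_mem_nhds.1 ht)
  obtain ⟨ε, hε⟩ : ∃ ε, ε = min (min ε₁ ε₂) (min ε₃ δ) := ⟨_, rfl⟩
  have hε0 : 0 < ε := by rw [hε]; exact lt_min (lt_min hε₁ hε₂) (lt_min hε₃ h.pos)
  have he1 : ε ≤ ε₁ := hε ▸ (min_le_left _ _).trans (min_le_left _ _)
  have he2 : ε ≤ ε₂ := hε ▸ (min_le_left _ _).trans (min_le_right _ _)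
  have he3 : ε ≤ ε₃ := hε ▸ (min_le_right _ _).trans (min_le_left _ _)
  have he4 : ε ≤ δ := hε ▸ (min_le_right _ _).trans (min_le_right _ _)
  have hI : ∀ s, |s - t| < ε → s ∈ I := fun s hs =>
    h₃ (by rw [Metric.mem_ball, Real.dist_eq]; linarith)
  have hdist : ∀ s s', |s - t| < ε → |s' - t| < ε →
      Q.meshDist (γ s) (γ s') = ENNReal.ofReal |s - s'| := fun s s' hs hs' =>
    h₁ s (hI s hs) s' (hI s' hs') (by linarith) (by linarith)
  have htt : |t - t| < ε := by simpa using hε0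
  have hnear : ∀ s, |s - t| < ε → Q.meshDist (γ t) (γ s) < ENNReal.ofReal δ := by
    intro s hs
    rw [hdist t s htt hs, ENNReal.ofReal_lt_ofReal_iff h.pos, abs_sub_comm]
    linarith
  have hE : ∀ s s', |s - t| < ε → |s' - t| < ε → ‖E (γ s) - E (γ s')‖ = |s - s'| := by
    intro s s' hs hs'
    have h4 := hdist s s' hs hs'
    rw [h.isometry _ _ (hnear s hs) (hnear s' hs'), edist_dist,
      ENNReal.ofReal_eq_ofReal_iff dist_nonneg (abs_nonneg _), dist_eq_norm] at h4
    exact h4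
  have hE0 : ∀ s, |s - t| < ε → ‖E (γ s)‖ = |s - t| := by
    intro s hs
    rw [← hE s t hs htt, h.apply_self, sub_zero]
  obtain ⟨c, hc⟩ : ∃ c, c = ε / 2 := ⟨_, rfl⟩
  have hc0 : 0 < c := by linarith
  have hct : |t + c - t| < ε := by rw [add_sub_cancel_left, abs_of_pos hc0]; linarith
  have hcC : (c : ℂ) ≠ 0 := by exact_mod_cast hc0.ne'
  set d : ℂ := E (γ (t + c)) / c with hd
  have hdc : E (γ (t + c)) = d * c := by rw [hd, div_mul_cancel₀ _ hcC]
  refine ⟨ε, hε0, d, ?_, fun s hs => ⟨hI s hs, hnear s hs, ?_⟩⟩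
  · obtain ⟨f, w, hw, hfw⟩ := Q.exists_param (γ (t + c))
    have hn := hnear _ hct
    rw [← hfw] at hn
    obtain ⟨z, hz, hzw⟩ := h.near f w hw hn
    have h5 := h.meshDist_eq f z w hz hw hzw
    have h6 := hE0 _ hct
    have h7 := h.apply_param f z w hz hw hzw
    have ha := h.unit f z hz
    rw [hfw] at h7
    rw [h7, norm_unit_mul_sub ha, add_sub_cancel_left] at h6
    obtain ⟨u, hu, r, hr⟩ := h₂ t htI (t + c) (hI _ hct) (by simpa using hε₂)
      (hct.trans_le he2) f z hz.1 w hw hz.2 hfw (by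
        rw [dist_comm, h6, sub_add_cancel_left, abs_neg])
    rw [crossField_eq] at hu
    rw [dist_eq_norm, hr, norm_smul, norm_of_mem_axisUnits hu, mul_one, Real.norm_eq_abs] at h6
    rw [hd, h7, hr]
    rcases abs_eq_abs.1 h6 with rfl | rfl
    · rw [Complex.real_smul, mul_left_comm, mul_div_cancel_left₀ _ hcC]
      exact mul_mem_axisUnits ha hu
    · rw [neg_smul, Complex.real_smul, mul_neg, mul_left_comm, neg_div,
        mul_div_cancel_left₀ _ hcC]
      exact neg_mem_axisUnits (mul_mem_axisUnits ha hu)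
  · have h5 := mul_eq_mul_of_norm_eq (x := E (γ s)) (y := E (γ (t + c))) (τ := s - t) (c := c)
      (hE0 s hs) (by rw [hE0 _ hct, add_sub_cancel_left]) (by rw [hE s _ hs hct]; congr 1; ring)
    rw [hdc] at h5
    refine mul_left_cancel₀ hcC ?_
    rw [h5]
    ring

/-! ### Segments in faces -/

theorem not_corner_of_mem_Ioo {z u : ℂ} (hz : z ∈ unitSquare) (hu : u ∈ axisUnits) {l t : ℝ}
    (hl : z + l • u ∈ unitSquare) (ht : t ∈ Ioo 0 l) (i : Fin 4) : z + t • u ≠ corner i := by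
  intro h
  obtain ⟨⟨h1, h2⟩, h3, h4⟩ := mem_unitSquare.1 hz
  obtain ⟨⟨h5, h6⟩, h7, h8⟩ := mem_unitSquare.1 hl
  obtain ⟨h9, h10⟩ := ht
  rcases hu with rfl | rfl | rfl | rfl <;> fin_cases i <;>
    simp [corner, Complex.ext_iff] at * <;> linarith

theorem exists_sidePt_of_corner {z u : ℂ} (hu : u ∈ axisUnits) {s t : ℝ} {i : Fin 4}
    (hs : z + s • u ∈ unitSquare) (h : z + t • u = corner i) :
    ∃ j, ∃ τ ∈ Icc (0 : ℝ) 1, z + s • u = sidePt j τ := by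
  refine exists_sidePt hs ?_
  rcases hu with rfl | rfl | rfl | rfl <;> fin_cases i <;>
    simp [corner, Complex.ext_iff] at * <;> simp [h]

theorem add_smul_mem {z u : ℂ} (hz : z ∈ unitSquare) {l t : ℝ} (hl : z + l • u ∈ unitSquare)
    (ht : t ∈ Icc 0 l) : z + t • u ∈ unitSquare := by
  rcases eq_or_lt_of_le (ht.1.trans ht.2) with h0 | h0
  · obtain rfl : t = 0 := le_antisymm (by linarith [ht.2]) ht.1
    simpa using hz
  · have := convex_unitSquare.add_smul_mem hz hl (t := t / l)
      ⟨div_nonneg ht.1 h0.le, div_le_one_of_le₀ ht.2 h0.le⟩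
    rwa [smul_smul, div_mul_cancel₀ _ h0.ne'] at this

theorem dist_add_smul {z u : ℂ} (hu : u ∈ axisUnits) (s t : ℝ) :
    dist (z + s • u) (z + t • u) = |s - t| := by
  rw [dist_add_left, dist_eq_norm, ← sub_smul, norm_smul, norm_of_mem_axisUnits hu, mul_one,
    Real.norm_eq_abs]

/-- A segment along a side, starting at a corner, is a geodesic near this corner, whatever the
angle around the vertex: it is radial. -/
theorem geodesic_of_corner [Finite F] {f : F} {z u : ℂ} (hu : u ∈ axisUnits) {I : Set ℝ} {t : ℝ}
    {i : Fin 4} (ht : z + t • u = corner i) (hI : ∀ s ∈ I, z + s • u ∈ unitSquare)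
    (hside : (∀ s ∈ I, t ≤ s) ∨ ∀ s ∈ I, s ≤ t) :
    ∃ ε > 0, ∀ s ∈ I, ∀ s' ∈ I, |s - t| < ε → |s' - t| < ε →
      Q.meshDist (Q.param f (z + s • u)) (Q.param f (z + s' • u)) = ENNReal.ofReal |s - s'| ∧
      ∀ (g : F), ∀ x ∈ unitSquare, ∀ w ∈ unitSquare,
        Q.param g x = Q.param f (z + s • u) → Q.param g w = Q.param f (z + s' • u) →
        dist x w = |s - s'| → ∃ u ∈ Q.crossField g, ∃ r : ℝ, w - x = r • u := by
  obtain ⟨r, hr⟩ := Q.exists_isSeparating (Q.param f (corner i))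
  have hfib : (f, z + t • u) ∈ Q.fibre (Q.param f (corner i)) :=
    ⟨by rw [ht]; exact corner_mem i, by rw [ht]⟩
  have hrad : ∀ s ∈ I, |s - t| < r →
      Q.meshDist (Q.param f (corner i)) (Q.param f (z + s • u)) = ENNReal.ofReal |s - t| := by
    intro s hs hst
    rw [hr.meshDist_eq hfib (hI s hs) (by rwa [dist_add_smul hu]), edist_dist, dist_add_smul hu]
  have hdiff : ∀ s ∈ I, ∀ s' ∈ I, |s - t| ≤ |s' - t| → |s - s'| = |s' - t| - |s - t| := by
    intro s hs s' hs' hle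
    rcases hside with h | h
    · have h1 := h s hs
      have h2 := h s' hs'
      rw [abs_of_nonneg (by linarith : 0 ≤ s - t), abs_of_nonneg (by linarith : 0 ≤ s' - t)] at *
      rw [abs_sub_comm, abs_of_nonneg (by linarith : 0 ≤ s' - s)]
      ring
    · have h1 := h s hs
      have h2 := h s' hs'
      rw [abs_of_nonpos (by linarith : s - t ≤ 0), abs_of_nonpos (by linarith : s' - t ≤ 0)] at *
      rw [abs_of_nonneg (by linarith : 0 ≤ s - s')]
      ring
  have hlow : ∀ s ∈ I, ∀ s' ∈ I, |s - t| < r → |s' - t| < r → |s - t| ≤ |s' - t| →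
      ENNReal.ofReal |s - s'| ≤ Q.meshDist (Q.param f (z + s • u)) (Q.param f (z + s' • u)) := by
    intro s hs s' hs' hst hst' hle
    rw [hdiff s hs s' hs' hle, ENNReal.ofReal_sub _ (abs_nonneg _), tsub_le_iff_left,
      ← hrad s hs hst, ← hrad s' hs' hst']
    exact meshDist_triangle _ _ _
  refine ⟨r, hr.pos, fun s hs s' hs' hst hst' => ⟨le_antisymm ?_ ?_, ?_⟩⟩
  · refine (meshDist_le_edist (hI s hs) (hI s' hs')).trans (le_of_eq ?_)
    rw [edist_dist, dist_add_smul hu]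
  · rcases le_total |s - t| |s' - t| with hle | hle
    · exact hlow s hs s' hs' hst hst' hle
    · rw [abs_sub_comm, meshDist_comm]
      exact hlow s' hs' s hs hst' hst hle
  · intro g x hx w hw hxs hws hxw
    rw [crossField_eq]
    -- the point of the square over the vertex, and the side on which a point near it lies
    have key : ∀ s ∈ I, |s - t| < r → ∀ x ∈ unitSquare, Q.param g x = Q.param f (z + s • u) →
        ∃ y, (g, y) ∈ Q.fibre (Q.param f (corner i)) ∧ dist x y = |s - t| ∧
          ∃ j, ∃ τ : ℝ, x - y = τ • sideDir j := by
      intro s hs hst x hx hxs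
      have h1 := hrad s hs hst
      rw [← hxs] at h1
      obtain ⟨y, hy, hxy, h2⟩ := hr.exists_near hx
        (by rw [h1]; exact (ENNReal.ofReal_lt_ofReal_iff hr.pos).2 hst)
      rw [h1, edist_dist, ENNReal.ofReal_eq_ofReal_iff (abs_nonneg _) dist_nonneg] at h2
      obtain ⟨j, τ, hτ, rfl⟩ := exists_sidePt_of_param_eq (hI s hs) hx hxs.symm
        (exists_sidePt_of_corner hu (hI s hs) ht)
      rcases hr.side g y j hy with ⟨τ', -, rfl⟩ | h3
      · refine ⟨_, hy, h2.symm, j, τ - τ', ?_⟩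
        rw [sidePt_sub, Complex.real_smul, mul_comm]
      · have := h3 τ hτ
        rw [dist_comm] at this
        linarith [hr.pos]
    obtain ⟨y, hy, hxy, j, τ, hτ⟩ := key s hs hst x hx hxs
    obtain ⟨y', hy', hwy, j', τ', hτ'⟩ := key s' hs' hst' w hw hws
    obtain rfl : y = y' := by
      by_contra hne
      have h1 := hr.fibre g y y' hy hy' hne
      have h2 := dist_triangle4 y x w y'
      rw [dist_comm y x] at h2
      have h3 := abs_sub_lt_of_lt hst hst'
      linarith
    have hcol := mul_eq_mul_of_norm_eq (x := w - y) (y := x - y) (τ := s' - t) (c := s - t)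
      (by rw [← dist_eq_norm, hwy]) (by rw [← dist_eq_norm, hxy]) (by
        rw [sub_sub_sub_cancel_right, ← dist_eq_norm, dist_comm, hxw, abs_sub_comm]
        congr 1
        ring)
    rcases eq_or_ne s t with rfl | hne
    · rw [sub_self, abs_zero] at hxy
      obtain rfl := dist_eq_zero.1 hxy
      exact ⟨_, sideDir_mem_axisUnits j', τ', hτ'⟩
    · refine ⟨_, sideDir_mem_axisUnits j, (s' - t) / (s - t) * τ - τ, ?_⟩
      have hst0 : ((s - t : ℝ) : ℂ) ≠ 0 := by exact_mod_cast sub_ne_zero.2 hne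
      have h1 : w - y = ((s' - t : ℝ) : ℂ) / ((s - t : ℝ) : ℂ) * (x - y) := by
        rw [div_mul_eq_mul_div, eq_div_iff hst0, ← hcol, mul_comm]
      rw [← sub_sub_sub_cancel_right w x y, h1, hτ, Complex.real_smul, Complex.real_smul]
      push_cast
      ring

theorem isEdgeParallelGeodesic_segment [Finite F] (f : F) {z u : ℂ} (hz : z ∈ unitSquare)
    (hu : u ∈ axisUnits) {l : ℝ} (hl0 : 0 < l) (hl : z + l • u ∈ unitSquare) :
    Q.IsEdgeParallelGeodesic (fun t => Q.param f (z + t • u)) (Icc 0 l) := by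
  have hmem : ∀ t ∈ Icc 0 l, z + t • u ∈ unitSquare := fun t ht => add_smul_mem hz hl ht
  have hreg : ∀ t ∈ Ioo 0 l, Q.param f (z + t • u) ∉ Q.vertices := by
    intro t ht h
    obtain ⟨i, hi⟩ := (mem_vertices_iff (hmem t (Ioo_subset_Icc_self ht))).1 h
    exact not_corner_of_mem_Ioo hz hu hl ht i hi
  have key : ∀ t ∈ Icc 0 l, ∃ ε > 0, ∀ s ∈ Icc 0 l, ∀ s' ∈ Icc 0 l, |s - t| < ε → |s' - t| < ε →
      Q.meshDist (Q.param f (z + s • u)) (Q.param f (z + s' • u)) = ENNReal.ofReal |s - s'| ∧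
      ∀ (g : F), ∀ x ∈ unitSquare, ∀ w ∈ unitSquare,
        Q.param g x = Q.param f (z + s • u) → Q.param g w = Q.param f (z + s' • u) →
        dist x w = |s - s'| → ∃ u ∈ Q.crossField g, ∃ r : ℝ, w - x = r • u := by
    intro t ht
    by_cases hp : Q.param f (z + t • u) ∈ Q.singularSet
    · obtain ⟨i, hi⟩ := (mem_vertices_iff (hmem t ht)).1 hp.1
      refine geodesic_of_corner hu hi hmem ?_
      have h0 : t = 0 ∨ t = l := by
        by_contra! h0
        exact hreg t ⟨lt_of_le_of_ne ht.1 h0.1.symm, lt_of_le_of_ne ht.2 h0.2⟩ hp.1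
      rcases h0 with rfl | rfl
      · exact Or.inl fun s hs => hs.1
      · exact Or.inr fun s hs => hs.2
    · obtain ⟨E, a, δ, h⟩ := exists_isDeveloping hp
      have hfib : (f, z + t • u) ∈ Q.fibre (Q.param f (z + t • u)) := ⟨hmem t ht, rfl⟩
      refine h.geodesic_of_straight (γ := fun t => Q.param f (z + t • u))
        (mul_mem_axisUnits (h.unit _ _ hfib) hu) h.pos fun s hs hst => ?_
      have hd : dist (z + s • u) (z + t • u) < δ := by rwa [dist_add_smul hu]
      refine ⟨?_, ?_⟩
      · rw [h.meshDist_eq _ _ _ hfib (hmem s hs) hd, edist_dist]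
        exact (ENNReal.ofReal_lt_ofReal_iff h.pos).2 hd
      · rw [h.apply_param _ _ _ hfib (hmem s hs) hd, add_sub_add_left_eq_sub, ← sub_smul,
          Complex.real_smul (x := s - t), mul_assoc, mul_comm u]
  refine ⟨ordConnected_Icc, ⟨0, ⟨le_rfl, hl0.le⟩, l, ⟨hl0.le, le_rfl⟩, hl0.ne⟩,
    fun t ht => ?_, fun t ht => ?_, fun t ht => ?_⟩
  · obtain ⟨ε, hε, h⟩ := key t ht
    exact ⟨ε, hε, fun s hs s' hs' hst hst' => (h s hs s' hs' hst hst').1⟩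
  · obtain ⟨ε, hε, h⟩ := key t ht
    exact ⟨ε, hε, fun s hs s' hs' hst hst' => (h s hs s' hs' hst hst').2⟩
  · rw [interior_Icc] at ht
    exact fun h => hreg t ht h.1

/-! ### Unique continuation of edge-parallel geodesics -/

theorem eq_of_frequently_eq [Finite F] {γ₁ γ₂ : ℝ → S} {I₁ I₂ : Set ℝ}
    (h₁ : Q.IsEdgeParallelGeodesic γ₁ I₁) (h₂ : Q.IsEdgeParallelGeodesic γ₂ I₂) {t : ℝ}
    (ht : t ∈ I₁ ∩ I₂) (h : ∃ᶠ s in 𝓝 t, s ∈ I₁ ∩ I₂ ∧ γ₁ s = γ₂ s) : γ₁ t = γ₂ t := by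
  obtain ⟨ε₁, hε₁, hd₁⟩ := h₁.geodesic t ht.1
  obtain ⟨ε₂, hε₂, hd₂⟩ := h₂.geodesic t ht.2
  refine eq_of_meshDist_eq_zero (Q := Q) (le_antisymm ?_ (zero_le))
  refine ENNReal.le_of_forall_pos_le_add fun η hη _ => ?_
  have hpos : 0 < min (min ε₁ ε₂) (η / 2) := lt_min (lt_min hε₁ hε₂) (by positivity)
  obtain ⟨s, ⟨hs, hss⟩, hst⟩ := (h.and_eventually (Metric.ball_mem_nhds t hpos)).exists
  rw [Real.dist_eq] at hst
  obtain ⟨hst', hst3⟩ := lt_min_iff.1 hst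
  obtain ⟨hst1, hst2⟩ := lt_min_iff.1 hst'
  refine (meshDist_triangle _ (γ₁ s) _).trans ?_
  rw [hd₁ t ht.1 s hs.1 (by simpa using hε₁) hst1, hss,
    hd₂ s hs.2 t ht.2 hst2 (by simpa using hε₂), abs_sub_comm t s,
    ← ENNReal.ofReal_add (abs_nonneg _) (abs_nonneg _), zero_add]
  refine (ENNReal.ofReal_le_ofReal (by linarith : |s - t| + |s - t| ≤ η)).trans (le_of_eq ?_)
  exact ENNReal.ofReal_coe_nnreal

/-- Two edge-parallel geodesics that agree on an interval agree wherever both are defined. -/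
theorem eqOn_of_eqOn_Ioo [Finite F] {γ₁ γ₂ : ℝ → S} {I₁ I₂ : Set ℝ}
    (h₁ : Q.IsEdgeParallelGeodesic γ₁ I₁) (h₂ : Q.IsEdgeParallelGeodesic γ₂ I₂) {a b : ℝ}
    (hab : a < b) (hsub : Ioo a b ⊆ I₁ ∩ I₂) (heq : EqOn γ₁ γ₂ (Ioo a b)) :
    EqOn γ₁ γ₂ (I₁ ∩ I₂) := by
  have hconv : Convex ℝ (I₁ ∩ I₂) := (h₁.ordConnected.inter h₂.ordConnected).convex
  have hint : Ioo a b ⊆ interior (I₁ ∩ I₂) := interior_maximal hsub isOpen_Ioo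
  obtain ⟨m, hm⟩ : (Ioo a b).Nonempty := nonempty_Ioo.2 hab
  have hmU : m ∈ {t | ∀ᶠ s in 𝓝 t, γ₁ s = γ₂ s} := by
    filter_upwards [isOpen_Ioo.mem_nhds hm] with s hs using heq hs
  have hU : interior (I₁ ∩ I₂) ⊆ {t | ∀ᶠ s in 𝓝 t, γ₁ s = γ₂ s} := by
    refine hconv.interior.isPreconnected.subset_of_closure_inter_subset
      isOpen_setOfPred_eventually_nhds ⟨m, hint hm, hmU⟩ ?_
    rintro t ⟨htU, ht⟩
    by_contra htn
    have hfreq : ∃ᶠ s in 𝓝 t, ∀ᶠ x in 𝓝 s, γ₁ x = γ₂ x := mem_closure_iff_frequently.1 htU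
    have htt : γ₁ t = γ₂ t := by
      refine eq_of_frequently_eq h₁ h₂ (interior_subset ht) ?_
      refine (hfreq.and_eventually (mem_interior_iff_mem_nhds.1 ht)).mono fun s hs => ?_
      exact ⟨hs.2, hs.1.self_of_nhds⟩
    have ht₁ : t ∈ interior I₁ := interior_mono inter_subset_left ht
    have ht₂ : t ∈ interior I₂ := interior_mono inter_subset_right ht
    obtain ⟨E, A, δ, hE⟩ := exists_isDeveloping (h₁.regular t ht₁)
    obtain ⟨ε₁, hε₁, d₁, -, hd₁⟩ := h₁.exists_straight ht₁ hE
    rw [htt] at hE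
    obtain ⟨ε₂, hε₂, d₂, -, hd₂⟩ := h₂.exists_straight ht₂ hE
    have hball := Metric.ball_mem_nhds t (lt_min hε₁ hε₂)
    obtain ⟨s, hs, hst⟩ := (hfreq.and_eventually hball).exists
    rw [Real.dist_eq, lt_min_iff] at hst
    have hne : s ≠ t := by
      rintro rfl
      exact htn hs
    have hdd : d₁ = d₂ := by
      have e1 := (hd₁ s hst.1).2.2
      rw [hs.self_of_nhds, (hd₂ s hst.2).2.2] at e1
      exact (mul_right_cancel₀ (by exact_mod_cast sub_ne_zero.2 hne) e1).symm
    refine htn ?_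
    filter_upwards [hball] with x hx
    rw [Metric.mem_ball, Real.dist_eq, lt_min_iff] at hx
    obtain ⟨-, h3, h4⟩ := hd₁ x hx.1
    obtain ⟨-, h5, h6⟩ := hd₂ x hx.2
    rw [htt] at h3
    exact hE.injective h3 h5 (by rw [h4, h6, hdd])
  intro t ht
  refine eq_of_frequently_eq h₁ h₂ ht ?_
  have hcl : t ∈ closure (interior (I₁ ∩ I₂)) := by
    rw [hconv.closure_interior_eq_closure_of_nonempty_interior ⟨m, hint hm⟩]
    exact subset_closure ht
  exact (mem_closure_iff_frequently.1 hcl).mono fun s hs =>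
    ⟨interior_subset hs, (hU hs).self_of_nhds⟩

/-- Two edge-parallel geodesics that agree on an overlap, the first one coming in from the left and
the second one going out to the right, are parts of one edge-parallel geodesic. -/
theorem exists_glue [Finite F] {γ₁ γ₂ : ℝ → S} {I₁ I₂ : Set ℝ}
    (h₁ : Q.IsEdgeParallelGeodesic γ₁ I₁) (h₂ : Q.IsEdgeParallelGeodesic γ₂ I₂) {a b : ℝ}
    (hab : a < b) (hsub : Ioo a b ⊆ I₁ ∩ I₂) (heq : EqOn γ₁ γ₂ (Ioo a b))
    (hl : I₂ ∩ Iio b ⊆ I₁) (hr : I₁ ∩ Ioi a ⊆ I₂) :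
    ∃ γ, Q.IsEdgeParallelGeodesic γ (I₁ ∪ I₂) ∧ EqOn γ₁ γ I₁ := by
  classical
  have heq' := eqOn_of_eqOn_Ioo h₁ h₂ hab hsub heq
  obtain ⟨m, hm⟩ : (Ioo a b).Nonempty := nonempty_Ioo.2 hab
  set γ : ℝ → S := fun x => if x < m then γ₁ x else γ₂ x with hγ
  have e₁ : EqOn γ₁ γ I₁ := by
    intro x hx
    simp only [hγ]
    split_ifs with hxm
    · rfl
    · exact heq' ⟨hx, hr ⟨hx, by rw [mem_Ioi]; linarith [hm.1]⟩⟩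
  have e₂ : EqOn γ₂ γ I₂ := by
    intro x hx
    simp only [hγ]
    split_ifs with hxm
    · exact (heq' ⟨hl ⟨hx, by rw [mem_Iio]; linarith [hm.2]⟩, hx⟩).symm
    · rfl
  refine ⟨γ, IsEdgeParallelGeodesic.of_local ?_ (h₁.nontrivial.mono subset_union_left) ?_, e₁⟩
  · exact (h₁.ordConnected.isPreconnected.union m (hsub hm).1 (hsub hm).2
      h₂.ordConnected.isPreconnected).ordConnected
  · intro t ht
    rcases lt_or_ge t b with htb | htb
    · refine ⟨b - t, by linarith, γ₁, I₁, h₁, fun x hx hxt => ?_⟩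
      have hxI : x ∈ I₁ := by
        rcases hx with hx | hx
        · exact hx
        · exact hl ⟨hx, by rw [mem_Iio]; linarith [(abs_lt.1 hxt).2]⟩
      exact ⟨hxI, (e₁ hxI).symm⟩
    · refine ⟨t - a, by linarith, γ₂, I₂, h₂, fun x hx hxt => ?_⟩
      have hxI : x ∈ I₂ := by
        rcases hx with hx | hx
        · exact hr ⟨hx, by rw [mem_Ioi]; linarith [(abs_lt.1 hxt).1]⟩
        · exact hx
      exact ⟨hxI, (e₂ hxI).symm⟩

theorem IsMaximalEdgeParallelGeodesic.subset_of_glue [Finite F] {γ₁ γ₂ : ℝ → S} {I₁ I₂ : Set ℝ}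
    (h₁ : Q.IsMaximalEdgeParallelGeodesic γ₁ I₁) (h₂ : Q.IsEdgeParallelGeodesic γ₂ I₂) {a b : ℝ}
    (hab : a < b) (hsub : Ioo a b ⊆ I₁ ∩ I₂) (heq : EqOn γ₁ γ₂ (Ioo a b))
    (hl : I₂ ∩ Iio b ⊆ I₁) (hr : I₁ ∩ Ioi a ⊆ I₂) : I₂ ⊆ I₁ := by
  obtain ⟨γ, hγ, he⟩ := exists_glue h₁.toIsEdgeParallelGeodesic h₂ hab hsub heq hl hr
  have := h₁.maximal γ _ hγ subset_union_left he
  rw [← this]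
  exact subset_union_right

/-! ### Straight pieces in faces -/

/-- At time `t` the curve `γ` starts to run in the face `b.1` from the point `b.2.1` of the square
in the direction of the axis-parallel unit vector `b.2.2`. -/
def IsGerm (Q : QuadMesh S F) (γ : ℝ → S) (t : ℝ) (b : F × ℂ × ℂ) : Prop :=
  b.2.2 ∈ axisUnits ∧ ∃ η > 0, ∀ s ∈ Icc 0 η, b.2.1 + s • b.2.2 ∈ unitSquare ∧
    γ (t + s) = Q.param b.1 (b.2.1 + s • b.2.2)

theorem IsGerm.mem {γ : ℝ → S} {t : ℝ} {b : F × ℂ × ℂ} (h : Q.IsGerm γ t b) :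
    b.2.1 ∈ unitSquare := by
  obtain ⟨-, η, hη, h⟩ := h
  simpa using (h 0 ⟨le_rfl, hη.le⟩).1

theorem IsGerm.param_eq {γ : ℝ → S} {t : ℝ} {b : F × ℂ × ℂ} (h : Q.IsGerm γ t b) :
    Q.param b.1 b.2.1 = γ t := by
  obtain ⟨-, η, hη, h⟩ := h
  simpa using (h 0 ⟨le_rfl, hη.le⟩).2.symm

theorem IsEdgeParallelGeodesic.exists_germ [Finite F] {γ : ℝ → S} {I : Set ℝ}
    (hγ : Q.IsEdgeParallelGeodesic γ I) {t : ℝ} (ht : t ∈ interior I) : ∃ b, Q.IsGerm γ t b := by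
  obtain ⟨E, A, δ, hE⟩ := exists_isDeveloping (hγ.regular t ht)
  obtain ⟨ε, hε, d, hd, hs⟩ := hγ.exists_straight ht hE
  obtain ⟨c, hc0, hcε⟩ := exists_between hε
  have hct : |t + c - t| < ε := by rwa [add_sub_cancel_left, abs_of_pos hc0]
  obtain ⟨f, w, hw, hfw⟩ := Q.exists_param (γ (t + c))
  obtain ⟨-, h1, h2⟩ := hs _ hct
  rw [← hfw] at h1 h2
  obtain ⟨z, hz, hwz⟩ := hE.near f w hw h1
  have ha := hE.unit f z hz
  have ha0 := ne_zero_of_mem_axisUnits ha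
  rw [hE.apply_param f z w hz hw hwz, add_sub_cancel_left] at h2
  have hv := mul_mem_axisUnits (inv_mem_axisUnits ha) hd
  have hwv : z + c • ((A f z)⁻¹ * d) = w := by
    have : w - z = c • ((A f z)⁻¹ * d) := by
      refine mul_left_cancel₀ ha0 ?_
      rw [h2, Complex.real_smul, mul_left_comm, mul_inv_cancel_left₀ ha0, mul_comm]
    rw [← this, add_sub_cancel]
  have hcδ : c < δ := by
    rwa [← hwv, dist_self_add_left, norm_smul, norm_of_mem_axisUnits hv, mul_one, Real.norm_eq_abs,
      abs_of_pos hc0] at hwz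
  refine ⟨(f, z, (A f z)⁻¹ * d), hv, c, hc0, fun s hsc => ?_⟩
  have hmem : z + s • ((A f z)⁻¹ * d) ∈ unitSquare :=
    add_smul_mem hz.1 (l := c) (by rwa [hwv]) hsc
  refine ⟨hmem, ?_⟩
  have hst : |t + s - t| < ε := by
    rw [add_sub_cancel_left, abs_of_nonneg hsc.1]; exact hsc.2.trans_lt hcε
  obtain ⟨-, h3, h4⟩ := hs _ hst
  have hdist : dist (z + s • ((A f z)⁻¹ * d)) z < δ := by
    rw [dist_self_add_left, norm_smul, norm_of_mem_axisUnits hv, mul_one, Real.norm_eq_abs,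
      abs_of_nonneg hsc.1]
    exact hsc.2.trans_lt hcδ
  refine hE.injective h3 ?_ ?_
  · rw [hE.meshDist_eq f z _ hz hmem hdist, edist_dist]
    exact (ENNReal.ofReal_lt_ofReal_iff hE.pos).2 hdist
  · rw [h4, hE.apply_param f z _ hz hmem hdist, add_sub_cancel_left, add_sub_cancel_left,
      Complex.real_smul, mul_left_comm, mul_inv_cancel_left₀ ha0, mul_comm]

theorem IsGerm.isEdgeParallelGeodesic [Finite F] {γ : ℝ → S} {t l : ℝ} {b : F × ℂ × ℂ}
    (hb : Q.IsGerm γ t b) (hl0 : 0 < l) (hl : b.2.1 + l • b.2.2 ∈ unitSquare) :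
    Q.IsEdgeParallelGeodesic (fun x => Q.param b.1 (b.2.1 + (x - t) • b.2.2)) (Icc t (t + l)) := by
  have h := (isEdgeParallelGeodesic_segment (Q := Q) b.1 hb.mem hb.1 hl0 hl).comp
    (IsometryEquiv.addRight (-t))
  have e : (IsometryEquiv.addRight (-t)) ⁻¹' Icc 0 l = Icc t (t + l) := by
    ext x
    simp only [IsometryEquiv.addRight_apply, mem_preimage, mem_Icc]
    constructor <;> rintro ⟨h1, h2⟩ <;> constructor <;> linarith
  rw [e] at h
  exact h

theorem exists_Icc_subset_of_mem_interior {I : Set ℝ} {t : ℝ} (ht : t ∈ interior I) :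
    ∃ κ > 0, Icc (t - κ) (t + κ) ⊆ I := by
  obtain ⟨κ, hκ, h⟩ := Metric.nhds_basis_closedBall.mem_iff.1 (mem_interior_iff_mem_nhds.1 ht)
  rw [Real.closedBall_eq_Icc] at h
  exact ⟨κ, hκ, h⟩

/-- A geodesic that starts straight in a face runs straight as long as this is possible. -/
theorem IsEdgeParallelGeodesic.eq_of_germ [Finite F] {γ : ℝ → S} {I : Set ℝ}
    (hγ : Q.IsEdgeParallelGeodesic γ I) {t l : ℝ} (ht : t ∈ interior I) {b : F × ℂ × ℂ}
    (hb : Q.IsGerm γ t b) (hl0 : 0 < l) (hl : b.2.1 + l • b.2.2 ∈ unitSquare) :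
    (∃ β > t, Ioo t β ⊆ I ∩ Icc t (t + l) ∧
      EqOn γ (fun x => Q.param b.1 (b.2.1 + (x - t) • b.2.2)) (Ioo t β)) ∧
    EqOn γ (fun x => Q.param b.1 (b.2.1 + (x - t) • b.2.2)) (I ∩ Icc t (t + l)) := by
  obtain ⟨η, hη, hgerm⟩ := hb.2
  obtain ⟨κ, hκ, hκI⟩ := exists_Icc_subset_of_mem_interior ht
  have h1 : ∃ β > t, Ioo t β ⊆ I ∩ Icc t (t + l) ∧
      EqOn γ (fun x => Q.param b.1 (b.2.1 + (x - t) • b.2.2)) (Ioo t β) := by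
    refine ⟨t + min η (min κ l), by simp [hη, hκ, hl0], fun x hx => ⟨hκI ?_, ?_⟩, fun x hx => ?_⟩
    · have := (min_le_right η (min κ l)).trans (min_le_left _ _)
      constructor <;> linarith [hx.1, hx.2]
    · have := (min_le_right η (min κ l)).trans (min_le_right _ _)
      constructor <;> linarith [hx.1, hx.2]
    · have := (hgerm (x - t) ⟨by linarith [hx.1], by linarith [hx.2, min_le_left η (min κ l)]⟩).2
      rwa [add_sub_cancel] at this
  refine ⟨h1, ?_⟩
  obtain ⟨β, hβ, hsub, heq⟩ := h1
  exact eqOn_of_eqOn_Ioo hγ (hb.isEdgeParallelGeodesic hl0 hl) hβ hsub heq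

/-- An axis-parallel line leaves the square at a time, and at a point, whose coordinates come from
the coordinates of the starting point. -/
theorem exists_exit {z v : ℂ} (hz : z ∈ unitSquare) (hv : v ∈ axisUnits) {Y : Set ℝ}
    (h0 : 0 ∈ Y) (h1 : 1 ∈ Y) (hY : ∀ y ∈ Y, 1 - y ∈ Y) (hre : z.re ∈ Y) (him : z.im ∈ Y) :
    ∃ l ∈ Y, z + l • v ∈ unitSquare ∧ (z + l • v).re ∈ Y ∧ (z + l • v).im ∈ Y ∧
      ∀ s : ℝ, z + s • v ∈ unitSquare → s ≤ l := by
  obtain ⟨⟨h2, h3⟩, h4, h5⟩ := mem_unitSquare.1 hz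
  rcases hv with rfl | rfl | rfl | rfl
  · refine ⟨1 - z.re, hY _ hre, ?_, by simpa using h1, by simpa using him, fun s hs => ?_⟩
    · simp [mem_unitSquare, h4, h5]
    · have := hs.1.2
      simp at this
      linarith
  · refine ⟨1 - z.im, hY _ him, ?_, by simpa using hre, by simpa using h1, fun s hs => ?_⟩
    · simp [mem_unitSquare, h2, h3]
    · have := hs.2.2
      simp at this
      linarith
  · refine ⟨z.re, hre, ?_, by simpa using h0, by simpa using him, fun s hs => ?_⟩
    · simp [mem_unitSquare, h4, h5]
    · have := hs.1.1
      simp at this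
      linarith
  · refine ⟨z.im, him, ?_, by simpa using hre, by simpa using h0, fun s hs => ?_⟩
    · simp [mem_unitSquare, h2, h3]
    · have := hs.2.1
      simp at this
      linarith

/-- The times at which a curve starts to run straight in a face from a point with coordinates in
the set `Y`. -/
def germTimes (Q : QuadMesh S F) (γ : ℝ → S) (I Y : Set ℝ) : Set ℝ :=
  {t | t ∈ interior I ∧ ∃ b, Q.IsGerm γ t b ∧ b.2.1.re ∈ Y ∧ b.2.1.im ∈ Y}

theorem exists_pos_le {Y : Set ℝ} (hY : Y.Finite) : ∃ m > 0, ∀ y ∈ Y, 0 < y → m ≤ y := by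
  have h : ∀ᶠ m in 𝓝[>] (0 : ℝ), ∀ y ∈ Y, 0 < y → m ≤ y := by
    rw [Filter.eventually_all_finite hY]
    intro y _
    by_cases hy : 0 < y
    · filter_upwards [Ioo_mem_nhdsGT hy] with m hm _ using hm.2.le
    · simp [hy]
  obtain ⟨m, h1, h2⟩ := (h.and self_mem_nhdsWithin).exists
  exact ⟨m, h2, h1⟩

theorem IsEdgeParallelGeodesic.interior_nonempty {γ : ℝ → S} {I : Set ℝ}
    (hγ : Q.IsEdgeParallelGeodesic γ I) : (interior I).Nonempty := by
  obtain ⟨a, ha, b, hb, hab⟩ := hγ.nontrivial.exists_lt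
  obtain ⟨m, hm⟩ := nonempty_Ioo.2 hab
  exact ⟨m, interior_maximal (Ioo_subset_Icc_self.trans (hγ.ordConnected.out ha hb)) isOpen_Ioo hm⟩

/-- The possible coordinates of the points at which a geodesic passes from face to face form a
finite set, so that the straight pieces of the geodesic have a minimal length `m`. -/
theorem IsEdgeParallelGeodesic.exists_germTimes [Finite F] {γ : ℝ → S} {I : Set ℝ}
    (hγ : Q.IsEdgeParallelGeodesic γ I) : ∃ Y : Set ℝ, Y.Finite ∧ (Q.germTimes γ I Y).Nonempty ∧
      ∃ m > 0, ∀ t ∈ Q.germTimes γ I Y, ∃ b l, Q.IsGerm γ t b ∧ m ≤ l ∧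
        b.2.1 + l • b.2.2 ∈ unitSquare ∧ (t + l ∈ interior I → t + l ∈ Q.germTimes γ I Y) := by
  obtain ⟨t₀, ht₀⟩ := hγ.interior_nonempty
  obtain ⟨b₀, hb₀⟩ := hγ.exists_germ ht₀
  have h0 : (0 : ℝ) ∈ coordSet b₀.2.1 := by simp [coordSet]
  have h1 : (1 : ℝ) ∈ coordSet b₀.2.1 := by simp [coordSet]
  refine ⟨coordSet b₀.2.1, coordSet_finite _,
    ⟨t₀, ht₀, b₀, hb₀, by simp [coordSet], by simp [coordSet]⟩, ?_⟩
  obtain ⟨m, hm, hmin⟩ := exists_pos_le (coordSet_finite b₀.2.1)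
  refine ⟨m, hm, ?_⟩
  rintro t ⟨ht, b, hb, hre, him⟩
  obtain ⟨l, hlY, hl, hlre, hlim, hlmax⟩ := exists_exit hb.mem hb.1 h0 h1 coordSet_symm hre him
  have hl0 : 0 < l := by
    obtain ⟨η, hη, h⟩ := hb.2
    exact hη.trans_le (hlmax η (h η ⟨hη.le, le_rfl⟩).1)
  refine ⟨b, l, hb, hmin l hlY hl0, hl, fun hint => ⟨hint, ?_⟩⟩
  obtain ⟨b', hb'⟩ := hγ.exists_germ hint
  refine ⟨b', hb', ?_⟩
  have he := (hγ.eq_of_germ ht hb hl0 hl).2 ⟨interior_subset hint, by linarith, le_rfl⟩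
  beta_reduce at he
  rw [add_sub_cancel_left, ← hb'.param_eq] at he
  exact coord_mem_of_param_eq h0 h1 coordSet_symm hl hb'.mem he.symm ⟨hlre, hlim⟩

/-- A geodesic whose domain is bounded above runs straight in a single face at the end. -/
theorem IsEdgeParallelGeodesic.exists_last_germ [Finite F] {γ : ℝ → S} {I : Set ℝ}
    (hγ : Q.IsEdgeParallelGeodesic γ I) (hI : BddAbove I) :
    ∃ t ∈ interior I, ∃ b l, Q.IsGerm γ t b ∧ 0 < l ∧ b.2.1 + l • b.2.2 ∈ unitSquare ∧
      ∀ x ∈ I, x ≤ t + l := by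
  obtain ⟨Y, -, hne, m, hm, hstep⟩ := hγ.exists_germTimes
  have hbdd : BddAbove (Q.germTimes γ I Y) := hI.mono fun t ht => interior_subset ht.1
  obtain ⟨t, ht, htm⟩ := exists_lt_of_lt_csSup hne
    (show sSup (Q.germTimes γ I Y) - m < sSup (Q.germTimes γ I Y) by linarith)
  obtain ⟨b, l, hb, hml, hl, hint⟩ := hstep t ht
  refine ⟨t, ht.1, b, l, hb, by linarith, hl, fun x hx => ?_⟩
  by_contra! hlt
  have hmem : t + l ∈ interior I :=
    interior_maximal (Ioo_subset_Icc_self.trans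
      (hγ.ordConnected.out (interior_subset ht.1) hx)) isOpen_Ioo ⟨by linarith, hlt⟩
  linarith [le_csSup hbdd (hint hmem)]

/-- A geodesic that can be followed for ever passes twice through the same germ, because there are
finitely many of them, and hence is periodic. -/
theorem IsEdgeParallelGeodesic.exists_period [Finite F] {γ : ℝ → S} {I : Set ℝ}
    (hγ : Q.IsEdgeParallelGeodesic γ I) (hI : ¬ BddAbove I) :
    ∃ T > 0, ∀ x ∈ I, x + T ∈ I ∧ γ (x + T) = γ x := by
  obtain ⟨Y, hY, hne, m, hm, hstep⟩ := hγ.exists_germTimes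
  have hup : ∀ x ∈ I, ∀ y ≥ x, y ∈ I := by
    intro x hx y hy
    obtain ⟨z, hz, hyz⟩ := not_bddAbove_iff.1 hI y
    exact hγ.ordConnected.out hx hz ⟨hy, hyz.le⟩
  have hinf : (Q.germTimes γ I Y).Infinite := by
    intro hfin
    have hbdd := hfin.bddAbove
    obtain ⟨t, ht, htm⟩ := exists_lt_of_lt_csSup hne
      (show sSup (Q.germTimes γ I Y) - m < sSup (Q.germTimes γ I Y) by linarith)
    obtain ⟨b, l, -, hml, -, hint⟩ := hstep t ht
    have hmem : t + l ∈ interior I :=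
      interior_maximal (fun x (hx : x ∈ Ioi t) => hup t (interior_subset ht.1) x (le_of_lt hx))
        isOpen_Ioi (show t < t + l by linarith)
    linarith [le_csSup hbdd (hint hmem)]
  have hb : ∀ t, ∃ b : F × ℂ × ℂ, t ∈ Q.germTimes γ I Y →
      Q.IsGerm γ t b ∧ b.2.1.re ∈ Y ∧ b.2.1.im ∈ Y := by
    intro t
    by_cases ht : t ∈ Q.germTimes γ I Y
    · obtain ⟨b, hb⟩ := ht.2
      exact ⟨b, fun _ => hb⟩
    · obtain ⟨t, ht'⟩ := hne
      obtain ⟨b, -⟩ := ht'.2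
      exact ⟨b, fun h => absurd h ht⟩
  choose b hb using hb
  have hfin : ((univ : Set F) ×ˢ ((fun a : ℝ × ℝ => (⟨a.1, a.2⟩ : ℂ)) '' (Y ×ˢ Y)) ×ˢ
      axisUnits).Finite :=
    finite_univ.prod (((hY.prod hY).image _).prod (by simp [axisUnits]))
  have hmaps : MapsTo b (Q.germTimes γ I Y) ((univ : Set F) ×ˢ
      ((fun a : ℝ × ℝ => (⟨a.1, a.2⟩ : ℂ)) '' (Y ×ˢ Y)) ×ˢ axisUnits) := fun t ht =>
    ⟨mem_univ _, ⟨((b t).2.1.re, (b t).2.1.im), (hb t ht).2, rfl⟩, (hb t ht).1.1⟩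
  obtain ⟨t, ht, t', ht', hne', hbb⟩ := hinf.exists_ne_map_eq_of_mapsTo hmaps hfin
  wlog hlt : t < t' generalizing t t'
  · exact this t' ht' t ht hne'.symm hbb.symm (lt_of_le_of_ne (not_lt.1 hlt) hne'.symm)
  obtain ⟨-, η, hη, hg⟩ := (hb t ht).1
  obtain ⟨-, η', hη', hg'⟩ := (hb t' ht').1
  have hshift := hγ.comp (IsometryEquiv.addRight (t' - t))
  have key : EqOn γ (γ ∘ IsometryEquiv.addRight (t' - t))
      (I ∩ (IsometryEquiv.addRight (t' - t)) ⁻¹' I) := by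
    refine eqOn_of_eqOn_Ioo hγ hshift (a := t) (b := t + min η η') (by simp [hη, hη'])
      (fun x hx => ?_) fun x hx => ?_
    · have hxI := hup t (interior_subset ht.1) x hx.1.le
      refine ⟨hxI, hup x hxI _ ?_⟩
      rw [IsometryEquiv.addRight_apply]
      linarith
    · have e1 := (hg (x - t) ⟨by linarith [hx.1], by linarith [hx.2, min_le_left η η']⟩).2
      have e2 := (hg' (x - t) ⟨by linarith [hx.1], by linarith [hx.2, min_le_right η η']⟩).2
      rw [← hbb, ← e1] at e2
      rw [Function.comp_apply, IsometryEquiv.addRight_apply]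
      rw [show t + (x - t) = x by ring, show t' + (x - t) = x + (t' - t) by ring] at e2
      exact e2.symm
  refine ⟨t' - t, by linarith, fun x hx => ?_⟩
  have hxI := hup x hx (x + (t' - t)) (by linarith)
  exact ⟨hxI, (key ⟨hx, hxI⟩).symm⟩

/-! ### Maximal edge-parallel geodesics -/

theorem IsMaximalEdgeParallelGeodesic.comp {γ : ℝ → S} {I : Set ℝ}
    (h : Q.IsMaximalEdgeParallelGeodesic γ I) (φ : ℝ ≃ᵢ ℝ) :
    Q.IsMaximalEdgeParallelGeodesic (γ ∘ φ) (φ ⁻¹' I) := by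
  refine ⟨h.toIsEdgeParallelGeodesic.comp φ, fun γ' I' hγ' hI heq => ?_⟩
  have h1 := h.maximal _ _ (hγ'.comp φ.symm) (fun x hx => ?_) (fun x hx => ?_)
  · rw [← h1, ← preimage_comp]
    ext x
    simp
  · exact hI (by simpa using hx)
  · have := heq (x := φ.symm x) (by simpa using hx)
    simpa using this

/-- A maximal geodesic whose domain is not bounded above is a closed loop. -/
theorem IsMaximalEdgeParallelGeodesic.periodic [Finite F] {γ : ℝ → S} {I : Set ℝ}
    (h : Q.IsMaximalEdgeParallelGeodesic γ I) (hI : ¬ BddAbove I) :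
    I = univ ∧ ∃ T > 0, Function.Periodic γ T := by
  obtain ⟨T, hT, hper⟩ := h.exists_period hI
  obtain ⟨t, ht⟩ := h.nontrivial.nonempty
  have hup : ∀ x ≥ t, x ∈ I := by
    intro x hx
    obtain ⟨z, hz, hyz⟩ := not_bddAbove_iff.1 hI x
    exact h.ordConnected.out ht hz ⟨hx, hyz.le⟩
  have hnat : ∀ n : ℕ, ∀ x ∈ I, γ (x + n * T) = γ x ∧ x + n * T ∈ I := by
    intro n x hx
    induction n with
    | zero => simpa using hx
    | succ n ih =>
      have := hper _ ih.2
      rw [show x + (n + 1 : ℕ) * T = x + n * T + T by push_cast; ring]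
      exact ⟨this.2.trans ih.1, this.1⟩
  have hint : ∀ x ∈ I, ∀ y ∈ I, ∀ k : ℤ, x = y + k * T → γ x = γ y := by
    intro x hx y hy k hk
    obtain ⟨n, rfl | rfl⟩ := k.eq_nat_or_neg
    · rw [hk]
      exact_mod_cast (hnat n y hy).1
    · have : y = x + n * T := by rw [hk]; push_cast; ring
      rw [this, (hnat n x hx).1]
  set γ' : ℝ → S := fun x => γ (toIocMod hT t x) with hγ'
  have hmod : ∀ x, toIocMod hT t x ∈ I := fun x =>
    hup _ (toIocMod_mem_Ioc hT t x).1.le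
  have hval : ∀ x, ∀ k : ℤ, x + k * T ∈ I → γ' x = γ (x + k * T) := by
    intro x k hx
    refine hint _ (hmod x) _ hx (-toIocDiv hT t x - k) ?_
    rw [toIocMod, zsmul_eq_mul]
    push_cast
    ring
  have heq : EqOn γ γ' I := by
    intro x hx
    have := hval x 0 (by simpa using hx)
    simpa using this.symm
  have hgeo : Q.IsEdgeParallelGeodesic γ' univ := by
    refine IsEdgeParallelGeodesic.of_local ordConnected_univ nontrivial_univ fun s _ => ?_
    obtain ⟨n, hn⟩ := exists_nat_gt ((t + 1 - s) / T)
    rw [div_lt_iff₀ hT] at hn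
    refine ⟨1, one_pos, _, _, h.toIsEdgeParallelGeodesic.comp (IsometryEquiv.addRight (n * T)),
      fun x _ hxs => ?_⟩
    have hx : x + ((n : ℤ) : ℝ) * T ∈ I :=
      hup _ (by push_cast; linarith [(abs_lt.1 hxs).1])
    have := hval x n hx
    push_cast at hx this
    exact ⟨hx, this⟩
  have huniv := h.maximal γ' univ hgeo (subset_univ _) heq
  refine ⟨huniv.symm, T, hT, fun x => ?_⟩
  rw [heq (huniv ▸ mem_univ (x + T)), heq (huniv ▸ mem_univ x)]
  simp only [hγ']
  rw [toIocMod_add_right]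

/-- A maximal geodesic whose domain is bounded above has an end point, which lies on the boundary
or is a singularity: the last straight piece of the geodesic can be followed up to its end in
the face, and beyond it in a flat chart around any other point. -/
theorem IsMaximalEdgeParallelGeodesic.exists_end [Finite F] [T2Space S] {γ : ℝ → S} {I : Set ℝ}
    (h : Q.IsMaximalEdgeParallelGeodesic γ I) (hI : BddAbove I) :
    ∃ b, IsGreatest I b ∧ γ b ∈ Q.boundary ∪ Q.singularSet := by
  obtain ⟨t, ht, ⟨f, z, v⟩, l, hb, hl0, hl, hmax⟩ := h.exists_last_germ hI
  dsimp only at hl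
  obtain ⟨⟨β, hβ, hsub, heq⟩, heq'⟩ := h.eq_of_germ ht hb hl0 hl
  dsimp only at heq heq'
  obtain ⟨κ, hκ, hκI⟩ := exists_Icc_subset_of_mem_interior ht
  have htI := interior_subset ht
  have hIcc : Icc t (t + l) ⊆ I := by
    refine h.subset_of_glue (hb.isEdgeParallelGeodesic hl0 hl) hβ hsub heq (fun x hx => ?_)
      fun x hx => ⟨hx.2.le, hmax x hx.1⟩
    rcases eq_or_lt_of_le hx.1.1 with rfl | htx
    · exact htI
    · exact (hsub ⟨htx, hx.2⟩).1
  have hbI : t + l ∈ I := hIcc ⟨by linarith, le_rfl⟩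
  refine ⟨t + l, ⟨hbI, hmax⟩, ?_⟩
  by_contra hcon
  rw [mem_union, not_or] at hcon
  obtain ⟨hbd, hreg⟩ := hcon
  obtain ⟨E, A, δ, hE⟩ := exists_isDeveloping hreg
  rw [localModel_of_notMem hbd] at hE
  have hfib : (f, z + l • v) ∈ Q.fibre (γ (t + l)) := by
    refine ⟨hl, ?_⟩
    have := heq' ⟨hbI, by linarith, le_rfl⟩
    beta_reduce at this
    rw [this, add_sub_cancel_left]
  set d : ℂ := A f (z + l • v) * v with hd
  have hdu : d ∈ axisUnits := mul_mem_axisUnits (hE.unit _ _ hfib) hb.1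
  -- the straight line in the developing map through the end point, in the direction of the end
  have hG : ∀ x : ℝ, ∃ q, |x - (t + l)| < δ → Q.meshDist (γ (t + l)) q < ENNReal.ofReal δ ∧
      E q = d * ((x - (t + l) : ℝ) : ℂ) := by
    intro x
    by_cases hx : |x - (t + l)| < δ
    · obtain ⟨q, hq⟩ := hE.cover (d * ((x - (t + l) : ℝ) : ℂ)) (mem_univ _) (by
        rwa [norm_mul, norm_of_mem_axisUnits hdu, one_mul, Complex.norm_real, Real.norm_eq_abs])
      exact ⟨q, fun _ => hq⟩
    · exact ⟨γ t, fun h => absurd h hx⟩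
  choose G hG using hG
  obtain ⟨ε, hε, hgeo⟩ := hE.geodesic_of_straight (γ := G) (I := univ) (t := t + l) hdu hE.pos
    fun s _ hs => hG s hs
  obtain ⟨r, hr, hrsub⟩ := (Q.nhds_hasBasis (γ (t + l))).mem_iff.1
    (Q.finite_singularSet.isClosed.isOpen_compl.mem_nhds hreg)
  obtain ⟨ρ, hρ⟩ : ∃ ρ, ρ = min (min ε r) (min δ l) := ⟨_, rfl⟩
  have hρ0 : 0 < ρ := by rw [hρ]; exact lt_min (lt_min hε hr) (lt_min hE.pos hl0)
  have hρ1 : ρ ≤ ε := hρ ▸ (min_le_left _ _).trans (min_le_left _ _)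
  have hρ2 : ρ ≤ r := hρ ▸ (min_le_left _ _).trans (min_le_right _ _)
  have hρ3 : ρ ≤ δ := hρ ▸ (min_le_right _ _).trans (min_le_left _ _)
  have hρ4 : ρ ≤ l := hρ ▸ (min_le_right _ _).trans (min_le_right _ _)
  have habs : ∀ x ∈ Ioo (t + l - ρ) (t + l + ρ), |x - (t + l)| < ρ := fun x hx =>
    abs_lt.2 ⟨by linarith [hx.1], by linarith [hx.2]⟩
  have hGgeo : Q.IsEdgeParallelGeodesic G (Ioo (t + l - ρ) (t + l + ρ)) := by
    refine ⟨ordConnected_Ioo, ⟨t + l, ⟨by linarith, by linarith⟩, t + l + ρ / 2,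
      ⟨by linarith, by linarith⟩, by linarith⟩, fun x _ => ⟨1, one_pos, fun s hs s' hs' _ _ => ?_⟩,
      fun x _ => ⟨1, one_pos, fun s hs s' hs' _ _ => ?_⟩, fun x hx => ?_⟩
    · exact (hgeo s (mem_univ _) s' (mem_univ _) ((habs s hs).trans_le hρ1)
        ((habs s' hs').trans_le hρ1)).1
    · exact (hgeo s (mem_univ _) s' (mem_univ _) ((habs s hs).trans_le hρ1)
        ((habs s' hs').trans_le hρ1)).2
    · have hx' := habs x (interior_subset hx)
      obtain ⟨h1, h2⟩ := hG x (hx'.trans_le hρ3)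
      refine hrsub ?_
      change Q.meshDist _ _ < _
      rw [hE.meshDist_eq_norm h1, h2, norm_mul, norm_of_mem_axisUnits hdu, one_mul,
        Complex.norm_real, Real.norm_eq_abs]
      exact (ENNReal.ofReal_lt_ofReal_iff hr).2 (hx'.trans_le hρ2)
  have hsub' : Ioo (t + l - ρ) (t + l) ⊆ Icc t (t + l) := fun x hx =>
    ⟨by linarith [hx.1], hx.2.le⟩
  have hext := h.subset_of_glue hGgeo (a := t + l - ρ) (b := t + l) (by linarith)
    (fun x hx => ⟨hIcc (hsub' hx), hx.1, by linarith [hx.2]⟩) (fun x hx => ?_)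
    (fun x hx => hIcc (hsub' ⟨hx.1.1, hx.2⟩))
    (fun x hx => ⟨hx.2, by linarith [hmax x hx.1]⟩)
  · have := hmax _ (hext (show t + l + ρ / 2 ∈ _ from ⟨by linarith, by linarith⟩))
    linarith
  · have hx' := habs x ⟨hx.1, by linarith [hx.2]⟩
    obtain ⟨h1, h2⟩ := hG x (hx'.trans_le hρ3)
    have hxI := hsub' hx
    have hmem : z + (x - t) • v ∈ unitSquare :=
      add_smul_mem hb.mem hl ⟨by linarith [hxI.1], by linarith [hxI.2]⟩
    have hdist : dist (z + (x - t) • v) (z + l • v) < δ := by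
      rw [dist_add_smul hb.1, sub_sub]
      exact hx'.trans_le hρ3
    have e := heq' ⟨hIcc hxI, hxI⟩
    beta_reduce at e
    rw [e]
    refine hE.injective ?_ h1 ?_
    · rw [hE.meshDist_eq _ _ _ hfib hmem hdist, edist_dist]
      exact (ENNReal.ofReal_lt_ofReal_iff hE.pos).2 hdist
    · rw [h2, hE.apply_param _ _ _ hfib hmem hdist, add_sub_add_left_eq_sub, ← sub_smul, sub_sub,
        hd, Complex.real_smul (x := x - (t + l)), mul_assoc, mul_comm v]

theorem IsMaximalEdgeParallelGeodesic.loop_or_compact [Finite F] [T2Space S] {γ : ℝ → S}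
    {I : Set ℝ} (h : Q.IsMaximalEdgeParallelGeodesic γ I) :
    (I = univ ∧ ∃ T > 0, Function.Periodic γ T) ∨
      ∃ a b, a < b ∧ I = Icc a b ∧ γ a ∈ Q.boundary ∪ Q.singularSet ∧
        γ b ∈ Q.boundary ∪ Q.singularSet := by
  by_cases hu : BddAbove I
  swap
  · exact Or.inl (h.periodic hu)
  have hneg := h.comp (IsometryEquiv.neg ℝ)
  have hpre : (IsometryEquiv.neg ℝ) ⁻¹' I = -I := rfl
  rw [hpre] at hneg
  by_cases hl : BddAbove (-I)
  swap
  · left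
    obtain ⟨h1, T, hT, hper⟩ := hneg.periodic hl
    refine ⟨by rw [← neg_neg I, h1]; exact neg_univ, T, hT, fun x => ?_⟩
    have : γ (-(-x - T + T)) = γ (-(-x - T)) := hper (-x - T)
    rw [show (-(-x - T + T) : ℝ) = x by ring, show (-(-x - T) : ℝ) = x + T by ring] at this
    exact this.symm
  right
  obtain ⟨b, hb, hγb⟩ := h.exists_end hu
  obtain ⟨a, ha, hγa⟩ := hneg.exists_end hl
  have hIcc : I = Icc (-a) b := by
    refine Subset.antisymm (fun x hx => ⟨?_, hb.2 hx⟩) (h.ordConnected.out ha.1 hb.1)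
    have : -x ∈ -I := by simpa using hx
    linarith [ha.2 this]
  refine ⟨-a, b, ?_, hIcc, hγa, hγb⟩
  have := h.nontrivial
  rw [hIcc] at this
  by_contra hab
  exact this.not_subsingleton (subsingleton_Icc_of_ge (not_lt.1 hab))

/-- Every edge-parallel geodesic has a maximal continuation: the union of a chain of continuations,
considered as graphs, is a continuation. -/
theorem IsEdgeParallelGeodesic.exists_maximal {γ : ℝ → S} {I : Set ℝ}
    (hγ : Q.IsEdgeParallelGeodesic γ I) :
    ∃ γ' I', Q.IsMaximalEdgeParallelGeodesic γ' I' ∧ I ⊆ I' ∧ EqOn γ γ' I := by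
  classical
  let graph : (ℝ → S) → Set ℝ → Set (ℝ × S) := fun γ I => (fun x => (x, γ x)) '' I
  have hgraph : ∀ γ I γ' I', graph γ I ⊆ graph γ' I' ↔ I ⊆ I' ∧ EqOn γ γ' I := by
    intro γ I γ' I'
    constructor
    · intro h
      have : ∀ x ∈ I, x ∈ I' ∧ γ x = γ' x := by
        intro x hx
        obtain ⟨y, hy, hyx⟩ := h ⟨x, hx, rfl⟩
        simp only [Prod.mk.injEq] at hyx
        obtain ⟨rfl, h2⟩ := hyx
        exact ⟨hy, h2.symm⟩
      exact ⟨fun x hx => (this x hx).1, fun x hx => (this x hx).2⟩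
    · rintro ⟨h1, h2⟩ _ ⟨x, hx, rfl⟩
      exact ⟨x, h1 hx, by simp [h2 hx]⟩
  have hzorn : ∀ c ⊆ {R | ∃ γ I, Q.IsEdgeParallelGeodesic γ I ∧ R = graph γ I},
      IsChain (· ⊆ ·) c → c.Nonempty →
      ∃ ub ∈ {R | ∃ γ I, Q.IsEdgeParallelGeodesic γ I ∧ R = graph γ I}, ∀ R ∈ c, R ⊆ ub := by
    intro c hc hchain hne
    have hdir : ∀ R ∈ c, ∀ R' ∈ c, ∃ R'' ∈ c, R ⊆ R'' ∧ R' ⊆ R'' := by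
      intro R hR R' hR'
      rcases hchain.total hR hR' with h | h
      · exact ⟨R', hR', h, Subset.rfl⟩
      · exact ⟨R, hR, Subset.rfl, h⟩
    set J : Set ℝ := {x | ∃ q, (x, q) ∈ ⋃₀ c} with hJ
    let γ' : ℝ → S := fun x => if h : ∃ q, (x, q) ∈ ⋃₀ c then h.choose else γ x
    have hmem : ∀ R ∈ c, ∀ γ₁ I₁, R = graph γ₁ I₁ → ∀ x ∈ I₁, x ∈ J ∧ γ' x = γ₁ x := by
      rintro R hR γ₁ I₁ rfl x hx
      have hxc : (x, γ₁ x) ∈ ⋃₀ c := ⟨_, hR, x, hx, rfl⟩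
      have h : ∃ q, (x, q) ∈ ⋃₀ c := ⟨_, hxc⟩
      refine ⟨h, ?_⟩
      simp only [γ']
      rw [dif_pos h]
      obtain ⟨R', hR', hxR'⟩ := h.choose_spec
      obtain ⟨R'', hR'', h1, h2⟩ := hdir _ hR _ hR'
      obtain ⟨γ₂, I₂, -, rfl⟩ := hc hR''
      obtain ⟨y, -, hy⟩ := h1 ⟨x, hx, rfl⟩
      obtain ⟨y', -, hy'⟩ := h2 hxR'
      simp only [Prod.mk.injEq] at hy hy'
      rw [← hy.2, ← hy'.2, hy.1, hy'.1]
    have hcover : ∀ x ∈ J, ∀ y ∈ J, ∀ z ∈ J, ∃ γ₁ I₁, Q.IsEdgeParallelGeodesic γ₁ I₁ ∧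
        (∀ x ∈ I₁, x ∈ J ∧ γ' x = γ₁ x) ∧ x ∈ I₁ ∧ y ∈ I₁ ∧ z ∈ I₁ := by
      rintro x ⟨qx, Rx, hRx, hx⟩ y ⟨qy, Ry, hRy, hy⟩ z ⟨qz, Rz, hRz, hz⟩
      obtain ⟨R, hR, h1, h2⟩ := hdir _ hRx _ hRy
      obtain ⟨R', hR', h3, h4⟩ := hdir _ hR _ hRz
      obtain ⟨γ₁, I₁, hγ₁, rfl⟩ := hc hR'
      have hin : ∀ x q, (x, q) ∈ graph γ₁ I₁ → x ∈ I₁ := by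
        rintro x q ⟨y, hy, hyx⟩
        rwa [← (Prod.mk.inj hyx).1]
      exact ⟨γ₁, I₁, hγ₁, hmem _ hR' _ _ rfl, hin _ _ (h3 (h1 hx)), hin _ _ (h3 (h2 hy)),
        hin _ _ (h4 hz)⟩
    refine ⟨graph γ' J, ⟨γ', J, IsEdgeParallelGeodesic.of_local ?_ ?_ ?_, rfl⟩, fun R hR => ?_⟩
    · refine ⟨fun x hx y hy => ?_⟩
      obtain ⟨γ₁, I₁, h₁, hin, hx₁, hy₁, -⟩ := hcover x hx y hy y hy
      exact fun z hz => (hin z (h₁.ordConnected.out hx₁ hy₁ hz)).1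
    · obtain ⟨R, hR⟩ := hne
      obtain ⟨γ₁, I₁, h₁, hR₁⟩ := hc hR
      exact h₁.nontrivial.mono fun x hx => (hmem R hR γ₁ I₁ hR₁ x hx).1
    · intro t ht
      -- a neighbourhood of `t` in `J` lies between two points of `J`
      have hlo : ∃ lo ∈ J, ∃ ε > 0, ∀ x ∈ J, |x - t| < ε → lo ≤ x := by
        by_cases h : ∃ lo ∈ J, lo < t
        · obtain ⟨lo, h1, h2⟩ := h
          exact ⟨lo, h1, t - lo, by linarith, fun x _ hx => by linarith [(abs_lt.1 hx).1]⟩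
        · push Not at h
          exact ⟨t, ht, 1, one_pos, fun x hx _ => h x hx⟩
      have hhi : ∃ hi ∈ J, ∃ ε > 0, ∀ x ∈ J, |x - t| < ε → x ≤ hi := by
        by_cases h : ∃ hi ∈ J, t < hi
        · obtain ⟨hi, h1, h2⟩ := h
          exact ⟨hi, h1, hi - t, by linarith, fun x _ hx => by linarith [(abs_lt.1 hx).2]⟩
        · push Not at h
          exact ⟨t, ht, 1, one_pos, fun x hx _ => h x hx⟩
      obtain ⟨lo, hloJ, ε, hε, hlo⟩ := hlo
      obtain ⟨hi, hhiJ, ε', hε', hhi⟩ := hhi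
      obtain ⟨γ₁, I₁, h₁, hin, hlo₁, hhi₁, -⟩ := hcover lo hloJ hi hhiJ hi hhiJ
      refine ⟨min ε ε', lt_min hε hε', γ₁, I₁, h₁, fun x hx hxt => ?_⟩
      have hx₁ : x ∈ I₁ := h₁.ordConnected.out hlo₁ hhi₁
        ⟨hlo x hx (hxt.trans_le (min_le_left _ _)), hhi x hx (hxt.trans_le (min_le_right _ _))⟩
      exact ⟨hx₁, (hin x hx₁).2⟩
    · obtain ⟨γ₁, I₁, h₁, hR₁⟩ := hc hR
      have := hmem R hR γ₁ I₁ hR₁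
      rw [hR₁, hgraph]
      exact ⟨fun x hx => (this x hx).1, fun x hx => (this x hx).2.symm⟩
  obtain ⟨m, hm, hmax⟩ := zorn_subset_nonempty _ hzorn (graph γ I) ⟨γ, I, hγ, rfl⟩
  obtain ⟨γ', I', hγ', rfl⟩ := hmax.prop
  rw [hgraph] at hm
  refine ⟨γ', I', ⟨hγ', fun γ'' I'' h'' hI heq => ?_⟩, hm⟩
  have := hmax.le_of_ge ⟨γ'', I'', h'', rfl⟩ ((hgraph _ _ _ _).2 ⟨hI, heq⟩)
  exact Subset.antisymm ((hgraph _ _ _ _).1 this).1 hI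

end QuadMesh

theorem theorem1 {S F : Type*} [TopologicalSpace S] [T2Space S] [Finite F] (Q : QuadMesh S F) :
    -- Gauss-Bonnet condition
    ((∀ p ∉ Q.singularSet, ∃ e : OpenPartialHomeomorph S (Q.localModel p),
        p ∈ e.source ∧ Q.IsFlatChart e) ∧
      Q.singularSet.Finite ∧
      (∀ v ∈ Q.vertices, Q.curvature v = Q.index v * (Real.pi / 2)) ∧
      ∑ᶠ v ∈ Q.singularSet, Q.curvature v = 2 * Real.pi * Q.eulerChar) ∧
    -- holonomy condition: the crosses form a global parallel, hence smooth, cross field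
    ((∀ f, Q.holonomyGroup f ≤ quarterTurns) ∧
      (∀ f, IsCross (Q.crossField f)) ∧
      (∀ f g A, Q.Transport f g A → A '' Q.crossField f = Q.crossField g) ∧
      (∀ p ∉ Q.singularSet, ∃ e : OpenPartialHomeomorph S (Q.localModel p),
        p ∈ e.source ∧ Q.IsFlatChart e ∧ Q.CrossFieldConstantIn e)) ∧
    -- boundary alignment condition
    (∀ f i, Q.mate (f, i) = (f, i) → ∀ u ∈ Q.crossField f,
      (∃ r : ℝ, sideDir i = r • u) ∨ inner ℝ (sideDir i) u = 0) ∧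
    -- finite geodesic lamination condition
    ((∀ f, ∀ z ∈ unitSquare, ∀ u ∈ Q.crossField f, ∀ l : ℝ, 0 < l → z + l • u ∈ unitSquare →
        Q.IsEdgeParallelGeodesic (fun t => Q.param f (z + t • u)) (Icc 0 l)) ∧
      (∀ γ I, Q.IsEdgeParallelGeodesic γ I →
        ∃ γ' I', Q.IsMaximalEdgeParallelGeodesic γ' I' ∧ I ⊆ I' ∧ EqOn γ γ' I) ∧
      (∀ γ I, Q.IsMaximalEdgeParallelGeodesic γ I →
        (I = univ ∧ ∃ T > 0, Function.Periodic γ T) ∨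
        ∃ a b, a < b ∧ I = Icc a b ∧ γ a ∈ Q.boundary ∪ Q.singularSet ∧
          γ b ∈ Q.boundary ∪ Q.singularSet)) := by
  refine ⟨⟨fun p hp => ?_, Q.finite_singularSet, fun v _ => QuadMesh.curvature_eq v,
      QuadMesh.gauss_bonnet⟩,
    ⟨fun f A hA => ?_, QuadMesh.isCross_crossField, fun f g A hA => ?_,
      fun p hp => QuadMesh.exists_chart_crossFieldConstant hp⟩,
    fun f i _ u hu => ?_, fun f z hz u hu l hl hzl => ?_, fun γ I h => h.exists_maximal,
    fun γ I h => h.loop_or_compact⟩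
  · obtain ⟨e, hp, he, -⟩ := QuadMesh.exists_chart_crossFieldConstant hp
    exact ⟨e, hp, he⟩
  · obtain ⟨u, hu, hAu⟩ := QuadMesh.Transport.exists_rotation hA
    exact QuadMesh.mem_quarterTurns hu hAu
  · obtain ⟨u, hu, hAu⟩ := hA.exists_rotation
    rw [QuadMesh.crossField_eq, QuadMesh.crossField_eq, funext hAu, mul_image_axisUnits hu]
  · rw [QuadMesh.crossField_eq] at hu
    exact QuadMesh.parallel_or_orthogonal (sideDir_mem_axisUnits i) hu
  · rw [QuadMesh.crossField_eq] at hu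
    exact QuadMesh.isEdgeParallelGeodesic_segment f hz hu hl hzl
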